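/- **Theorem 1 (security of S-SIP$_1$).** Let $\kappa$ be the security parameter. Let $p=p(\kappa)$ be a prime with polynomially many digits and $1/p$ negligible, and let $k,m,n,t,\ell$ be polynomially bounded functions of $\kappa$. The client $P_0$ holds $(x_1,s_1),\dots,(x_t,s_t)$ and the server $P_1$ holds $(y_1,g_1),\dots,(y_n,g_n)$ with pairwise distinct keys $y_i$, where $x_j,y_i\in\{0,1\}^\ell$ and $s_j,g_i\in\mathbb F_p$. Put $u_j=s_jg_i$ if $x_j=y_i$ for some $i$, and $u_j=0$ otherwise. The functionality S-SIP chooses $r\in\mathbb F_p^t$ uniformly and gives $u-r$ to $P_0$ and $r$ to $P_1$. *Protocol S-SIP$_1$.* Offline: the server chooses the seed of an efficient family of hash functions $h_1,\dots,h_k:\{0,1\}^\ell\to[m]$ and a key pair $(pk,sk)$ of a homomorphic encryption scheme with plaintext space $\mathbb F_p$, and sends the seed and $pk$. It builds the Bloom filter $BF\in\{0,1\}^m$ of $\{y_1,\dots,y_n\}$ and a garbled Bloom filter $GBF\in\mathbb F_p^m$: for $i=1,\dots,n$ in turn, the still empty positions among $h_1(y_i),\dots,h_k(y_i)$ are filled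 with random values subject to $\sum_{a}GBF[h_a(y_i)]=g_i$ (the server aborts if this is impossible), and finally all remaining positions are filled uniformly. It sends encryptions $ct.BF$, $ct.GBF$ of all entries. Online, for each $j$ (residues modulo $k+1$ of elements of $\mathbb F_p$ are those of their representatives of least absolute value): (a) the client sends $\nu=\sum_a ct.BF[h_a(x_j)]-\mathtt{Enc}(pk,\mu)$ for uniform $\mu\in\mathbb F_p$; the server decrypts it to $\mu'$, picks a uniform bit $b_1$, and is the sender in a 1-out-of-$(k+1)$ OT whose inputs are all $b_1$, except for $1\oplus b_1$ at position $(k-\mu')\bmod(k+1)$; the client chooses position $\mu\bmod(k+1)$ and receives $b_0$; (b) the client sends $\nu'=\mathtt{Enc}(pk,s_j)\cdot\sum_a ct.GBF[h_a(x_j)]-\mathtt{Enc}(pk,\delta)$ for uniform $\delta\in\mathbb F_p$; the server decrypts it to $\rho$; (c) the client, with uniform $\Delta\in\mathbb F_p$, is the sender in a 1-out-of-2 OT with inputs $\Delta+b_0\delta$ and $\Delta+(1-b_0)\delta$, and the server chooses $b_1$ and receives $r$; the server, with uniform $\alpha_j\in\mathbb F_p$, is the sender in a 1-out-of-2 OT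 with inputs $r+b_1(\rho-\alpha_j)-(1-b_1)\alpha_j$ and $r+(1-b_1)(\rho-\alpha_j)-b_1\alpha_j$, and the client chooses $b_0$ and receives $r'$. The shares of $u_j$ are $r'-\Delta$ for the client and $\alpha_j$ for the server. *Assumptions.* (i) The hash functions and the parameters $k,m$ are such that, for every set $Q$ of at most $n$ keys and every key $x\notin Q$, the probability (over the seed) that $x$ passes the Bloom filter check for $Q$ is negligible. (ii) The homomorphic encryption scheme runs in polynomial time, decrypts correctly (up to negligible error) after homomorphic evaluation of arithmetic formulas of polynomial size and degree at most $2$, and is secure against semi-honest parties: it is semantically secure, and it is function private, i.e. the result of such an evaluation, after homomorphic addition of a fresh encryption of a mask, can be simulated in polynomial time from $pk$ and its plaintext alone, even towards a key holder who knows all random tapes used for key generation and for the encryption of the input ciphertexts. (iii) The two oblivious transfer protocols used (1-out-of-$(k+1)$ for bits and 1-out-of-2 for elements of $\mathbb F_p$) run in polynomial time and securely realize the OT functionality against a semi-honest sender and a semi-honest receiver. *Conclusion.* S-SIP$_1$ securely realizes the functionality S-SIP against a semi-honest client and against a semi-honest server. That is, for each of the two parties there is a polynomial-time simulator which, given this party's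 input and its output from the functionality, produces a view such that the simulated view together with both outputs of the functionality is computationally indistinguishable, for all sequences of inputs, from the party's real view (its random choices and received messages) together with both real outputs. Polynomial time and indistinguishability are non-uniform (probabilistic circuits of polynomial size); secure realization in (iii) is meant in the same sense. -/

import Mathlib

open Filter Topology
open scoped BigOperators

noncomputable section

/- ## Asymptotics and elementary probability -/

/-- Bit strings of length `n`. -/
abbrev Bits (n : ℕ) : Type := Fin n → Bool

/-- `f` is bounded by a polynomial in the security parameter. -/
def PolyBounded (f : ℕ → ℕ) : Prop :=
  ∃ P : Polynomial ℕ, ∀ κ, f κ ≤ P.eval κ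

/-- `f` decreases faster than the inverse of every polynomial. -/
def Negligible (f : ℕ → ℝ) : Prop :=
  Asymptotics.SuperpolynomialDecay atTop (fun κ : ℕ => (κ : ℝ)) f

/-- The uniform distribution on a finite nonempty type. -/
def unif (α : Type) [Fintype α] [Nonempty α] : PMF α := PMF.uniformOfFintype α

/-- The probability of an event. -/
def prob {α : Type} (P : PMF α) (s : Set α) : ℝ := (P.toOuterMeasure s).toReal

/-- Independent samples from `f 0, …, f (r - 1)`. -/
def indep {α : Type} : (r : ℕ) → (Fin r → PMF α) → PMF (Fin r → α)
  | 0, _ => PMF.pure Fin.elim0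
  | r + 1, f => do
      let a ← f 0
      let v ← indep r (fun i => f i.succ)
      return Fin.cons a v

/- ## Computational model: families of probabilistic circuits of polynomial size

Wires carry elements of `𝔽_p`, and bits are the field elements `0` and `1`. Since `bit b` reads a
binary digit, and `p` has polynomially many digits in the theorem, this is the usual non-uniform
probabilistic polynomial time, with exact uniform sampling from `𝔽_p` in addition. -/

/-- The gates of a circuit whose existing wires are indexed by `α`. -/
inductive Gate (p : ℕ) (α : Type) : Type
  /-- a constant -/
  | const (c : ZMod p)
  /-- the sum of two wires -/
  | add (i j : α)
  /-- the product of two wires -/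
  | mul (i j : α)
  /-- binary digit number `b` of the representative in `[0, p)` of a wire -/
  | bit (b : ℕ) (i : α)
  /-- a uniform random bit -/
  | flip
  /-- a uniform random field element -/
  | rand

/-- Circuits with inputs `α` and outputs `β`: each step applies a gate to existing wires and adds
one new wire; at the end the output wires are selected. -/
inductive Circuit (p : ℕ) (β : Type) : Type → Type 1
  | out {α : Type} (f : β → α) : Circuit p β α
  | step {α : Type} (g : Gate p α) (C : Circuit p β (Option α)) : Circuit p β α

/-- The number of gates. -/
def Circuit.size {p : ℕ} {β : Type} : {α : Type} → Circuit p β α → ℕ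
  | _, .out _ => 0
  | _, .step _ C => C.size + 1

/-- The bit `b` as a field element. -/
def bitF (p : ℕ) (b : Bool) : ZMod p := if b then 1 else 0

def Gate.eval {p : ℕ} [Fact p.Prime] {α : Type} (w : α → ZMod p) : Gate p α → PMF (ZMod p)
  | .const c => PMF.pure c
  | .add i j => PMF.pure (w i + w j)
  | .mul i j => PMF.pure (w i * w j)
  | .bit b i => PMF.pure (bitF p ((w i).val.testBit b))
  | .flip => (unif Bool).map (bitF p)
  | .rand => unif (ZMod p)

/-- The distribution of the output wires of a circuit, given the values of its input wires. -/
def Circuit.eval {p : ℕ} [Fact p.Prime] {β : Type} :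
    {α : Type} → Circuit p β α → (α → ZMod p) → PMF (β → ZMod p)
  | _, .out f, w => PMF.pure fun o => w (f o)
  | _, .step g C, w => (g.eval w).bind fun v => C.eval fun o => o.elim v w

/-- A data type together with its representation on wires. -/
class Data (p : ℕ) (α : Type) where
  Idx : Type
  enc : α → Idx → ZMod p

/-- Represent `α` through a map to a represented type. -/
@[reducible] def Data.via {p : ℕ} {α β : Type} [Data p β] (f : α → β) : Data p α where
  Idx := Data.Idx p β
  enc a := Data.enc (f a)

instance (p : ℕ) : Data p Unit where
  Idx := Empty
  enc _ i := i.elim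

instance (p : ℕ) : Data p Bool where
  Idx := Unit
  enc b _ := bitF p b

instance (p : ℕ) : Data p (ZMod p) where
  Idx := Unit
  enc x _ := x

/-- An index is represented by its indicator vector. -/
instance (p n : ℕ) : Data p (Fin n) where
  Idx := Fin n
  enc a i := bitF p (decide (i = a))

instance (p : ℕ) (α β : Type) [Data p α] [Data p β] : Data p (α × β) where
  Idx := Data.Idx p α ⊕ Data.Idx p β
  enc a := Sum.elim (Data.enc a.1) (Data.enc a.2)

instance (p n : ℕ) (α : Type) [Data p α] : Data p (Fin n → α) where
  Idx := Fin n × Data.Idx p α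
  enc a i := Data.enc (a i.1) i.2

/-- An optional value is represented by a flag and the value; everything is `0` for `none`. -/
instance (p : ℕ) (α : Type) [Data p α] : Data p (Option α) where
  Idx := Option (Data.Idx p α)
  enc a i := a.elim 0 fun v => i.elim 1 (Data.enc v)

/-- The family of randomized functions `f` is computed by probabilistic circuits of
polynomial size. -/
def PolyTime (p : ℕ → ℕ) [∀ κ, Fact (p κ).Prime] {α β : ℕ → Type}
    [∀ κ, Data (p κ) (α κ)] [∀ κ, Data (p κ) (β κ)] (f : ∀ κ, α κ → PMF (β κ)) : Prop :=
  ∃ C : ∀ κ, Circuit (p κ) (Data.Idx (p κ) (β κ)) (Data.Idx (p κ) (α κ)),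
    PolyBounded (fun κ => (C κ).size) ∧
      ∀ κ a, (C κ).eval (Data.enc a) = (f κ a).map Data.enc

/-- Computational indistinguishability (against non-uniform distinguishers). -/
def Indist (p : ℕ → ℕ) [∀ κ, Fact (p κ).Prime] {α : ℕ → Type} [∀ κ, Data (p κ) (α κ)]
    (X Y : ∀ κ, PMF (α κ)) : Prop :=
  ∀ D : ∀ κ, α κ → PMF Bool, PolyTime p D →
    Negligible fun κ => prob ((X κ).bind (D κ)) {true} - prob ((Y κ).bind (D κ)) {true}

/- ## Simulation-based security of two-party protocols against semi-honest parties -/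

/-- The execution `exec` of a two-party protocol, which yields the two views and the two outputs,
securely realizes the randomized functionality `F` on valid inputs against a semi-honest party `0`
and against a semi-honest party `1`: a polynomial-time simulator is given the input and the output
of the corrupted party, and the simulated view jointly with both outputs of the functionality is
indistinguishable from the real view jointly with both real outputs. Views consist of the random
choices and the received messages. (The inputs are fixed sequences, known to the non-uniform
distinguisher.) -/
def SecurelyRealizes (p : ℕ → ℕ) [∀ κ, Fact (p κ).Prime]
    {In₀ In₁ View₀ View₁ Out₀ Out₁ : ℕ → Type}
    [∀ κ, Data (p κ) (In₀ κ)] [∀ κ, Data (p κ) (In₁ κ)]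
    [∀ κ, Data (p κ) (View₀ κ)] [∀ κ, Data (p κ) (View₁ κ)]
    [∀ κ, Data (p κ) (Out₀ κ)] [∀ κ, Data (p κ) (Out₁ κ)]
    (valid : ∀ κ, In₀ κ → In₁ κ → Prop)
    (exec : ∀ κ, In₀ κ → In₁ κ → PMF (View₀ κ × View₁ κ × Out₀ κ × Out₁ κ))
    (F : ∀ κ, In₀ κ → In₁ κ → PMF (Out₀ κ × Out₁ κ)) : Prop :=
  (∃ Sim₀ : ∀ κ, In₀ κ × Out₀ κ → PMF (View₀ κ), PolyTime p Sim₀ ∧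
    ∀ (a : ∀ κ, In₀ κ) (b : ∀ κ, In₁ κ), (∀ κ, valid κ (a κ) (b κ)) →
      Indist p (α := fun κ => View₀ κ × Out₀ κ × Out₁ κ)
        (fun κ => do
          let o ← F κ (a κ) (b κ)
          let v ← Sim₀ κ (a κ, o.1)
          return (v, o.1, o.2))
        (fun κ => do
          let e ← exec κ (a κ) (b κ)
          return (e.1, e.2.2.1, e.2.2.2))) ∧
  (∃ Sim₁ : ∀ κ, In₁ κ × Out₁ κ → PMF (View₁ κ), PolyTime p Sim₁ ∧
    ∀ (a : ∀ κ, In₀ κ) (b : ∀ κ, In₁ κ), (∀ κ, valid κ (a κ) (b κ)) →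
      Indist p (α := fun κ => View₁ κ × Out₀ κ × Out₁ κ)
        (fun κ => do
          let o ← F κ (a κ) (b κ)
          let v ← Sim₁ κ (b κ, o.2)
          return (v, o.1, o.2))
        (fun κ => do
          let e ← exec κ (a κ) (b κ)
          return (e.2.1, e.2.2.1, e.2.2.2)))

/- ## Interactive two-party protocols and oblivious transfer -/

/-- A two-party protocol at one security level. In each round party `0` sends a message and then
party `1` sends a message; a message depends on the input, the coins, the round and the messages
received so far. -/
structure TwoParty (In₀ In₁ Out₀ Out₁ : Type) where
  rounds : ℕ
  msgLen : ℕ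
  coins₀ : ℕ
  coins₁ : ℕ
  msg₀ : In₀ → Bits coins₀ → Fin rounds → (Fin rounds → Option (Bits msgLen)) → Bits msgLen
  msg₁ : In₁ → Bits coins₁ → Fin rounds → (Fin rounds → Option (Bits msgLen)) → Bits msgLen
  out₀ : In₀ → Bits coins₀ → (Fin rounds → Option (Bits msgLen)) → Out₀
  out₁ : In₁ → Bits coins₁ → (Fin rounds → Option (Bits msgLen)) → Out₁

namespace TwoParty

variable {In₀ In₁ Out₀ Out₁ : Type}

/-- Received messages; `none` for the rounds that have not yet taken place. -/
abbrev Inbox (π : TwoParty In₀ In₁ Out₀ Out₁) : Type := Fin π.rounds → Option (Bits π.msgLen)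

abbrev View₀ (π : TwoParty In₀ In₁ Out₀ Out₁) : Type := Bits π.coins₀ × π.Inbox

abbrev View₁ (π : TwoParty In₀ In₁ Out₀ Out₁) : Type := Bits π.coins₁ × π.Inbox

/-- The messages received by party `0` and by party `1` in the first `i` rounds. -/
def inboxes (π : TwoParty In₀ In₁ Out₀ Out₁) (a : In₀) (b : In₁) (c₀ : Bits π.coins₀)
    (c₁ : Bits π.coins₁) : ℕ → π.Inbox × π.Inbox
  | 0 => (fun _ => none, fun _ => none)
  | i + 1 =>
    let r := π.inboxes a b c₀ c₁ i
    if h : i < π.rounds then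
      let r₁ := Function.update r.2 ⟨i, h⟩ (some (π.msg₀ a c₀ ⟨i, h⟩ r.1))
      (Function.update r.1 ⟨i, h⟩ (some (π.msg₁ b c₁ ⟨i, h⟩ r₁)), r₁)
    else r

/-- The execution of the protocol: both views and both outputs. -/
def exec (π : TwoParty In₀ In₁ Out₀ Out₁) (a : In₀) (b : In₁) :
    PMF (π.View₀ × π.View₁ × Out₀ × Out₁) := do
  let c₀ ← unif (Bits π.coins₀)
  let c₁ ← unif (Bits π.coins₁)
  let r := π.inboxes a b c₀ c₁ π.rounds
  return ((c₀, r.1), (c₁, r.2), π.out₀ a c₀ r.1, π.out₁ b c₁ r.2)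

end TwoParty

/-- Both parties of the protocol run in polynomial time. -/
def TwoParty.Efficient (p : ℕ → ℕ) [∀ κ, Fact (p κ).Prime] {In₀ In₁ Out₀ Out₁ : ℕ → Type}
    [∀ κ, Data (p κ) (In₀ κ)] [∀ κ, Data (p κ) (In₁ κ)]
    [∀ κ, Data (p κ) (Out₀ κ)] [∀ κ, Data (p κ) (Out₁ κ)]
    (π : ∀ κ, TwoParty (In₀ κ) (In₁ κ) (Out₀ κ) (Out₁ κ)) : Prop :=
  PolyBounded (fun κ => (π κ).rounds) ∧ PolyBounded (fun κ => (π κ).msgLen) ∧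
  PolyBounded (fun κ => (π κ).coins₀) ∧ PolyBounded (fun κ => (π κ).coins₁) ∧
  PolyTime p (α := fun κ => In₀ κ × Bits (π κ).coins₀ × Fin (π κ).rounds × (π κ).Inbox)
    (β := fun κ => Bits (π κ).msgLen)
    (fun κ v => PMF.pure ((π κ).msg₀ v.1 v.2.1 v.2.2.1 v.2.2.2)) ∧
  PolyTime p (α := fun κ => In₁ κ × Bits (π κ).coins₁ × Fin (π κ).rounds × (π κ).Inbox)
    (β := fun κ => Bits (π κ).msgLen)
    (fun κ v => PMF.pure ((π κ).msg₁ v.1 v.2.1 v.2.2.1 v.2.2.2)) ∧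
  PolyTime p (α := fun κ => In₀ κ × Bits (π κ).coins₀ × (π κ).Inbox) (β := Out₀)
    (fun κ v => PMF.pure ((π κ).out₀ v.1 v.2.1 v.2.2)) ∧
  PolyTime p (α := fun κ => In₁ κ × Bits (π κ).coins₁ × (π κ).Inbox) (β := Out₁)
    (fun κ v => PMF.pure ((π κ).out₁ v.1 v.2.1 v.2.2))

/-- The type of 1-out-of-`N` oblivious transfer protocols for messages in `M`: the sender is
party `0`, the receiver is party `1`. -/
abbrev OTProtocol (N : ℕ) (M : Type) : Type := TwoParty (Fin N → M) (Fin N) Unit M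

/-- The functionality of 1-out-of-`N` oblivious transfer. -/
def otFunctionality {N : ℕ} {M : Type} (a : Fin N → M) (c : Fin N) : PMF (Unit × M) :=
  PMF.pure ((), a c)

/-- `π` is a polynomial-time oblivious transfer, secure against semi-honest parties. -/
def OTSecure (p : ℕ → ℕ) [∀ κ, Fact (p κ).Prime] {N : ℕ → ℕ} {M : ℕ → Type}
    [∀ κ, Data (p κ) (M κ)] (π : ∀ κ, OTProtocol (N κ) (M κ)) : Prop :=
  TwoParty.Efficient p π ∧
  SecurelyRealizes p (fun _ _ _ => True) (fun κ => (π κ).exec) (fun _ => otFunctionality)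

/- ## Homomorphic encryption -/

/-- The algorithms of a public-key homomorphic encryption scheme with plaintext space `𝔽_p`, at
one security level; the last argument of a randomized algorithm is its random tape. -/
structure HEScheme (p : ℕ) where
  pkLen : ℕ
  skLen : ℕ
  ctLen : ℕ
  genLen : ℕ
  encLen : ℕ
  sumLen : ℕ → ℕ
  mulLen : ℕ → ℕ
  keyGen : Bits genLen → Bits pkLen × Bits skLen
  enc : Bits pkLen → ZMod p → Bits encLen → Bits ctLen
  dec : Bits skLen → Bits ctLen → ZMod p
  evalSum : Bits pkLen → (r : ℕ) → (Fin r → Bits ctLen) → Bits (sumLen r) → Bits ctLen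
  evalMul : Bits pkLen → (r : ℕ) → (Fin r → Bits ctLen) → Bits (mulLen r) → Bits ctLen

/-- Arithmetic formulas: `inp i` is a given ciphertext, `own a` a fresh encryption of `a` made by
the evaluating party. -/
inductive Formula (p : ℕ) (ι : Type) : Type
  | inp (i : ι)
  | own (a : ZMod p)
  | sum (r : ℕ) (f : Fin r → Formula p ι)
  | mul (r : ℕ) (f : Fin r → Formula p ι)

namespace Formula

variable {p : ℕ} {ι : Type}

def size : Formula p ι → ℕ
  | inp _ => 1
  | own _ => 1
  | sum _ f => 1 + ∑ i, (f i).size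
  | mul _ f => 1 + ∑ i, (f i).size

/-- The degree in the ciphertexts, the given ones and the fresh ones. -/
def degree : Formula p ι → ℕ
  | inp _ => 1
  | own _ => 1
  | sum _ f => Finset.univ.sup fun i => (f i).degree
  | mul _ f => ∑ i, (f i).degree

/-- The value on plaintexts. -/
def value (x : ι → ZMod p) : Formula p ι → ZMod p
  | inp i => x i
  | own a => a
  | sum _ f => ∑ i, (f i).value x
  | mul _ f => ∏ i, (f i).value x

end Formula

namespace HEScheme

variable {p : ℕ}

abbrev PK (H : HEScheme p) : Type := Bits H.pkLen

abbrev SK (H : HEScheme p) : Type := Bits H.skLen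

abbrev CT (H : HEScheme p) : Type := Bits H.ctLen

/-- Homomorphic evaluation of a formula on ciphertexts. -/
def evalFormula (H : HEScheme p) {ι : Type} (pk : H.PK) (c : ι → H.CT) : Formula p ι → PMF H.CT
  | .inp i => PMF.pure (c i)
  | .own a => do
      let ω ← unif (Bits H.encLen)
      return H.enc pk a ω
  | .sum r f => do
      let cs ← indep r (fun i => H.evalFormula pk c (f i))
      let ω ← unif (Bits (H.sumLen r))
      return H.evalSum pk r cs ω
  | .mul r f => do
      let cs ← indep r (fun i => H.evalFormula pk c (f i))
      let ω ← unif (Bits (H.mulLen r))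
      return H.evalMul pk r cs ω

/-- The key holder generates keys and encrypts `x`, and another party evaluates `e` on the
ciphertexts: the random tapes of the key holder, and the evaluated ciphertext. -/
def evalGame (H : HEScheme p) {M : ℕ} (x : Fin M → ZMod p) (e : Formula p (Fin M)) :
    PMF (Bits H.genLen × (Fin M → Bits H.encLen) × H.CT) := do
  let g ← unif (Bits H.genLen)
  let ω ← unif (Fin M → Bits H.encLen)
  let z ← H.evalFormula (H.keyGen g).1 (fun i => H.enc (H.keyGen g).1 (x i) (ω i)) e
  return (g, ω, z)

/-- A public key with an encryption of `a`. -/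
def encGame (H : HEScheme p) (a : ZMod p) : PMF (H.PK × H.CT) := do
  let g ← unif (Bits H.genLen)
  let ω ← unif (Bits H.encLen)
  return ((H.keyGen g).1, H.enc (H.keyGen g).1 a ω)

end HEScheme

section HESecurity

variable (p : ℕ → ℕ) [∀ κ, Fact (p κ).Prime] (H : ∀ κ, HEScheme (p κ))

/-- All algorithms of the scheme run in polynomial time. -/
def HEEfficient : Prop :=
  PolyBounded (fun κ => (H κ).pkLen) ∧ PolyBounded (fun κ => (H κ).skLen) ∧
  PolyBounded (fun κ => (H κ).ctLen) ∧ PolyBounded (fun κ => (H κ).genLen) ∧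
  PolyBounded (fun κ => (H κ).encLen) ∧
  PolyTime p (α := fun κ => Bits (H κ).genLen) (β := fun κ => (H κ).PK × (H κ).SK)
    (fun κ v => PMF.pure ((H κ).keyGen v)) ∧
  PolyTime p (α := fun κ => (H κ).PK × ZMod (p κ) × Bits (H κ).encLen) (β := fun κ => (H κ).CT)
    (fun κ v => PMF.pure ((H κ).enc v.1 v.2.1 v.2.2)) ∧
  PolyTime p (α := fun κ => (H κ).SK × (H κ).CT) (β := fun κ => ZMod (p κ))
    (fun κ v => PMF.pure ((H κ).dec v.1 v.2)) ∧
  ∀ r : ℕ → ℕ, PolyBounded r →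
    PolyBounded (fun κ => (H κ).sumLen (r κ)) ∧ PolyBounded (fun κ => (H κ).mulLen (r κ)) ∧
    PolyTime p
      (α := fun κ => (H κ).PK × (Fin (r κ) → (H κ).CT) × Bits ((H κ).sumLen (r κ)))
      (β := fun κ => (H κ).CT)
      (fun κ v => PMF.pure ((H κ).evalSum v.1 (r κ) v.2.1 v.2.2)) ∧
    PolyTime p
      (α := fun κ => (H κ).PK × (Fin (r κ) → (H κ).CT) × Bits ((H κ).mulLen (r κ)))
      (β := fun κ => (H κ).CT)
      (fun κ v => PMF.pure ((H κ).evalMul v.1 (r κ) v.2.1 v.2.2))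

/-- Correctness of decryption after homomorphic evaluation of formulas of polynomial size and
degree at most two. -/
def HECorrect : Prop :=
  ∀ (M : ℕ → ℕ) (x : ∀ κ, Fin (M κ) → ZMod (p κ)) (e : ∀ κ, Formula (p κ) (Fin (M κ))),
    PolyBounded M → PolyBounded (fun κ => (e κ).size) → (∀ κ, (e κ).degree ≤ 2) →
    Negligible fun κ => prob ((H κ).evalGame (x κ) (e κ))
      {v | (H κ).dec ((H κ).keyGen v.1).2 v.2.2 ≠ (e κ).value (x κ)}

/-- Semantic security against a party that holds the public key (encryptions of any two
plaintexts are indistinguishable). -/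
def HESemanticSecurity : Prop :=
  ∀ a b : ∀ κ, ZMod (p κ), Indist p (α := fun κ => (H κ).PK × (H κ).CT)
    (fun κ => (H κ).encGame (a κ)) (fun κ => (H κ).encGame (b κ))

/-- Function privacy against the semi-honest key holder: an evaluated ciphertext to which the
evaluating party has added a fresh encryption of a mask `b` can be simulated from the public key
and its plaintext alone, even given all random tapes of the key holder. -/
def HEFunctionPrivacy : Prop :=
  ∃ Sim : ∀ κ, (H κ).PK × ZMod (p κ) → PMF (H κ).CT, PolyTime p Sim ∧
    ∀ (M : ℕ → ℕ) (x : ∀ κ, Fin (M κ) → ZMod (p κ)) (e : ∀ κ, Formula (p κ) (Fin (M κ)))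
      (b : ∀ κ, ZMod (p κ)),
      PolyBounded M → PolyBounded (fun κ => (e κ).size) → (∀ κ, (e κ).degree ≤ 2) →
      Indist p (α := fun κ => Bits (H κ).genLen × (Fin (M κ) → Bits (H κ).encLen) × (H κ).CT)
        (fun κ => (H κ).evalGame (x κ) (.sum 2 ![e κ, .own (b κ)]))
        (fun κ => do
          let g ← unif (Bits (H κ).genLen)
          let ω ← unif (Fin (M κ) → Bits (H κ).encLen)
          let z ← Sim κ (((H κ).keyGen g).1, (e κ).value (x κ) + b κ)
          return (g, ω, z))

/-- `H` is a polynomial-time homomorphic encryption scheme, secure against semi-honest parties. -/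
def HESecure : Prop :=
  HEEfficient p H ∧ HECorrect p H ∧ HESemanticSecurity p H ∧ HEFunctionPrivacy p H

end HESecurity

/- ## Bloom filters and garbled Bloom filters -/

/-- A family of `k`-tuples of hash functions from `ℓ`-bit strings to the `m` positions of a Bloom
filter, indexed by a seed. -/
structure HashFamily (l k m : ℕ) where
  seedLen : ℕ
  hash : Bits seedLen → Fin k → Bits l → Fin m

/-- The hash functions can be described and evaluated in polynomial time. -/
def HashEfficient (p l k m : ℕ → ℕ) [∀ κ, Fact (p κ).Prime]
    (h : ∀ κ, HashFamily (l κ) (k κ) (m κ)) : Prop :=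
  PolyBounded (fun κ => (h κ).seedLen) ∧
  PolyTime p (α := fun κ => Bits (h κ).seedLen × Bits (l κ)) (β := fun κ => Fin (k κ) → Fin (m κ))
    (fun κ v => PMF.pure fun i => (h κ).hash v.1 i v.2)

/-- Bit `q` of the Bloom filter of the set of keys `Q` is set. -/
def BFSet {l k m : ℕ} (h : Fin k → Bits l → Fin m) (Q : Set (Bits l)) (q : Fin m) : Prop :=
  ∃ y ∈ Q, ∃ i, h i y = q

/-- For a set of at most `n` keys, a key outside the set passes the Bloom filter check with
negligible probability only. -/
def BFReliable (l k m n : ℕ → ℕ) (h : ∀ κ, HashFamily (l κ) (k κ) (m κ)) : Prop :=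
  ∀ (Q : ∀ κ, Finset (Bits (l κ))) (x : ∀ κ, Bits (l κ)),
    (∀ κ, (Q κ).card ≤ n κ) → (∀ κ, x κ ∉ Q κ) →
    Negligible fun κ => prob (unif (Bits (h κ).seedLen))
      {s | ∀ i, BFSet ((h κ).hash s) (Q κ) ((h κ).hash s i (x κ))}

/-- A partially filled garbled Bloom filter; `none` stands for `⊥`. -/
abbrev GBFTable (p m : ℕ) : Type := Fin m → Option (ZMod p)

section GBF

variable {p k m : ℕ} [Fact p.Prime]

open Classical in
/-- The tables that result from `T` by filling exactly the empty ones among the positions `pos`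
in such a way that the entries at `pos` sum to `v`. -/
def gbfFillings (T : GBFTable p m) (pos : Fin k → Fin m) (v : ZMod p) :
    Finset (GBFTable p m) :=
  Finset.univ.filter fun T' =>
    (∀ q, (T q ≠ none ∨ ∀ j, pos j ≠ q) → T' q = T q) ∧
    (∀ j, T' (pos j) ≠ none) ∧ ∑ j, (T' (pos j)).getD 0 = v

open Classical in
/-- Successive insertion of values, given by their positions, into a garbled Bloom filter. Empty
positions are filled with random values subject to the required sum. The Boolean tells whether
all insertions have succeeded; the process stops at the first failure. -/
def gbfInsertAll : List ((Fin k → Fin m) × ZMod p) → GBFTable p m → PMF (GBFTable p m × Bool)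
  | [], T => PMF.pure (T, true)
  | e :: L, T =>
    if h : (gbfFillings T e.1 e.2).Nonempty then
      (PMF.uniformOfFinset (gbfFillings T e.1 e.2) h).bind (gbfInsertAll L)
    else PMF.pure (T, false)

/-- Fill the remaining empty positions with uniformly random values. -/
def gbfFinish (T : GBFTable p m) : PMF (Fin m → ZMod p) := do
  let w ← unif (Fin m → ZMod p)
  return fun q => (T q).getD (w q)

end GBF

/- ## The protocol S-SIP₁ -/

/-- The building blocks of the protocol at one security level: homomorphic encryption, hash
functions, 1-out-of-`(k+1)` oblivious transfer of bits, and 1-out-of-2 oblivious transfer of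
field elements. -/
structure Blocks (p l k m : ℕ) where
  he : HEScheme p
  hf : HashFamily l k m
  otB : OTProtocol (k + 1) Bool
  otF : OTProtocol 2 (ZMod p)

/-- The residue of the integer `z` modulo `k + 1`, as an index. -/
def modIdx (k : ℕ) (z : ℤ) : Fin (k + 1) :=
  ⟨(z % ((k : ℤ) + 1)).toNat, by
    have h1 := Int.emod_nonneg z (show (k : ℤ) + 1 ≠ 0 by omega)
    have h2 := Int.emod_lt_of_pos z (show (0 : ℤ) < (k : ℤ) + 1 by omega)
    omega⟩

/-- A bit as the choice in a 1-out-of-2 oblivious transfer. -/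
def choice (b : Bool) : Fin 2 := if b then 1 else 0

section Protocol

variable {p l k m : ℕ}

/-- The client's view of the treatment of one query: its masks `μ`, `δ`, `Δ`, its random tapes for
homomorphic operations, and its views of the three oblivious transfers. -/
structure ClientQueryView (B : Blocks p l k m) where
  μ : ZMod p
  δ : ZMod p
  Δ : ZMod p
  ωsum : Bits (B.he.sumLen k)
  ωμ : Bits B.he.encLen
  ων : Bits (B.he.sumLen 2)
  ωsum' : Bits (B.he.sumLen k)
  ωs : Bits B.he.encLen
  ωmul : Bits (B.he.mulLen 2)
  ωδ : Bits B.he.encLen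
  ων' : Bits (B.he.sumLen 2)
  ot₁ : B.otB.View₁
  ot₂ : B.otF.View₀
  ot₃ : B.otF.View₁

/-- The server's view of the treatment of one query: its random choices `b` and `α`, the received
ciphertexts, and its views of the three oblivious transfers. -/
structure ServerQueryView (B : Blocks p l k m) where
  b : Bool
  α : ZMod p
  ν : B.he.CT
  ν' : B.he.CT
  ot₁ : B.otB.View₀
  ot₂ : B.otF.View₁
  ot₃ : B.otF.View₀

/-- The client's view: the hash functions, the public key and, unless the server aborts, the
encrypted Bloom filter and garbled Bloom filter and the views of the `t` queries. -/
structure ClientView (B : Blocks p l k m) (t : ℕ) where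
  seed : Bits B.hf.seedLen
  pk : B.he.PK
  rest : Option ((Fin m → B.he.CT) × (Fin m → B.he.CT) × (Fin t → ClientQueryView B))

/-- The server's view: its random choices of hash functions, keys and entries of the garbled Bloom
filter and, unless it aborts, the completed garbled Bloom filter, the random tapes of the
encryptions, and the views of the `t` queries. -/
structure ServerView (B : Blocks p l k m) (t : ℕ) where
  seed : Bits B.hf.seedLen
  gen : Bits B.he.genLen
  table : GBFTable p m
  rest : Option ((Fin m → ZMod p) × (Fin m → Bits B.he.encLen) × (Fin m → Bits B.he.encLen) ×
    (Fin t → ServerQueryView B))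

instance (B : Blocks p l k m) : Data p (ClientQueryView B) :=
  Data.via fun v => (v.μ, v.δ, v.Δ, v.ωsum, v.ωμ, v.ων, v.ωsum', v.ωs, v.ωmul, v.ωδ, v.ων',
    v.ot₁, v.ot₂, v.ot₃)

instance (B : Blocks p l k m) : Data p (ServerQueryView B) :=
  Data.via fun v => (v.b, v.α, v.ν, v.ν', v.ot₁, v.ot₂, v.ot₃)

instance (B : Blocks p l k m) (t : ℕ) : Data p (ClientView B t) :=
  Data.via fun v => (v.seed, v.pk, v.rest)

instance (B : Blocks p l k m) (t : ℕ) : Data p (ServerView B t) :=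
  Data.via fun v => (v.seed, v.gen, v.table, v.rest)

variable [Fact p.Prime]

/-- The online phase for one query `(x, s)`, where `ctB` and `ctG` are the encrypted Bloom filter
and garbled Bloom filter: the views of client and server and their shares. Field elements are
reduced modulo `k + 1` through their representatives of least absolute value. -/
def ssipOnline (B : Blocks p l k m) (seed : Bits B.hf.seedLen) (pk : B.he.PK) (sk : B.he.SK)
    (ctB ctG : Fin m → B.he.CT) (x : Bits l) (s : ZMod p) :
    PMF (ClientQueryView B × ServerQueryView B × ZMod p × ZMod p) := do
  -- secure membership check
  let μ ← unif (ZMod p)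
  let ωsum ← unif (Bits (B.he.sumLen k))
  let ωμ ← unif (Bits B.he.encLen)
  let ων ← unif (Bits (B.he.sumLen 2))
  let ν := B.he.evalSum pk 2
    ![B.he.evalSum pk k (fun i => ctB (B.hf.hash seed i x)) ωsum, B.he.enc pk (-μ) ωμ] ων
  let μ' := B.he.dec sk ν
  let b₁ ← unif Bool
  let ot₁ ← B.otB.exec
    (fun i => if i = modIdx k ((k : ℤ) - μ'.valMinAbs) then !b₁ else b₁) (modIdx k μ.valMinAbs)
  let b₀ := ot₁.2.2.2
  -- secure associated value extraction
  let δ ← unif (ZMod p)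
  let ωsum' ← unif (Bits (B.he.sumLen k))
  let ωs ← unif (Bits B.he.encLen)
  let ωmul ← unif (Bits (B.he.mulLen 2))
  let ωδ ← unif (Bits B.he.encLen)
  let ων' ← unif (Bits (B.he.sumLen 2))
  let ν' := B.he.evalSum pk 2
    ![B.he.evalMul pk 2
        ![B.he.enc pk s ωs, B.he.evalSum pk k (fun i => ctG (B.hf.hash seed i x)) ωsum'] ωmul,
      B.he.enc pk (-δ) ωδ] ων'
  let ρ := B.he.dec sk ν'
  -- secure component product
  let Δ ← unif (ZMod p)
  let ot₂ ← B.otF.exec ![Δ + bitF p b₀ * δ, Δ + (1 - bitF p b₀) * δ] (choice b₁)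
  let r := ot₂.2.2.2
  let α ← unif (ZMod p)
  let ot₃ ← B.otF.exec
    ![r + bitF p b₁ * (ρ - α) - (1 - bitF p b₁) * α,
      r + (1 - bitF p b₁) * (ρ - α) - bitF p b₁ * α] (choice b₀)
  let r' := ot₃.2.2.2
  let viewC : ClientQueryView B :=
    { μ := μ, δ := δ, Δ := Δ, ωsum := ωsum, ωμ := ωμ, ων := ων, ωsum' := ωsum', ωs := ωs,
      ωmul := ωmul, ωδ := ωδ, ων' := ων', ot₁ := ot₁.2.1, ot₂ := ot₂.1, ot₃ := ot₃.2.1 }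
  let viewS : ServerQueryView B :=
    { b := b₁, α := α, ν := ν, ν' := ν', ot₁ := ot₁.1, ot₂ := ot₂.2.1, ot₃ := ot₃.1 }
  return (viewC, viewS, r' - Δ, α)

open Classical in
/-- The execution of S-SIP₁ on the client's queries `(x_j, s_j)` and the server's key-value pairs
`(y_i, g_i)`: both views and both outputs, where the output `none` means that the server has
aborted. -/
def ssip₁ (B : Blocks p l k m) {t n : ℕ} (XS : Fin t → Bits l × ZMod p)
    (YG : Fin n → Bits l × ZMod p) :
    PMF (ClientView B t × ServerView B t ×
      Option (Fin t → ZMod p) × Option (Fin t → ZMod p)) := do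
  -- offline phase
  let seed ← unif (Bits B.hf.seedLen)
  let gen ← unif (Bits B.he.genLen)
  let pk := (B.he.keyGen gen).1
  let sk := (B.he.keyGen gen).2
  let T ← gbfInsertAll (List.ofFn fun i => (fun j => B.hf.hash seed j (YG i).1, (YG i).2))
    (fun _ => none)
  if T.2 then
    let gbf ← gbfFinish T.1
    let ωB ← unif (Fin m → Bits B.he.encLen)
    let ωG ← unif (Fin m → Bits B.he.encLen)
    let ctB := fun q => B.he.enc pk
      (if BFSet (B.hf.hash seed) (Set.range fun i => (YG i).1) q then 1 else 0) (ωB q)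
    let ctG := fun q => B.he.enc pk (gbf q) (ωG q)
    -- online phase
    let res ← indep t fun j => ssipOnline B seed pk sk ctB ctG (XS j).1 (XS j).2
    let viewC : ClientView B t :=
      { seed := seed, pk := pk, rest := some (ctB, ctG, fun j => (res j).1) }
    let viewS : ServerView B t :=
      { seed := seed, gen := gen, table := T.1,
        rest := some (gbf, ωB, ωG, fun j => (res j).2.1) }
    return (viewC, viewS, some fun j => (res j).2.2.1, some fun j => (res j).2.2.2)
  else
    let viewC : ClientView B t := { seed := seed, pk := pk, rest := none }
    let viewS : ServerView B t := { seed := seed, gen := gen, table := T.1, rest := none }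
    return (viewC, viewS, none, none)

open Classical in
/-- The vector that is to be shared: `s_j g_i` if `x_j = y_i` for some `i`, and `0` otherwise. -/
def ssipTarget {t n : ℕ} (XS : Fin t → Bits l × ZMod p) (YG : Fin n → Bits l × ZMod p) :
    Fin t → ZMod p :=
  fun j => if h : ∃ i, (XS j).1 = (YG i).1 then (XS j).2 * (YG h.choose).2 else 0

/-- The functionality S-SIP: uniformly random additive shares of the target vector. -/
def ssipFunctionality {t n : ℕ} (XS : Fin t → Bits l × ZMod p) (YG : Fin n → Bits l × ZMod p) :
    PMF (Option (Fin t → ZMod p) × Option (Fin t → ZMod p)) := do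
  let r ← unif (Fin t → ZMod p)
  return (some (ssipTarget XS YG - r), some r)

end Protocol

end

noncomputable section

open scoped ENNReal NNReal

set_option linter.unusedSectionVars false

/- ## Composition of circuits -/

/-! The real execution is compared with an ideal one, `ssipIdeal`, in which the server never aborts,
decryption returns the correct plaintext, and every oblivious transfer (OT) returns the prescribed
value.

Correctness. Call a seed good if no query is a false positive for the server's keys and no key is a
false positive for the keys inserted before it (`GoodSeed`); a union bound makes all other seeds
negligible. For a good seed every insertion finds an empty position, and because k < p the required
sum can be solved for one of the new entries, so the server does not abort. Let c be the number of
set filter positions among the k positions of a query. Then c = k exactly for members. The client's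
choice is μ, the flipped position is k - μ' with μ' = c - μ; unless the reduction modulo p wraps
around, which has probability at most k/p, the two agree modulo k+1 iff c = k (`modIdx_membership`).
Hence b₀ is b₁ xor the membership bit, in the remaining transfers the mask δ cancels, and the
client's share is the target minus α. So the distance between real and ideal execution is bounded by
a sum of failure probabilities (`sd_onlineIdeal`, `sd_ssipIdeal`).

Client. In the ideal execution the OT views depend, beyond the client's own coins, only on b₀ and on
its share. Both are uniform, since b₁ and α are (`clientQuerySim_eq`). The encrypted tables are
replaced by encryptions of zero by semantic security (`ci_clientSim`).

Server. It sees the plaintexts C - μ and s·G - δ and the OT value Δ + pass·δ. These are uniform and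
independent because of the masks μ, δ, Δ (`serverQuerySim_eq`). The two ciphertexts are simulated
from their plaintexts by function privacy (`ci_lawPair`), and the tables are sampled from the
server's own input (`ci_serverSim`).

Method. The assumptions speak of one sequence of parameters at a time. Since distinguishers are
non-uniform, nearly worst parameters at each level again form such a sequence, so the assumptions
give bounds uniform over all parameters of a level (`exists_negligible_bound`, `CI.of_indist`).
Efficiency and indistinguishability are therefore treated for families over an arbitrary index type
with a level map. Values already sampled can then be moved into the index, averaged over
(`CI.average`) and wired in as constants, and hybrid arguments over polynomially many components
have one common error per step (`CI.indep_congr`, `CI.indep_context`).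

The simulators are assembled from circuits. Two computations need an idea: uniform filling of the
garbled filter without search (`uniformOfFinset_gbfFillings`), and residues modulo k+1 of
representatives of least absolute value (`DT.modIdx_valMinAbs`). -/

/-- Rename the wires a gate reads. -/
def Gate.rename {p : ℕ} {α α' : Type} (φ : α → α') : Gate p α → Gate p α'
  | .const c => .const c
  | .add i j => .add (φ i) (φ j)
  | .mul i j => .mul (φ i) (φ j)
  | .bit b i => .bit b (φ i)
  | .flip => .flip
  | .rand => .rand

/-- Rename the input wires of a circuit. -/
def Circuit.rename {p : ℕ} {β : Type} :
    {α α' : Type} → (α → α') → Circuit p β α → Circuit p β α'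
  | _, _, φ, .out f => .out (φ ∘ f)
  | _, _, φ, .step g C => .step (g.rename φ) (C.rename (Option.map φ))

/-- Select among the output wires of a circuit. -/
def Circuit.select {p : ℕ} {β γ : Type} (ψ : γ → β) :
    {α : Type} → Circuit p β α → Circuit p γ α
  | _, .out f => .out (f ∘ ψ)
  | _, .step g C => .step g (C.select ψ)

/-- Run a second circuit on some wires of the first and on its outputs. -/
def Circuit.andThen {p : ℕ} {β γ α₀ : Type} :
    {α : Type} → Circuit p β α → (α₀ → α) → Circuit p γ (α₀ ⊕ β) → Circuit p γ α
  | _, .out f, φ, C₂ => C₂.rename (Sum.elim φ f)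
  | _, .step g C, φ, C₂ => .step g (C.andThen (fun a => some (φ a)) C₂)

section

variable {p : ℕ} {α α' α₀ β γ : Type}

theorem Circuit.size_rename (φ : α → α') (C : Circuit p β α) : (C.rename φ).size = C.size := by
  induction C generalizing α' with
  | out f => rfl
  | step g C ih => simp [Circuit.rename, Circuit.size, ih]

theorem Circuit.size_select (ψ : γ → β) (C : Circuit p β α) : (C.select ψ).size = C.size := by
  induction C with
  | out f => rfl
  | step g C ih => simp [Circuit.select, Circuit.size, ih]

theorem Circuit.size_andThen (C : Circuit p β α) (φ : α₀ → α) (C₂ : Circuit p γ (α₀ ⊕ β)) :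
    (C.andThen φ C₂).size = C.size + C₂.size := by
  induction C with
  | out f => simp [Circuit.andThen, Circuit.size, Circuit.size_rename]
  | step g C ih => simp only [Circuit.andThen, Circuit.size, ih]; omega

variable [Fact p.Prime]

theorem Gate.eval_rename (φ : α → α') (g : Gate p α) (w : α' → ZMod p) :
    (g.rename φ).eval w = g.eval (w ∘ φ) := by
  cases g <;> rfl

theorem Circuit.eval_rename (φ : α → α') (C : Circuit p β α) (w : α' → ZMod p) :
    (C.rename φ).eval w = C.eval (w ∘ φ) := by
  induction C generalizing α' with
  | out f => rfl
  | step g C ih =>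
    simp only [Circuit.rename, Circuit.eval, ih, Gate.eval_rename]
    congr 1
    funext v
    congr 1
    funext o
    cases o <;> rfl

theorem Circuit.eval_select (ψ : γ → β) (C : Circuit p β α) (w : α → ZMod p) :
    (C.select ψ).eval w = (C.eval w).map (fun v => v ∘ ψ) := by
  induction C with
  | out f => simp [Circuit.select, Circuit.eval, PMF.pure_map, Function.comp_def]
  | step g C ih => simp only [Circuit.select, Circuit.eval, ih, PMF.map_bind]

/-- Wires are never overwritten, so the inputs stay readable through `φ` after the first circuit has
run; each gate only shifts their names by `some`. A continuation can thus depend on the input and on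
the sampled output together. -/
theorem Circuit.eval_andThen (C : Circuit p β α) (φ : α₀ → α) (C₂ : Circuit p γ (α₀ ⊕ β))
    (w : α → ZMod p) :
    (C.andThen φ C₂).eval w = (C.eval w).bind fun v => C₂.eval (Sum.elim (w ∘ φ) v) := by
  induction C with
  | out f =>
    simp only [Circuit.andThen, Circuit.eval, Circuit.eval_rename, PMF.pure_bind]
    congr 1
    funext x
    cases x <;> rfl
  | step g C ih =>
    simp only [Circuit.andThen, Circuit.eval, PMF.bind_bind, ih]
    rfl

end

/- ## Functions computed by circuits of a given size -/

/-- The randomized function `f` is computed by a circuit with at most `s` gates. -/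
def HasCost (p : ℕ) [Fact p.Prime] {α β : Type} [Data p α] [Data p β] (f : α → PMF β)
    (s : ℕ) : Prop :=
  ∃ C : Circuit p (Data.Idx p β) (Data.Idx p α),
    C.size ≤ s ∧ ∀ a, C.eval (Data.enc a) = (f a).map Data.enc

section

variable {p : ℕ} [Fact p.Prime] {α β γ δ : Type} [Data p α] [Data p β] [Data p γ] [Data p δ]

theorem HasCost.mono {f : α → PMF β} {s s' : ℕ} (h : HasCost p f s) (hs : s ≤ s') :
    HasCost p f s' :=
  let ⟨C, h1, h2⟩ := h
  ⟨C, h1.trans hs, h2⟩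

/-- Rewiring is free. -/
theorem HasCost.wiring {f : α → β} (φ : Data.Idx p β → Data.Idx p α)
    (h : ∀ a o, Data.enc (p := p) (f a) o = Data.enc a (φ o)) :
    HasCost p (fun a => PMF.pure (f a)) 0 :=
  ⟨.out φ, le_rfl, fun a => by
    rw [PMF.pure_map, Circuit.eval]
    congr 1
    funext o
    exact (h a o).symm⟩

/-- The continuation is costed on the pair of input and sample. Iterated binds nest the earlier
values to the left, and chains of projections retrieve them. -/
theorem HasCost.bind {f : α → PMF β} {g : α → β → PMF γ} {s t : ℕ} (hf : HasCost p f s)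
    (hg : HasCost p (fun x : α × β => g x.1 x.2) t) :
    HasCost p (fun a => (f a).bind (g a)) (s + t) := by
  obtain ⟨C, hC, hf⟩ := hf
  obtain ⟨E, hE, hg⟩ := hg
  refine ⟨C.andThen id E, by rw [Circuit.size_andThen]; omega, fun a => ?_⟩
  rw [Circuit.eval_andThen, hf, PMF.bind_map, PMF.map_bind]
  congr 1
  funext b
  exact hg (a, b)

theorem HasCost.comp {f : β → PMF γ} {g : α → β} {s t : ℕ}
    (hg : HasCost p (fun a => PMF.pure (g a)) s) (hf : HasCost p f t) :
    HasCost p (fun a => f (g a)) (s + t) := by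
  have h : HasCost p (fun x : α × β => f x.2) t := by
    obtain ⟨E, hE, hf⟩ := hf
    refine ⟨E.rename Sum.inr, by rwa [Circuit.size_rename], fun x => ?_⟩
    rw [Circuit.eval_rename, ← hf]
    rfl
  simpa [PMF.pure_bind] using HasCost.bind hg h

theorem HasCost.prod {f : α → β} {g : α → γ} {s t : ℕ}
    (hf : HasCost p (fun a => PMF.pure (f a)) s) (hg : HasCost p (fun a => PMF.pure (g a)) t) :
    HasCost p (fun a => PMF.pure (f a, g a)) (s + t) := by
  have hfst : HasCost p (fun x : α × β => PMF.pure x.1) 0 := HasCost.wiring Sum.inl fun _ _ => rfl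
  have hswap : HasCost p (fun x : (α × β) × γ => PMF.pure (x.1.2, x.2)) 0 :=
    HasCost.wiring (Sum.elim (fun i => Sum.inl (Sum.inr i)) Sum.inr) fun x o => by
      cases o <;> rfl
  have := HasCost.bind hf (g := fun a b => (PMF.pure (g a)).bind fun c => PMF.pure (b, c))
    (HasCost.bind (HasCost.comp (f := fun a => PMF.pure (g a)) hfst hg) hswap)
  simpa [PMF.pure_bind] using this

/-- Computing finitely many output wires one after the other. -/
theorem HasCost.of_wires [Finite (Data.Idx p β)] {f : α → β} {c : ℕ}
    (h : ∀ o : Data.Idx p β, HasCost p (fun a => PMF.pure (Data.enc (p := p) (f a) o)) c) :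
    HasCost p (fun a => PMF.pure (f a)) (Nat.card (Data.Idx p β) * c) := by
  have key : ∀ (r : ℕ) (F : Fin r → α → ZMod p),
      (∀ i, HasCost p (fun a => PMF.pure (F i a)) c) →
      ∃ C : Circuit p (Fin r) (Data.Idx p α), C.size ≤ r * c ∧
        ∀ a, C.eval (Data.enc a) = PMF.pure fun i => F i a := by
    intro r
    induction r with
    | zero =>
      intro F _
      exact ⟨.out Fin.elim0, by simp [Circuit.size], fun a => by
        rw [Circuit.eval]
        congr 1
        funext i
        exact i.elim0⟩
    | succ r ih =>
      intro F hF
      obtain ⟨C, hC, hCe⟩ := ih (fun i => F i.succ) fun i => hF i.succ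
      obtain ⟨E, hE, hEe⟩ := hF 0
      -- One more output wire is computed from the original inputs, while the `r` wires obtained so
      -- far are passed through.
      let E' : Circuit p (Fin r ⊕ Unit) (Data.Idx p α ⊕ Fin r) :=
        (E.rename Sum.inl).andThen (Sum.inr : Fin r → _) (.out id)
      refine ⟨(C.andThen id E').select (Fin.cons (Sum.inr ()) Sum.inl), ?_, fun a => ?_⟩
      · rw [Circuit.size_select, Circuit.size_andThen, Circuit.size_andThen, Circuit.size_rename]
        simp only [Circuit.size]
        linarith
      · rw [Circuit.eval_select, Circuit.eval_andThen, hCe, PMF.pure_bind, Circuit.eval_andThen,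
          Circuit.eval_rename, Sum.elim_comp_inl, Function.comp_id, hEe, PMF.pure_map,
          PMF.pure_bind, Circuit.eval, PMF.pure_map]
        congr 1
        funext i
        refine Fin.cases ?_ (fun i => ?_) i <;> rfl
  let e := Finite.equivFin (Data.Idx p β)
  obtain ⟨C, hC, hCe⟩ := key _ (fun i a => Data.enc (p := p) (f a) (e.symm i)) fun i => h _
  refine ⟨C.select e, by rwa [Circuit.size_select], fun a => ?_⟩
  rw [Circuit.eval_select, hCe, PMF.pure_map, PMF.pure_map]
  congr 1
  funext o
  simp

theorem HasCost.gate (g : Gate p (Data.Idx p α)) {f : α → PMF (ZMod p)}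
    (h : ∀ a, g.eval (Data.enc a) = f a) : HasCost p f 1 :=
  ⟨.step g (.out fun _ => none), le_rfl, fun a => by
    simp only [Circuit.eval, h]
    rfl⟩

theorem HasCost.gate_bool (g : Gate p (Data.Idx p α)) {f : α → PMF Bool}
    (h : ∀ a, g.eval (Data.enc a) = (f a).map (bitF p)) : HasCost p f 1 :=
  ⟨.step g (.out fun _ => none), le_rfl, fun a => by
    simp only [Circuit.eval, h, PMF.bind_map]
    rfl⟩

/-- A bit and the corresponding field element are represented by the same wire. -/
theorem HasCost.bool_iff {f : α → Bool} {s : ℕ} :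
    HasCost p (fun a => PMF.pure (f a)) s ↔ HasCost p (fun a => PMF.pure (bitF p (f a))) s := by
  constructor <;> rintro ⟨C, h, hC⟩ <;> refine ⟨C, h, fun a => (hC a).trans ?_⟩ <;>
    simp only [PMF.pure_map] <;> rfl

theorem HasCost.indep {r : ℕ} {f : Fin r → α → PMF β} {c : ℕ} (h : ∀ i, HasCost p (f i) c) :
    HasCost p (fun a => indep r fun i => f i a) (r * c) := by
  induction r with
  | zero =>
    rw [Nat.zero_mul]
    exact HasCost.wiring (fun x => x.1.elim0) fun _ x => x.1.elim0
  | succ r ih =>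
    have hfst : HasCost p (fun x : α × β => PMF.pure x.1) 0 :=
      HasCost.wiring Sum.inl fun _ _ => rfl
    have hcons : HasCost p (fun x : (α × β) × (Fin r → β) =>
        PMF.pure (Fin.cons x.1.2 x.2 : Fin (r + 1) → β)) 0 := by
      refine HasCost.wiring (fun o => Fin.cases (motive := fun _ => _)
        (Sum.inl (Sum.inr o.2)) (fun i => Sum.inr (i, o.2)) o.1) fun x o => ?_
      obtain ⟨i, o⟩ := o
      refine Fin.cases ?_ (fun i => ?_) i <;> rfl
    have := HasCost.bind (h 0)
      (g := fun a b => (_root_.indep r fun i => f i.succ a).bind fun v =>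
        PMF.pure (Fin.cons b v : Fin (r + 1) → β))
      (HasCost.bind (HasCost.comp (f := fun a => _root_.indep r fun i => f i.succ a) hfst
        (ih fun i => h i.succ)) hcons)
    refine (this.mono ?_)
    linarith

end

/- ## Uniform products -/

section

variable {α β γ : Type}

/-- All perfect masking below is an instance: a bit is hidden by xor, a field element by translation
or reflection. -/
theorem unif_bind_equiv [Fintype α] [Nonempty α] [Fintype β] [Nonempty β] (e : α ≃ β)
    (f : β → PMF γ) : ((unif α).bind fun a => f (e a)) = (unif β).bind f := by
  ext c
  simp only [PMF.bind_apply, unif, PMF.uniformOfFintype_apply]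
  rw [Fintype.card_congr e]
  exact e.tsum_eq fun b => (Fintype.card β : ENNReal)⁻¹ * f b c

theorem unif_prod [Fintype α] [Nonempty α] [Fintype β] [Nonempty β] :
    unif (α × β) = (unif α).bind fun a => (unif β).map fun b => (a, b) := by
  classical
  ext ⟨a, b⟩
  simp only [PMF.bind_apply, unif, PMF.uniformOfFintype_apply, PMF.map_apply, Prod.mk.injEq]
  rw [tsum_eq_single a, tsum_eq_single b]
  · simp only [and_self, if_true, Fintype.card_prod, Nat.cast_mul]
    rw [ENNReal.mul_inv] <;> simp
  · intro b' hb'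
    simp [hb'.symm]
  · intro a' ha'
    simp [ha'.symm]

/-- Needed twice: circuits sample uniform vectors entry by entry, and the server's shares of the
individual queries together form the uniform vector chosen by the functionality. -/
theorem unif_fin (r : ℕ) [Fintype α] [Nonempty α] :
    unif (Fin r → α) = indep r fun _ => unif α := by
  induction r with
  | zero =>
    ext v
    simp [unif, indep, PMF.pure_apply, Subsingleton.elim v Fin.elim0]
  | succ r ih =>
    rw [← PMF.bind_pure (unif (Fin (r + 1) → α)), ← unif_bind_equiv (Fin.consEquiv fun _ => α),
      unif_prod, indep, ← ih]
    simp only [PMF.bind_bind, PMF.bind_map]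
    rfl

/-- Draws for different components commute, so all first stages can be performed before all second
stages. -/
theorem indep_bind (r : ℕ) (P : Fin r → PMF α) (f : Fin r → α → PMF β) :
    (indep r fun j => (P j).bind (f j)) = (indep r P).bind fun a => indep r fun j => f j (a j) := by
  induction r with
  | zero =>
    simp only [indep, PMF.pure_bind]
  | succ r ih =>
    change (((P 0).bind (f 0)).bind fun b =>
        (indep r fun j => (P j.succ).bind (f j.succ)).bind fun v => PMF.pure (Fin.cons b v : Fin (r + 1) → β)) =
      ((P 0).bind fun a => (indep r fun j => P j.succ).bind fun v =>
        PMF.pure (Fin.cons a v : Fin (r + 1) → α)).bind fun a =>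
          (f 0 (a 0)).bind fun b => (indep r fun j => f j.succ (a j.succ)).bind fun v =>
            PMF.pure (Fin.cons b v : Fin (r + 1) → β)
    simp only [PMF.bind_bind, PMF.pure_bind, Fin.cons_zero, Fin.cons_succ, ih]
    congr 1
    funext a
    rw [PMF.bind_comm]

theorem indep_pure (r : ℕ) (f : Fin r → α) :
    (indep r fun j => PMF.pure (f j)) = PMF.pure f := by
  induction r with
  | zero =>
    change PMF.pure _ = _
    congr 1
    funext i
    exact i.elim0
  | succ r ih =>
    change ((PMF.pure (f 0)).bind fun b =>
        (indep r fun j => PMF.pure (f j.succ)).bind fun v =>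
          PMF.pure (Fin.cons b v : Fin (r + 1) → α)) = _
    rw [ih, PMF.pure_bind, PMF.pure_bind]
    congr 1
    exact Fin.cons_self_tail f

theorem indep_map (r : ℕ) (P : Fin r → PMF α) (f : Fin r → α → β) :
    (indep r fun j => (P j).map (f j)) = (indep r P).map fun a j => f j (a j) := by
  have := indep_bind r P fun j a => PMF.pure (f j a)
  simp only [indep_pure] at this
  exact this

end

/- ## Polynomially bounded families -/

/-- `s` is bounded by a polynomial in the level. -/
def PolyBdd {I : Type} (N s : I → ℕ) : Prop :=
  ∃ P : Polynomial ℕ, ∀ i, s i ≤ P.eval (N i)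

section

variable {I J : Type} {N s t : I → ℕ}

theorem polyBdd_const (c : ℕ) : PolyBdd N fun _ => c :=
  ⟨Polynomial.C c, fun i => by simp⟩

theorem PolyBdd.add (hs : PolyBdd N s) (ht : PolyBdd N t) : PolyBdd N fun i => s i + t i :=
  let ⟨P, hP⟩ := hs
  let ⟨Q, hQ⟩ := ht
  ⟨P + Q, fun i => by rw [Polynomial.eval_add]; exact add_le_add (hP i) (hQ i)⟩

theorem PolyBdd.mul (hs : PolyBdd N s) (ht : PolyBdd N t) : PolyBdd N fun i => s i * t i :=
  let ⟨P, hP⟩ := hs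
  let ⟨Q, hQ⟩ := ht
  ⟨P * Q, fun i => by rw [Polynomial.eval_mul]; exact Nat.mul_le_mul (hP i) (hQ i)⟩

theorem PolyBdd.mono (ht : PolyBdd N t) (h : ∀ i, s i ≤ t i) : PolyBdd N s :=
  let ⟨P, hP⟩ := ht
  ⟨P, fun i => (h i).trans (hP i)⟩

theorem polyBdd_eval (P : Polynomial ℕ) : PolyBdd N fun i => P.eval (N i) := ⟨P, fun _ => le_rfl⟩

theorem PolyBdd.reindex (h : PolyBdd N s) (φ : J → I) :
    PolyBdd (fun j => N (φ j)) fun j => s (φ j) :=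
  let ⟨P, hP⟩ := h
  ⟨P, fun j => hP (φ j)⟩

theorem PolyBounded.polyBdd {f : ℕ → ℕ} (h : PolyBounded f) : PolyBdd N fun i => f (N i) :=
  let ⟨P, hP⟩ := h
  ⟨P, fun i => hP (N i)⟩

end

/-- The representation of `α i` uses finitely many wires, polynomially many in the level. -/
def FewWires {I : Type} (N p : I → ℕ) (α : I → Type) [∀ i, Data (p i) (α i)] : Prop :=
  (∀ i, Finite (Data.Idx (p i) (α i))) ∧ PolyBdd N fun i => Nat.card (Data.Idx (p i) (α i))

section

variable {I J : Type} {N p : I → ℕ} {α β : I → Type} [∀ i, Data (p i) (α i)]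
  [∀ i, Data (p i) (β i)] {n : I → ℕ}

theorem FewWires.reindex (h : FewWires N p α) (φ : J → I) :
    FewWires (fun j => N (φ j)) (fun j => p (φ j)) fun j => α (φ j) :=
  ⟨fun j => h.1 (φ j), h.2.reindex φ⟩

theorem fewWires_unit : FewWires N p fun _ => Unit :=
  ⟨fun _ => inferInstanceAs (Finite Empty), 0, fun i => by
    change Nat.card Empty ≤ _
    simp⟩

theorem fewWires_bool : FewWires N p fun _ => Bool :=
  ⟨fun _ => inferInstanceAs (Finite Unit), 1, fun i => by
    change Nat.card Unit ≤ _
    simp⟩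

theorem fewWires_zmod : FewWires N p fun i => ZMod (p i) :=
  ⟨fun _ => inferInstanceAs (Finite Unit), 1, fun i => by
    change Nat.card Unit ≤ _
    simp⟩

theorem fewWires_fin (hn : PolyBdd N n) : FewWires N p fun i => Fin (n i) :=
  ⟨fun i => inferInstanceAs (Finite (Fin (n i))), hn.mono fun i => by
    change Nat.card (Fin (n i)) ≤ _
    simp⟩

theorem FewWires.prod (hα : FewWires N p α) (hβ : FewWires N p β) :
    FewWires N p fun i => α i × β i := by
  have h1 := hα.1
  have h2 := hβ.1
  exact ⟨fun i => inferInstanceAs (Finite (Data.Idx (p i) (α i) ⊕ Data.Idx (p i) (β i))),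
    (hα.2.add hβ.2).mono fun i => (Nat.card_sum (α := Data.Idx (p i) (α i))
      (β := Data.Idx (p i) (β i))).le⟩

theorem FewWires.pi (hn : PolyBdd N n) (hα : FewWires N p α) :
    FewWires N p fun i => Fin (n i) → α i := by
  have h1 := hα.1
  exact ⟨fun i => inferInstanceAs (Finite (Fin (n i) × Data.Idx (p i) (α i))),
    (hn.mul hα.2).mono fun i => by
      have := Nat.card_prod (Fin (n i)) (Data.Idx (p i) (α i))
      rw [Nat.card_fin] at this
      exact this.le⟩

theorem FewWires.option (hα : FewWires N p α) : FewWires N p fun i => Option (α i) := by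
  have h1 := hα.1
  exact ⟨fun i => inferInstanceAs (Finite (Option (Data.Idx (p i) (α i)))),
    (hα.2.add (polyBdd_const 1)).mono fun i =>
      (Finite.card_option (α := Data.Idx (p i) (α i))).le⟩

theorem fewWires_bits (hn : PolyBdd N n) : FewWires N p fun i => Bits (n i) :=
  FewWires.pi hn fewWires_bool

end

/- ## Families of functions computed by circuits of polynomial size -/

/-- The randomized functions `f i` are computed by circuits of size polynomial in the level
`N i`. Several `i` may have the same level, and then the bound is uniform. -/
def PT {I : Type} (N p : I → ℕ) [∀ i, Fact (p i).Prime] {α β : I → Type}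
    [∀ i, Data (p i) (α i)] [∀ i, Data (p i) (β i)] (f : ∀ i, α i → PMF (β i)) : Prop :=
  ∃ P : Polynomial ℕ, ∀ i, HasCost (p i) (f i) (P.eval (N i))

/-- The functions `f i` are computed by circuits of size polynomial in the level. -/
def DT {I : Type} (N p : I → ℕ) [∀ i, Fact (p i).Prime] {α β : I → Type}
    [∀ i, Data (p i) (α i)] [∀ i, Data (p i) (β i)] (f : ∀ i, α i → β i) : Prop :=
  PT N p fun i a => PMF.pure (f i a)

/-- The circuits depend on the level only, so one family serves all indices of a level with a common
size bound. -/
theorem PolyTime.pt {q : ℕ → ℕ} [∀ κ, Fact (q κ).Prime] {α β : ℕ → Type}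
    [∀ κ, Data (q κ) (α κ)] [∀ κ, Data (q κ) (β κ)] {f : ∀ κ, α κ → PMF (β κ)}
    (h : PolyTime q f) {I : Type} (N : I → ℕ) :
    PT N (fun i => q (N i)) fun i => f (N i) :=
  let ⟨C, ⟨P, hP⟩, hC⟩ := h
  ⟨P, fun i => ⟨C (N i), hP (N i), hC (N i)⟩⟩

theorem PT.polyTime {q : ℕ → ℕ} [∀ κ, Fact (q κ).Prime] {α β : ℕ → Type}
    [∀ κ, Data (q κ) (α κ)] [∀ κ, Data (q κ) (β κ)] {f : ∀ κ, α κ → PMF (β κ)}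
    (h : PT (fun κ => κ) q f) : PolyTime q f := by
  obtain ⟨P, hP⟩ := h
  choose C h1 h2 using hP
  exact ⟨C, ⟨P, h1⟩, h2⟩

section

variable {I J : Type} {N p : I → ℕ} [∀ i, Fact (p i).Prime] {α β γ δ : I → Type}
  [∀ i, Data (p i) (α i)] [∀ i, Data (p i) (β i)] [∀ i, Data (p i) (γ i)]
  [∀ i, Data (p i) (δ i)] {n : I → ℕ}

theorem PT.of_cost {f : ∀ i, α i → PMF (β i)} {s : I → ℕ} (hs : PolyBdd N s)
    (h : ∀ i, HasCost (p i) (f i) (s i)) : PT N p f :=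
  let ⟨P, hP⟩ := hs
  ⟨P, fun i => (h i).mono (hP i)⟩

theorem DT.of_wiring {f : ∀ i, α i → β i}
    (φ : ∀ i, Data.Idx (p i) (β i) → Data.Idx (p i) (α i))
    (h : ∀ i a o, Data.enc (p := p i) (f i a) o = Data.enc a (φ i o)) : DT N p f :=
  PT.of_cost (polyBdd_const 0) fun i => HasCost.wiring (φ i) (h i)

theorem PT.reindex {f : ∀ i, α i → PMF (β i)} (h : PT N p f) (φ : J → I) :
    PT (fun j => N (φ j)) (fun j => p (φ j)) fun j => f (φ j) :=
  let ⟨P, hP⟩ := h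
  ⟨P, fun j => hP (φ j)⟩

theorem DT.reindex {f : ∀ i, α i → β i} (h : DT N p f) (φ : J → I) :
    DT (fun j => N (φ j)) (fun j => p (φ j)) fun j => f (φ j) :=
  PT.reindex h φ

theorem PT.bind {f : ∀ i, α i → PMF (β i)} {g : ∀ i, α i → β i → PMF (γ i)} (hf : PT N p f)
    (hg : PT N p (α := fun i => α i × β i) fun i x => g i x.1 x.2) :
    PT N p fun i a => (f i a).bind (g i a) :=
  let ⟨_, hP⟩ := hf
  let ⟨_, hQ⟩ := hg
  PT.of_cost ((polyBdd_eval _).add (polyBdd_eval _)) fun i => (hP i).bind (hQ i)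

theorem PT.comp {f : ∀ i, β i → PMF (γ i)} {g : ∀ i, α i → β i} (hf : PT N p f) (hg : DT N p g) :
    PT N p fun i a => f i (g i a) :=
  let ⟨_, hP⟩ := hf
  let ⟨_, hQ⟩ := hg
  PT.of_cost ((polyBdd_eval _).add (polyBdd_eval _)) fun i => (hQ i).comp (hP i)

theorem DT.comp {f : ∀ i, β i → γ i} {g : ∀ i, α i → β i} (hf : DT N p f) (hg : DT N p g) :
    DT N p fun i a => f i (g i a) :=
  PT.comp (f := fun i b => PMF.pure (f i b)) hf hg

theorem DT.id : DT N p fun i (a : α i) => a := DT.of_wiring (fun _ o => o) fun _ _ _ => rfl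

theorem DT.fst {f : ∀ i, α i → β i × γ i} (h : DT N p f) : DT N p fun i a => (f i a).1 :=
  DT.comp (f := fun i (x : β i × γ i) => x.1) (DT.of_wiring (fun _ => Sum.inl) fun _ _ _ => rfl) h

theorem DT.snd {f : ∀ i, α i → β i × γ i} (h : DT N p f) : DT N p fun i a => (f i a).2 :=
  DT.comp (f := fun i (x : β i × γ i) => x.2) (DT.of_wiring (fun _ => Sum.inr) fun _ _ _ => rfl) h

theorem DT.prodMk {f : ∀ i, α i → β i} {g : ∀ i, α i → γ i} (hf : DT N p f) (hg : DT N p g) :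
    DT N p fun i a => (f i a, g i a) :=
  let ⟨_, hP⟩ := hf
  let ⟨_, hQ⟩ := hg
  PT.of_cost ((polyBdd_eval _).add (polyBdd_eval _)) fun i => (hP i).prod (hQ i)

theorem DT.eval {f : ∀ i, α i → Fin (n i) → β i} (h : DT N p f) (j : ∀ i, Fin (n i)) :
    DT N p fun i a => f i a (j i) :=
  DT.comp (f := fun i (x : Fin (n i) → β i) => x (j i))
    (DT.of_wiring (fun i o => (j i, o)) fun _ _ _ => rfl) h

theorem DT.wire {f : ∀ i, α i → β i} (h : DT N p f) (o : ∀ i, Data.Idx (p i) (β i)) :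
    DT N p fun i a => (Data.enc (f i a) (o i) : ZMod (p i)) :=
  DT.comp (f := fun i (x : β i) => (Data.enc x (o i) : ZMod (p i)))
    (DT.of_wiring (fun i _ => o i) fun _ _ _ => rfl) h

/-- The output wire becomes part of the index. A size bound uniform over the enlarged index type,
multiplied by the number of wires, remains polynomial. The same device treats vectors, sums and
products of variable length. -/
theorem DT.of_wires (hβ : FewWires N p β) {f : ∀ i, α i → β i}
    (h : DT (I := Σ i, Data.Idx (p i) (β i)) (fun x => N x.1) (fun x => p x.1)
      (α := fun x => α x.1) (β := fun x => ZMod (p x.1)) fun x a => Data.enc (f x.1 a) x.2) :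
    DT N p f :=
  let ⟨_, hP⟩ := h
  PT.of_cost (hβ.2.mul (polyBdd_eval _)) fun i =>
    have := hβ.1 i
    HasCost.of_wires fun o => hP ⟨i, o⟩

theorem DT.constF (c : ∀ i, ZMod (p i)) : DT N p fun i (_ : α i) => c i :=
  PT.of_cost (polyBdd_const 1) fun i => HasCost.gate (.const (c i)) fun _ => rfl

/-- Non-uniformity enters here: any value, however hard to compute, can be wired in at one gate per
wire. This is how values fixed in the index reach a reduction. -/
theorem DT.const (hβ : FewWires N p β) (c : ∀ i, β i) : DT N p fun i (_ : α i) => c i :=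
  DT.of_wires hβ (DT.constF fun x : Σ i, Data.Idx (p i) (β i) => Data.enc (c x.1) x.2)

theorem PT.flip : PT N p fun i (_ : α i) => unif Bool :=
  PT.of_cost (polyBdd_const 1) fun _ => HasCost.gate_bool .flip fun _ => rfl

theorem PT.rand : PT N p fun i (_ : α i) => unif (ZMod (p i)) :=
  PT.of_cost (polyBdd_const 1) fun _ => HasCost.gate .rand fun _ => rfl

theorem PT.indep (hn : PolyBdd N n) {f : ∀ i, Fin (n i) → α i → PMF (β i)}
    (h : PT (I := Σ i, Fin (n i)) (fun x => N x.1) (fun x => p x.1) fun x a => f x.1 x.2 a) :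
    PT N p fun i a => indep (n i) fun j => f i j a :=
  let ⟨_, hP⟩ := h
  PT.of_cost (hn.mul (polyBdd_eval _)) fun i => HasCost.indep fun j => hP ⟨i, j⟩

theorem DT.pi (hn : PolyBdd N n) {f : ∀ i, Fin (n i) → α i → β i}
    (h : DT (I := Σ i, Fin (n i)) (fun x => N x.1) (fun x => p x.1) fun x a => f x.1 x.2 a) :
    DT N p fun i a j => f i j a := by
  have := PT.indep hn (f := fun i j a => PMF.pure (f i j a)) h
  simp only [indep_pure] at this
  exact this

theorem PT.unif_pi (hn : PolyBdd N n) [∀ i, Fintype (β i)] [∀ i, Nonempty (β i)]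
    (h : PT N p fun i (_ : α i) => unif (β i)) :
    PT N p fun i (_ : α i) => unif (Fin (n i) → β i) := by
  simp only [unif_fin]
  exact PT.indep hn (h.reindex Sigma.fst)

theorem PT.unif_bits (hn : PolyBdd N n) : PT N p fun i (_ : α i) => unif (Bits (n i)) :=
  PT.unif_pi hn PT.flip

theorem DT.some {f : ∀ i, α i → β i} (h : DT N p f) : DT N p fun i a => some (f i a) :=
  DT.comp (f := fun _ x => Option.some x) (PT.of_cost (polyBdd_const 1) fun i =>
    -- The new wire `none`, carrying 1, is exactly the flag wire of an optional value, and the old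
    -- wires keep their names.
    ⟨.step (.const 1) (.out fun o => Option.map (fun j => j) o), le_rfl, fun a => by
      simp only [Circuit.eval, Gate.eval, PMF.pure_bind, PMF.pure_map]
      congr 1
      funext o
      cases o <;> rfl⟩) h

/-- Data represented through a map `g`. -/
theorem DT.via {σ : I → Type} {g : ∀ i, σ i → γ i} {f : ∀ i, α i → σ i}
    (h : DT N p fun i a => g i (f i a)) :
    @DT I N p _ α σ _ (fun i => Data.via (g i)) f :=
  let ⟨P, hP⟩ := h
  ⟨P, fun i =>
    let ⟨C, h1, h2⟩ := hP i
    ⟨C, h1, fun a => by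
      rw [PMF.pure_map]
      exact (h2 a).trans (PMF.pure_map _ _)⟩⟩

/- ### Arithmetic -/

theorem DT.of_bool {f : ∀ i, α i → Bool} (h : DT N p fun i a => bitF (p i) (f i a)) :
    DT N p f :=
  let ⟨P, hP⟩ := h
  ⟨P, fun i => HasCost.bool_iff.2 (hP i)⟩

theorem DT.bitF {f : ∀ i, α i → Bool} (h : DT N p f) : DT N p fun i a => bitF (p i) (f i a) :=
  let ⟨P, hP⟩ := h
  ⟨P, fun i => HasCost.bool_iff.1 (hP i)⟩

section Arith

variable {f g : ∀ i, α i → ZMod (p i)}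

theorem DT.add (hf : DT N p f) (hg : DT N p g) : DT N p fun i a => f i a + g i a :=
  DT.comp (f := fun i (x : ZMod (p i) × ZMod (p i)) => x.1 + x.2)
    (PT.of_cost (polyBdd_const 1) fun _ =>
      HasCost.gate (.add (Sum.inl ()) (Sum.inr ())) fun _ => rfl) (hf.prodMk hg)

theorem DT.mul (hf : DT N p f) (hg : DT N p g) : DT N p fun i a => f i a * g i a :=
  DT.comp (f := fun i (x : ZMod (p i) × ZMod (p i)) => x.1 * x.2)
    (PT.of_cost (polyBdd_const 1) fun _ =>
      HasCost.gate (.mul (Sum.inl ()) (Sum.inr ())) fun _ => rfl) (hf.prodMk hg)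

theorem DT.neg (hf : DT N p f) : DT N p fun i a => -f i a := by
  have := (DT.constF (α := α) (N := N) (p := p) fun _ => -1).mul hf
  simpa only [neg_one_mul] using this

theorem DT.sub (hf : DT N p f) (hg : DT N p g) : DT N p fun i a => f i a - g i a := by
  simpa only [sub_eq_add_neg] using hf.add hg.neg

theorem DT.bit (hf : DT N p f) (b : I → ℕ) : DT N p fun i a => ((f i a).val.testBit (b i)) :=
  DT.of_bool (DT.comp (f := fun i (x : ZMod (p i)) => _root_.bitF (p i) (x.val.testBit (b i)))
    (PT.of_cost (polyBdd_const 1) fun i => HasCost.gate (.bit (b i) ()) fun _ => rfl) hf)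

end Arith

theorem HasCost.constF {q : ℕ} [Fact q.Prime] {α : Type} [Data q α] (c : ZMod q) :
    HasCost q (fun _ : α => PMF.pure c) 1 :=
  HasCost.gate (.const c) fun _ => rfl

theorem HasCost.sum {q : ℕ} [Fact q.Prime] {α : Type} [Data q α] (r : ℕ)
    (f : Fin r → α → ZMod q) (c : ℕ) (h : ∀ i, HasCost q (fun a => PMF.pure (f i a)) c) :
    HasCost q (fun a => PMF.pure (∑ i, f i a)) (1 + r * (c + 1)) := by
  induction r with
  | zero => simpa using HasCost.constF (q := q) 0
  | succ r ih =>
    have h1 := ih (fun i => f i.succ) fun i => h i.succ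
    have h2 : HasCost q (fun x : ZMod q × ZMod q => PMF.pure (x.1 + x.2)) 1 :=
      HasCost.gate (.add (Sum.inl ()) (Sum.inr ())) fun _ => rfl
    simp only [Fin.sum_univ_succ]
    exact (HasCost.comp ((h 0).prod h1) h2).mono (by linarith)

theorem HasCost.prod_univ {q : ℕ} [Fact q.Prime] {α : Type} [Data q α] (r : ℕ)
    (f : Fin r → α → ZMod q) (c : ℕ) (h : ∀ i, HasCost q (fun a => PMF.pure (f i a)) c) :
    HasCost q (fun a => PMF.pure (∏ i, f i a)) (1 + r * (c + 1)) := by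
  induction r with
  | zero => simpa using HasCost.constF (q := q) 1
  | succ r ih =>
    have h1 := ih (fun i => f i.succ) fun i => h i.succ
    have h2 : HasCost q (fun x : ZMod q × ZMod q => PMF.pure (x.1 * x.2)) 1 :=
      HasCost.gate (.mul (Sum.inl ()) (Sum.inr ())) fun _ => rfl
    simp only [Fin.prod_univ_succ]
    exact (HasCost.comp ((h 0).prod h1) h2).mono (by linarith)

theorem DT.sum (hn : PolyBdd N n) {f : ∀ i, Fin (n i) → α i → ZMod (p i)}
    (h : DT (I := Σ i, Fin (n i)) (fun x => N x.1) (fun x => p x.1) (α := fun x => α x.1)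
      (β := fun x => ZMod (p x.1)) fun x a => f x.1 x.2 a) :
    DT N p fun i a => ∑ j, f i j a :=
  let ⟨_, hP⟩ := h
  PT.of_cost ((polyBdd_const 1).add (hn.mul ((polyBdd_eval _).add (polyBdd_const 1)))) fun i =>
    HasCost.sum (n i) (f i) _ fun j => hP ⟨i, j⟩

theorem DT.prod (hn : PolyBdd N n) {f : ∀ i, Fin (n i) → α i → ZMod (p i)}
    (h : DT (I := Σ i, Fin (n i)) (fun x => N x.1) (fun x => p x.1) (α := fun x => α x.1)
      (β := fun x => ZMod (p x.1)) fun x a => f x.1 x.2 a) :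
    DT N p fun i a => ∏ j, f i j a :=
  let ⟨_, hP⟩ := h
  PT.of_cost ((polyBdd_const 1).add (hn.mul ((polyBdd_eval _).add (polyBdd_const 1)))) fun i =>
    HasCost.prod_univ (n i) (f i) _ fun j => hP ⟨i, j⟩

/-- Square and multiply: every binary digit of the exponent costs one squaring and at most one
further product. The exponents p - 2 and p - 1 will serve for inversion and for testing inequality.
-/
theorem HasCost.pow {q : ℕ} [Fact q.Prime] (e : ℕ) :
    HasCost q (fun x : ZMod q => PMF.pure (x ^ e)) (1 + 2 * e.size) := by
  induction e using Nat.binaryRec with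
  | zero => simpa using HasCost.constF (q := q) (α := ZMod q) 1
  | bit b e ih =>
    by_cases hb : Nat.bit b e = 0
    · rw [hb]
      simpa using HasCost.constF (q := q) (α := ZMod q) 1
    · rw [Nat.size_bit hb]
      have hsq : HasCost q (fun x : ZMod q => PMF.pure (x * x)) 1 :=
        HasCost.gate (.mul () ()) fun _ => rfl
      have h1 := HasCost.comp ih hsq
      cases b with
      | false =>
        have : ∀ x : ZMod q, x ^ (Nat.bit false e) = x ^ e * x ^ e := fun x => by
          rw [← pow_add, ← two_mul]; rfl
        simp only [this]
        exact h1.mono (by rw [Nat.succ_eq_add_one]; linarith)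
      | true =>
        have : ∀ x : ZMod q, x ^ (Nat.bit true e) = x ^ e * x ^ e * x := fun x => by
          rw [← pow_add, ← two_mul, ← pow_succ]; rfl
        have h2 : HasCost q (fun x : ZMod q × ZMod q => PMF.pure (x.1 * x.2)) 1 :=
          HasCost.gate (.mul (Sum.inl ()) (Sum.inr ())) fun _ => rfl
        have h3 : HasCost q (fun x : ZMod q => PMF.pure x) 0 :=
          HasCost.wiring (fun o => o) fun _ _ => rfl
        simp only [this]
        exact (HasCost.comp (h1.prod h3) h2).mono (by rw [Nat.succ_eq_add_one]; linarith)

theorem DT.pow {e : I → ℕ} (he : PolyBdd N fun i => (e i).size) {f : ∀ i, α i → ZMod (p i)}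
    (hf : DT N p f) : DT N p fun i a => f i a ^ e i :=
  DT.comp (f := fun i (x : ZMod (p i)) => x ^ e i)
    (PT.of_cost ((polyBdd_const 1).add ((polyBdd_const 2).mul he)) fun i => HasCost.pow (e i)) hf

/- ### Case distinction and iteration -/

/-- Both branches are computed and selected wire by wire through b·f + (1 - b)·g. -/
theorem DT.ite (hβ : FewWires N p β) {b : ∀ i, α i → Bool} {f g : ∀ i, α i → β i} (hb : DT N p b)
    (hf : DT N p f) (hg : DT N p g) :
    DT N p fun i a => if b i a then f i a else g i a := by
  refine DT.of_wires hβ ?_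
  have h1 := (DT.bitF hb).reindex (Sigma.fst : (Σ i, Data.Idx (p i) (β i)) → I)
  have h2 := (DT.reindex hf (Sigma.fst : (Σ i, Data.Idx (p i) (β i)) → I)).wire Sigma.snd
  have h3 := (DT.reindex hg (Sigma.fst : (Σ i, Data.Idx (p i) (β i)) → I)).wire Sigma.snd
  have h := (h1.mul h2).add (((DT.constF fun _ => 1).sub h1).mul h3)
  convert h using 3 with x a
  cases hba : b x.1 a <;> simp [_root_.bitF]

/-- Apply randomized functions to a state one after the other. -/
def iterP {σ : Type} : (r : ℕ) → (Fin r → σ → PMF σ) → σ → PMF σ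
  | 0, _, s => PMF.pure s
  | r + 1, f, s => (f 0 s).bind (iterP r fun j => f j.succ)

theorem HasCost.iterP {q : ℕ} [Fact q.Prime] {α σ : Type} [Data q α] [Data q σ] (r : ℕ)
    (f : Fin r → α → σ → PMF σ) (c : ℕ)
    (h : ∀ j, HasCost q (fun x : α × σ => f j x.1 x.2) c) :
    HasCost q (fun x : α × σ => iterP r (fun j => f j x.1) x.2) (r * c) := by
  induction r with
  | zero =>
    rw [Nat.zero_mul]
    exact HasCost.wiring Sum.inr fun _ _ => rfl
  | succ r ih =>
    have h1 := ih (fun j => f j.succ) fun j => h j.succ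
    have hw : HasCost q (fun x : (α × σ) × σ => PMF.pure (x.1.1, x.2)) 0 :=
      HasCost.wiring (Sum.elim (fun i => Sum.inl (Sum.inl i)) Sum.inr) fun x o => by
        cases o <;> rfl
    have := HasCost.bind (h 0) (g := fun x s => _root_.iterP r (fun j => f j.succ x.1) s)
      (HasCost.comp (f := fun x : α × σ => _root_.iterP r (fun j => f j.succ x.1) x.2) hw h1)
    exact this.mono (by linarith)

theorem PT.iterP (hn : PolyBdd N n) {f : ∀ i, Fin (n i) → α i → β i → PMF (β i)}
    (h : PT (I := Σ i, Fin (n i)) (fun x => N x.1) (fun x => p x.1)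
      (α := fun x => α x.1 × β x.1) fun x a => f x.1 x.2 a.1 a.2) :
    PT N p (α := fun i => α i × β i) fun i x => iterP (n i) (fun j => f i j x.1) x.2 :=
  let ⟨_, hP⟩ := h
  PT.of_cost (hn.mul (polyBdd_eval _)) fun i => HasCost.iterP (n i) (f i) _ fun j => hP ⟨i, j⟩

end

/- ## Negligible functions -/

section

theorem negligible_zero : Negligible fun _ => ((0 : ℝ≥0) : ℝ) := by
  exact Asymptotics.superpolynomialDecay_zero atTop fun κ : ℕ => (κ : ℝ)

theorem Negligible.add {ε δ : ℕ → ℝ≥0} (hε : Negligible fun κ => (ε κ : ℝ))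
    (hδ : Negligible fun κ => (δ κ : ℝ)) : Negligible fun κ => ((ε κ + δ κ : ℝ≥0) : ℝ) := by
  exact Asymptotics.SuperpolynomialDecay.add hε hδ

theorem Negligible.of_le {f g : ℕ → ℝ} (hg : Negligible g) (h : ∀ᶠ κ in atTop, |f κ| ≤ |g κ|) :
    Negligible f :=
  Asymptotics.SuperpolynomialDecay.trans_eventually_abs_le hg h

theorem Negligible.poly_mul {ε : ℕ → ℝ≥0} (hε : Negligible fun κ => (ε κ : ℝ)) {s : ℕ → ℕ}
    (hs : PolyBounded s) : Negligible fun κ => ((s κ * ε κ : ℝ≥0) : ℝ) := by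
  obtain ⟨P, hP⟩ := hs
  have h := Asymptotics.SuperpolynomialDecay.polynomial_mul hε (P.map (Nat.castRingHom ℝ))
  refine Negligible.of_le h (Eventually.of_forall fun κ => ?_)
  have h1 : ((P.map (Nat.castRingHom ℝ)).eval (κ : ℝ)) = ((P.eval κ : ℕ) : ℝ) := by
    rw [Polynomial.eval_map, Polynomial.eval₂_at_natCast]
    simp
  change _ ≤ |(P.map (Nat.castRingHom ℝ)).eval (κ : ℝ) * (ε κ : ℝ)|
  rw [h1, abs_of_nonneg (by positivity), abs_of_nonneg (by positivity)]
  push_cast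
  have : (s κ : ℝ) ≤ ((P.eval κ : ℕ) : ℝ) := by exact_mod_cast hP κ
  gcongr

theorem Negligible.modify {ε δ : ℕ → ℝ≥0} (hε : Negligible fun κ => (ε κ : ℝ))
    (h : ∀ᶠ κ in atTop, δ κ = ε κ) : Negligible fun κ => (δ κ : ℝ) :=
  Negligible.of_le hε (h.mono fun κ hκ => by rw [hκ])

/-- A function that is negligible for all sequences of parameters has a uniform negligible
bound. -/
theorem exists_negligible_bound {W : ℕ → Type*} [∀ κ, Nonempty (W κ)] (f : ∀ κ, W κ → ℝ)
    (h0 : ∀ κ w, 0 ≤ f κ w) (h1 : ∀ κ w, f κ w ≤ 1)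
    (h : ∀ w : ∀ κ, W κ, Negligible fun κ => f κ (w κ)) :
    ∃ ε : ℕ → ℝ≥0, Negligible (fun κ => (ε κ : ℝ)) ∧ ∀ κ w, f κ w ≤ ε κ := by
  -- The supremum need not be attained, but some parameter reaches half of it; if it vanishes, any
  -- parameter will do. The sequence of these parameters is covered by the hypothesis.
  have hw : ∀ κ, ∃ w : W κ, ∀ w', f κ w' ≤ 2 * f κ w := by
    intro κ
    have hb : BddAbove (Set.range (f κ)) := ⟨1, by rintro _ ⟨w, rfl⟩; exact h1 κ w⟩
    by_cases hs : 0 < ⨆ w, f κ w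
    · obtain ⟨w, hw⟩ := exists_lt_of_lt_ciSup (half_lt_self hs)
      exact ⟨w, fun w' => by linarith [le_ciSup hb w']⟩
    · obtain ⟨w⟩ := ‹∀ κ, Nonempty (W κ)› κ
      exact ⟨w, fun w' => by linarith [le_ciSup hb w', h0 κ w]⟩
  choose w hw using hw
  refine ⟨fun κ => ⟨2 * f κ (w κ), by linarith [h0 κ (w κ)]⟩, ?_, fun κ w' => hw κ w'⟩
  exact Asymptotics.SuperpolynomialDecay.const_mul (h w) 2

end

/- ## Expectations -/

section

variable {α β γ : Type}

/-- The expectation of `f`. -/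
def expect (P : PMF α) (f : α → ℝ≥0∞) : ℝ≥0∞ := ∑' a, P a * f a

theorem expect_bind (P : PMF α) (Q : α → PMF β) (f : β → ℝ≥0∞) :
    expect (P.bind Q) f = expect P fun a => expect (Q a) f := by
  simp only [expect, PMF.bind_apply, ← ENNReal.tsum_mul_right, ← ENNReal.tsum_mul_left]
  rw [ENNReal.tsum_comm]
  simp only [mul_assoc]

theorem expect_pure (a : α) (f : α → ℝ≥0∞) : expect (PMF.pure a) f = f a := by
  rw [expect, tsum_eq_single a]
  · simp
  · intro b hb
    simp [PMF.pure_apply, hb]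

theorem expect_map (P : PMF α) (g : α → β) (f : β → ℝ≥0∞) :
    expect (P.map g) f = expect P fun a => f (g a) := by
  rw [PMF.map, expect_bind]
  simp only [Function.comp, expect_pure]

theorem expect_add (P : PMF α) (f g : α → ℝ≥0∞) :
    (expect P fun a => f a + g a) = expect P f + expect P g := by
  simp only [expect, mul_add, ENNReal.tsum_add]

theorem expect_const (P : PMF α) (c : ℝ≥0∞) : (expect P fun _ => c) = c := by
  rw [expect, ENNReal.tsum_mul_right, P.tsum_coe, one_mul]

theorem expect_mono {P : PMF α} {f g : α → ℝ≥0∞} (h : ∀ a ∈ P.support, f a ≤ g a) :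
    expect P f ≤ expect P g := by
  refine ENNReal.tsum_le_tsum fun a => ?_
  by_cases ha : P a = 0
  · simp [ha]
  · gcongr
    exact h a ((P.mem_support_iff a).2 ha)

theorem expect_le {P : PMF α} {f : α → ℝ≥0∞} {c : ℝ≥0∞} (h : ∀ a ∈ P.support, f a ≤ c) :
    expect P f ≤ c :=
  (expect_mono h).trans (expect_const P c).le

theorem expect_sum {ι : Type} (s : Finset ι) (P : PMF α) (f : ι → α → ℝ≥0∞) :
    (expect P fun a => ∑ j ∈ s, f j a) = ∑ j ∈ s, expect P (f j) := by
  classical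
  induction s using Finset.induction_on with
  | empty => simp [expect_const]
  | insert j s hj ih => simp only [Finset.sum_insert hj, expect_add, ih]

theorem expect_comm (P : PMF α) (Q : PMF β) (f : α → β → ℝ≥0∞) :
    (expect P fun a => expect Q (f a)) = expect Q fun b => expect P fun a => f a b := by
  simp only [expect, ← ENNReal.tsum_mul_left]
  rw [ENNReal.tsum_comm]
  simp only [mul_left_comm]

theorem expect_indicator (P : PMF α) (s : Set α) [DecidablePred (· ∈ s)] :
    (expect P fun a => if a ∈ s then 1 else 0) = P.toOuterMeasure s := by
  rw [expect, PMF.toOuterMeasure_apply]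
  congr 1
  funext a
  by_cases h : a ∈ s <;> simp [h]

theorem toOuterMeasure_le_one (P : PMF α) (s : Set α) : P.toOuterMeasure s ≤ 1 := by
  classical
  rw [← expect_indicator]
  exact expect_le fun a _ => by split_ifs <;> simp

theorem toOuterMeasure_eq_ofReal (P : PMF α) (s : Set α) :
    P.toOuterMeasure s = ENNReal.ofReal (prob P s) := by
  rw [prob, ENNReal.ofReal_toReal]
  exact ((toOuterMeasure_le_one P s).trans_lt ENNReal.one_lt_top).ne

theorem prob_nonneg (P : PMF α) (s : Set α) : 0 ≤ prob P s := ENNReal.toReal_nonneg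

theorem prob_le_one (P : PMF α) (s : Set α) : prob P s ≤ 1 :=
  ENNReal.toReal_le_of_le_ofReal zero_le_one (by simpa using toOuterMeasure_le_one P s)

theorem prob_singleton (P : PMF α) (a : α) : prob P {a} = (P a).toReal := by
  rw [prob, PMF.toOuterMeasure_apply_singleton]

/- ## Statistical distance -/

/-- No test distinguishes `X` and `Y` with an advantage greater than `ε`. -/
def SD (ε : ℝ≥0∞) (X Y : PMF α) : Prop :=
  ∀ D : α → PMF Bool, (X.bind D) true ≤ (Y.bind D) true + ε ∧ (Y.bind D) true ≤ (X.bind D) true + ε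

theorem bind_true (X : PMF α) (D : α → PMF Bool) : (X.bind D) true = expect X fun a => D a true :=
  rfl

theorem SD.of_eq {ε : ℝ≥0∞} {X Y : PMF α} (h : X = Y) : SD ε X Y := fun _ => by simp [h]

theorem SD.mono {ε δ : ℝ≥0∞} {X Y : PMF α} (h : SD ε X Y) (hε : ε ≤ δ) : SD δ X Y := fun D =>
  ⟨(h D).1.trans (by gcongr), (h D).2.trans (by gcongr)⟩

theorem SD.trans {ε δ : ℝ≥0∞} {X Y Z : PMF α} (h : SD ε X Y) (h' : SD δ Y Z) :
    SD (ε + δ) X Z := fun D =>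
  ⟨calc (X.bind D) true ≤ (Y.bind D) true + ε := (h D).1
    _ ≤ (Z.bind D) true + δ + ε := by gcongr; exact (h' D).1
    _ = _ := by ring,
   calc (Z.bind D) true ≤ (Y.bind D) true + δ := (h' D).2
    _ ≤ (X.bind D) true + ε + δ := by gcongr; exact (h D).2
    _ = _ := by ring⟩

theorem SD.one (X Y : PMF α) : SD 1 X Y := fun D =>
  ⟨((X.bind D).coe_le_one true).trans le_add_self, ((Y.bind D).coe_le_one true).trans le_add_self⟩

theorem SD.bind_left {ε : ℝ≥0∞} {X Y : PMF α} (h : SD ε X Y) (k : α → PMF β) :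
    SD ε (X.bind k) (Y.bind k) := fun D => by
  simp only [PMF.bind_bind]
  exact h _

/-- The error may depend on the sampled value and enters only through its expectation. This is what
converts failure probabilities into distances. -/
theorem SD.bind_right {P : PMF α} {ε : α → ℝ≥0∞} {f g : α → PMF β}
    (h : ∀ a ∈ P.support, SD (ε a) (f a) (g a)) : SD (expect P ε) (P.bind f) (P.bind g) := fun D => by
  simp only [PMF.bind_bind, bind_true, ← expect_add]
  exact ⟨expect_mono fun a ha => (h a ha D).1, expect_mono fun a ha => (h a ha D).2⟩

theorem SD.bind_right_const {P : PMF α} {ε : ℝ≥0∞} {f g : α → PMF β}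
    (h : ∀ a ∈ P.support, SD ε (f a) (g a)) : SD ε (P.bind f) (P.bind g) := by
  simpa only [expect_const] using SD.bind_right (ε := fun _ => ε) h

theorem SD.bind {X Y : PMF α} {ε δ : ℝ≥0∞} {f g : α → PMF β} (h : SD ε X Y)
    (h' : ∀ a ∈ Y.support, SD δ (f a) (g a)) : SD (ε + δ) (X.bind f) (Y.bind g) :=
  (h.bind_left f).trans (SD.bind_right_const h')

theorem SD.indep {r : ℕ} {X Y : Fin r → PMF α} {ε : Fin r → ℝ≥0∞}
    (h : ∀ j, SD (ε j) (X j) (Y j)) : SD (∑ j, ε j) (indep r X) (indep r Y) := by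
  induction r with
  | zero => exact SD.of_eq rfl
  | succ r ih =>
    rw [Fin.sum_univ_succ]
    exact SD.bind (h 0) fun a _ => (ih fun j => h j.succ).bind_left _

/- ## Computational indistinguishability for families -/

/-- Circuits with `s` gates do not distinguish `X` and `Y` with an advantage greater than `ε`. -/
def Close (p : ℕ) [Fact p.Prime] [Data p α] (s : ℕ) (ε : ℝ≥0∞) (X Y : PMF α) : Prop :=
  ∀ D : α → PMF Bool, HasCost p D s →
    (X.bind D) true ≤ (Y.bind D) true + ε ∧ (Y.bind D) true ≤ (X.bind D) true + ε

theorem SD.close {p : ℕ} [Fact p.Prime] [Data p α] {s : ℕ} {ε : ℝ≥0∞} {X Y : PMF α}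
    (h : SD ε X Y) : Close p s ε X Y := fun D _ => h D

theorem Close.trans {p : ℕ} [Fact p.Prime] [Data p α] {s : ℕ} {ε δ : ℝ≥0∞} {X Y Z : PMF α}
    (h : Close p s ε X Y) (h' : Close p s δ Y Z) : Close p s (ε + δ) X Z := fun D hD =>
  ⟨calc (X.bind D) true ≤ (Y.bind D) true + ε := (h D hD).1
    _ ≤ (Z.bind D) true + δ + ε := by gcongr; exact (h' D hD).1
    _ = _ := by ring,
   calc (Z.bind D) true ≤ (Y.bind D) true + δ := (h' D hD).2
    _ ≤ (X.bind D) true + ε + δ := by gcongr; exact (h D hD).2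
    _ = _ := by ring⟩

theorem Close.symm {p : ℕ} [Fact p.Prime] [Data p α] {s : ℕ} {ε : ℝ≥0∞} {X Y : PMF α}
    (h : Close p s ε X Y) : Close p s ε Y X := fun D hD => ⟨(h D hD).2, (h D hD).1⟩

theorem Close.hybrid {p : ℕ} [Fact p.Prime] [Data p α] {s : ℕ} {ε : ℝ≥0∞} {H : ℕ → PMF α}
    (r : ℕ) (h : ∀ j < r, Close p s ε (H j) (H (j + 1))) : Close p s (r * ε) (H 0) (H r) := by
  induction r with
  | zero => exact (SD.of_eq rfl).close
  | succ r ih =>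
    have := (ih fun j hj => h j (by omega)).trans (h r (by omega))
    simpa [add_mul] using this

end

/-- The distributions `X i` and `Y i` are computationally indistinguishable, uniformly for all `i`
of the same level. -/
def CI {I : Type} (N p : I → ℕ) [∀ i, Fact (p i).Prime] {α : I → Type} [∀ i, Data (p i) (α i)]
    (X Y : ∀ i, PMF (α i)) : Prop :=
  ∀ P : Polynomial ℕ, ∃ ε : ℕ → NNReal, Negligible (fun κ => (ε κ : ℝ)) ∧
    ∀ i, Close (p i) (P.eval (N i)) (ε (N i)) (X i) (Y i)

/-- The distributions `X i` and `Y i` are statistically indistinguishable, uniformly for all `i`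
of the same level. -/
def SI {I : Type} (N : I → ℕ) {α : I → Type} (X Y : ∀ i, PMF (α i)) : Prop :=
  ∃ ε : ℕ → NNReal, Negligible (fun κ => (ε κ : ℝ)) ∧ ∀ i, SD (ε (N i)) (X i) (Y i)

section

variable {I J : Type} {N p : I → ℕ} {α β γ Z : I → Type} {X Y W : ∀ i, PMF (α i)} {n : I → ℕ}

/-- At the finitely many exceptional levels the trivial bound 1 is used, which does not affect
negligibility. The conditions k < p and p ≠ 2 will be available only eventually. -/
theorem SI.of_eventually {X Y : ∀ i, PMF (α i)}
    (h : ∃ ε : ℕ → NNReal, Negligible (fun κ => (ε κ : ℝ)) ∧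
      ∀ᶠ κ in atTop, ∀ i, N i = κ → SD (ε κ) (X i) (Y i)) : SI N X Y := by
  classical
  obtain ⟨ε, hε, h⟩ := h
  obtain ⟨κ₀, h⟩ := eventually_atTop.1 h
  refine ⟨fun κ => if κ₀ ≤ κ then ε κ else 1, hε.modify ?_, fun i => ?_⟩
  · exact (eventually_ge_atTop κ₀).mono fun κ hκ => if_pos hκ
  · by_cases hi : κ₀ ≤ N i
    · simpa [hi] using h _ hi i rfl
    · simpa [hi] using SD.one _ _

variable [∀ i, Fact (p i).Prime] [∀ i, Data (p i) (α i)] [∀ i, Data (p i) (β i)]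
  [∀ i, Data (p i) (γ i)]

theorem SI.ci (h : SI N X Y) : CI N p X Y := fun _ =>
  let ⟨ε, hε, h⟩ := h
  ⟨ε, hε, fun i => (h i).close⟩

theorem CI.of_eq (h : ∀ i, X i = Y i) : CI N p X Y :=
  SI.ci ⟨fun _ => 0, negligible_zero, fun i => SD.of_eq (h i)⟩

theorem CI.symm (h : CI N p X Y) : CI N p Y X := fun P =>
  let ⟨ε, hε, h⟩ := h P
  ⟨ε, hε, fun i => (h i).symm⟩

theorem CI.trans (h : CI N p X Y) (h' : CI N p Y W) : CI N p X W := fun P =>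
  let ⟨ε, hε, h⟩ := h P
  let ⟨δ, hδ, h'⟩ := h' P
  ⟨fun κ => ε κ + δ κ, hε.add hδ, fun i => by
    rw [ENNReal.coe_add]
    exact (h i).trans (h' i)⟩

theorem CI.reindex (h : CI N p X Y) (φ : J → I) :
    CI (fun j => N (φ j)) (fun j => p (φ j)) (fun j => X (φ j)) fun j => Y (φ j) := fun P =>
  let ⟨ε, hε, h⟩ := h P
  ⟨ε, hε, fun j => h (φ j)⟩

/-- Efficient postprocessing. -/
theorem CI.bind_pt (h : CI N p X Y) {g : ∀ i, α i → PMF (β i)} (hg : PT N p g) :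
    CI N p (fun i => (X i).bind (g i)) fun i => (Y i).bind (g i) := fun P => by
  obtain ⟨Q, hQ⟩ := hg
  obtain ⟨ε, hε, h⟩ := h (Q + P)
  refine ⟨ε, hε, fun i D hD => ?_⟩
  simp only [PMF.bind_bind]
  refine h i _ ?_
  rw [Polynomial.eval_add]
  exact (hQ i).bind (g := fun _ b => D b)
    ((HasCost.comp (HasCost.wiring (f := fun x : α i × β i => x.2) Sum.inr fun _ _ => rfl) hD).mono
      (by omega))

theorem CI.map (h : CI N p X Y) {g : ∀ i, α i → β i} (hg : DT N p g) :
    CI N p (fun i => (X i).map (g i)) fun i => (Y i).map (g i) :=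
  CI.bind_pt h hg

/-- Common randomness that is independent of the rest may be fixed. -/
theorem CI.average (P : ∀ i, PMF (Z i)) {X Y : ∀ i, Z i → PMF (α i)}
    (h : CI (I := Σ i, Z i) (fun x => N x.1) (fun x => p x.1) (fun x => X x.1 x.2)
      fun x => Y x.1 x.2) :
    CI N p (fun i => (P i).bind (X i)) fun i => (P i).bind (Y i) := fun Q => by
  obtain ⟨ε, hε, h⟩ := h Q
  refine ⟨ε, hε, fun i D hD => ?_⟩
  simp only [PMF.bind_bind, bind_true _ (fun _ => PMF.bind _ _)]
  rw [← expect_const (P i) (ε (N i) : ENNReal), ← expect_add, ← expect_add]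
  exact ⟨expect_mono fun z _ => (h ⟨i, z⟩ D hD).1, expect_mono fun z _ => (h ⟨i, z⟩ D hD).2⟩

/-- The position in the chain is part of the index, so all steps of a level share one negligible
error, and polynomially many copies of it stay negligible. A separate negligible bound for each step
would not suffice. -/
theorem CI.hybrid (hn : PolyBdd N n) {H : ∀ i, ℕ → PMF (α i)}
    (h : CI (I := Σ i, Fin (n i)) (fun x => N x.1) (fun x => p x.1) (fun x => H x.1 x.2)
      fun x => H x.1 (x.2 + 1)) :
    CI N p (fun i => H i 0) fun i => H i (n i) := fun P => by
  obtain ⟨Q, hQ⟩ := hn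
  obtain ⟨ε, hε, h⟩ := h P
  refine ⟨fun κ => (Q.eval κ : ℕ) * ε κ, hε.poly_mul ⟨Q, fun _ => le_rfl⟩, fun i => ?_⟩
  have := Close.hybrid (p := p i) (s := P.eval (N i)) (ε := ε (N i)) (H := H i) (n i)
    fun j hj => h ⟨i, ⟨j, hj⟩⟩
  intro D hD
  have h1 : (n i : ENNReal) * ε (N i) ≤ (((Q.eval (N i) : ℕ) * ε (N i) : NNReal) : ENNReal) := by
    rw [ENNReal.coe_mul]
    gcongr
    simpa using hQ i
  exact ⟨(this D hD).1.trans (by gcongr), (this D hD).2.trans (by gcongr)⟩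

end

/- ### Replacing one component of independent samples -/

theorem indep_update_pure {α : Type} (r : ℕ) (v : Fin r → α) (l : Fin r) (P : PMF α) :
    indep r (Function.update (fun j => PMF.pure (v j)) l P) = P.map (Function.update v l) := by
  induction r with
  | zero => exact l.elim0
  | succ r ih =>
    change ((Function.update (fun j => PMF.pure (v j)) l P 0).bind fun b =>
        (indep r fun j => Function.update (fun j => PMF.pure (v j)) l P j.succ).bind fun w =>
          PMF.pure (Fin.cons b w : Fin (r + 1) → α)) = _
    refine Fin.cases ?_ (fun l => ?_) l
    · have : (fun j : Fin r => Function.update (fun j => PMF.pure (v j)) 0 P j.succ) =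
          fun j => PMF.pure (v j.succ) := by
        funext j
        simp
      rw [this, indep_pure, Function.update_self]
      simp only [PMF.pure_bind]
      refine congrArg P.bind (funext fun a => congrArg PMF.pure ?_)
      funext j
      refine Fin.cases ?_ (fun j => ?_) j <;> simp
    · have : (fun j : Fin r => Function.update (fun j => PMF.pure (v j)) l.succ P j.succ) =
          Function.update (fun j => PMF.pure (v j.succ)) l P := by
        funext j
        by_cases hj : j = l
        · subst hj; simp
        · rw [Function.update_of_ne hj, Function.update_of_ne (by simpa using hj)]
      rw [this, ih (fun j => v j.succ), Function.update_of_ne (Fin.succ_ne_zero l).symm,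
        PMF.pure_bind, PMF.bind_map]
      refine congrArg P.bind (funext fun a => congrArg PMF.pure ?_)
      funext j
      refine Fin.cases ?_ (fun j => ?_) j
      · simp [Function.update_of_ne (Fin.succ_ne_zero l).symm]
      · by_cases hj : j = l
        · subst hj; simp
        · rw [Function.update_of_ne (by simpa using hj), Fin.cons_succ, Function.update_of_ne hj]

/-- The kernel keeps every component except `l`, which forgets its value and is drawn afresh.
Neighbouring hybrids thereby become one common sample with a single component overwritten by two
different laws. -/
theorem indep_update {α : Type} (r : ℕ) (f : Fin r → PMF α) (l : Fin r) (P : PMF α) :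
    indep r (Function.update f l P) = (indep r f).bind fun v => P.map (Function.update v l) := by
  have := indep_bind r f fun j a => Function.update (fun _ => PMF.pure a) l P j
  convert this using 2
  · funext j
    by_cases hj : j = l
    · subst hj; simp
    · simp [Function.update_of_ne hj, PMF.bind_pure]
  · funext v
    rw [← indep_update_pure]
    congr 1

section

variable {I J : Type} {N p : I → ℕ} {α β γ Z : I → Type} [∀ i, Fact (p i).Prime]
  [∀ i, Data (p i) (α i)] [∀ i, Data (p i) (β i)] [∀ i, Data (p i) (γ i)] {n : I → ℕ}

theorem DT.update {f : ∀ i, α i → Fin (n i) → β i} {l : ∀ i, Fin (n i)} {g : ∀ i, α i → β i}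
    (hf : DT N p f) (hg : DT N p g) : DT N p fun i a => Function.update (f i a) (l i) (g i a) := by
  refine DT.comp (f := fun i (x : (Fin (n i) → β i) × β i) => Function.update x.1 (l i) x.2)
    (DT.of_wiring (fun i (o : Fin (n i) × Data.Idx (p i) (β i)) =>
      if o.1 = l i then Sum.inr o.2 else Sum.inl o) ?_) (hf.prodMk hg)
  rintro i ⟨v, b⟩ ⟨j, o⟩
  change Data.enc (Function.update v (l i) b j) o = _
  by_cases hj : j = l i
  · subst hj
    rw [Function.update_self, if_pos rfl]
    rfl
  · simp only [Function.update_of_ne hj, if_neg hj]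
    rfl

theorem PT.ite_index {c : I → Prop} [DecidablePred c] {f g : ∀ i, α i → PMF (β i)}
    (hf : PT N p f) (hg : PT N p g) : PT N p fun i => if c i then f i else g i :=
  let ⟨_, hP⟩ := hf
  let ⟨_, hQ⟩ := hg
  PT.of_cost ((polyBdd_eval _).add (polyBdd_eval _)) fun i => by
    split_ifs
    · exact (hP i).mono (Nat.le_add_right _ _)
    · exact (hQ i).mono (Nat.le_add_left _ _)

/-- Independent samples may be replaced one by one. -/
theorem CI.indep_congr (hn : PolyBdd N n) (hα : FewWires N p α) {X Y : ∀ i, Fin (n i) → PMF (α i)}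
    (h : CI (I := Σ i, Fin (n i)) (fun x => N x.1) (fun x => p x.1) (fun x => X x.1 x.2)
      fun x => Y x.1 x.2) :
    CI N p (fun i => indep (n i) (X i)) fun i => indep (n i) (Y i) := by
  let K : ∀ i, ℕ → Fin (n i) → PMF (α i) := fun i l j => if j < l then Y i j else X i j
  have key := CI.hybrid (N := N) (p := p) (H := fun i l => indep (n i) (K i l)) hn ?_
  · have h0 : ∀ i, K i 0 = X i := fun i => by
      funext j
      simp [K]
    have h1 : ∀ i, K i (n i) = Y i := fun i => by
      funext j
      simp [K]
    simpa only [h0, h1] using key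
  · have hX : ∀ x : Σ i, Fin (n i), indep (n x.1) (K x.1 x.2) =
        (indep (n x.1) (K x.1 x.2)).bind fun v => (X x.1 x.2).map (Function.update v x.2) := by
      intro x
      rw [← indep_update]
      congr 1
      funext j
      by_cases hj : j = x.2
      · subst hj; simp [K]
      · rw [Function.update_of_ne hj]
    have hY : ∀ x : Σ i, Fin (n i), indep (n x.1) (K x.1 (x.2 + 1)) =
        (indep (n x.1) (K x.1 x.2)).bind fun v => (Y x.1 x.2).map (Function.update v x.2) := by
      intro x
      rw [← indep_update]
      congr 1
      funext j
      by_cases hj : j = x.2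
      · subst hj; simp [K]
      · have : (j : ℕ) ≠ x.2 := fun h => hj (Fin.ext h)
        rw [Function.update_of_ne hj]
        simp only [K, show (j : ℕ) < x.2 + 1 ↔ (j : ℕ) < x.2 by omega]
    refine (CI.of_eq hX).trans (CI.trans ?_ (CI.of_eq hY).symm)
    -- The other components are fixed and wired in rather than sampled by the reduction, so no
    -- efficient samplers for `X` and `Y` are required.
    refine CI.average _ ?_
    refine CI.map (h.reindex (J := Σ x : Σ i, Fin (n i), Fin (n x.1) → α x.1) Sigma.fst)
      (g := fun (x : Σ x : Σ i, Fin (n i), Fin (n x.1) → α x.1) a =>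
        Function.update x.2 x.1.2 a) ?_
    exact DT.update (DT.const ((FewWires.pi hn hα).reindex
      fun x : Σ x : Σ i, Fin (n i), Fin (n x.1) → α x.1 => x.1.1) fun x => x.2) DT.id

/-- Independent samples that depend on a common context may be replaced one by one. -/
theorem CI.indep_context (hn : PolyBdd N n) {P : ∀ i, PMF (γ i)}
    {A B : ∀ i, Fin (n i) → γ i → PMF (α i)}
    (hA : PT (I := Σ i, Fin (n i)) (fun x => N x.1) (fun x => p x.1) fun x a => A x.1 x.2 a)
    (hB : PT (I := Σ i, Fin (n i)) (fun x => N x.1) (fun x => p x.1) fun x a => B x.1 x.2 a)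
    (h : CI (I := Σ i, Fin (n i)) (fun x => N x.1) (fun x => p x.1)
      (fun x => (P x.1).bind fun c => (A x.1 x.2 c).map fun z => (c, z))
      fun x => (P x.1).bind fun c => (B x.1 x.2 c).map fun z => (c, z)) :
    CI N p (fun i => (P i).bind fun c => (indep (n i) fun j => A i j c).map fun z => (c, z))
      fun i => (P i).bind fun c => (indep (n i) fun j => B i j c).map fun z => (c, z) := by
  let K : ∀ i, ℕ → γ i → Fin (n i) → PMF (α i) := fun i l c j =>
    if (j : ℕ) < l then B i j c else A i j c
  have key := CI.hybrid (N := N) (p := p) (H := fun i l => (P i).bind fun c =>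
    (_root_.indep (n i) (K i l c)).map fun z => (c, z)) hn ?_
  · have h0 : ∀ i c, K i 0 c = fun j => A i j c := fun i c => by
      funext j
      simp [K]
    have h1 : ∀ i c, K i (n i) c = fun j => B i j c := fun i c => by
      funext j
      simp [K]
    simpa only [h0, h1] using key
  -- The reduction: from the context and one challenge component it samples all other components
  -- itself. They depend on the context, so they cannot be fixed beforehand, and `A` and `B` have to
  -- be efficient.
  · let G : ∀ x : Σ i, Fin (n i), γ x.1 × α x.1 → PMF (γ x.1 × (Fin (n x.1) → α x.1)) := fun x y =>
      (_root_.indep (n x.1) (K x.1 x.2 y.1)).bind fun v => PMF.pure (y.1, Function.update v x.2 y.2)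
    have hG : PT (fun x => N x.1) (fun x => p x.1) G := by
      refine PT.bind (f := fun (x : Σ i, Fin (n i)) (y : γ x.1 × α x.1) =>
        _root_.indep (n x.1) (K x.1 x.2 y.1)) (PT.indep (hn.reindex Sigma.fst) ?_) ?_
      · have hA' := hA.reindex (J := Σ x : Σ i, Fin (n i), Fin (n x.1)) fun y => ⟨y.1.1, y.2⟩
        have hB' := hB.reindex (J := Σ x : Σ i, Fin (n i), Fin (n x.1)) fun y => ⟨y.1.1, y.2⟩
        have := PT.ite_index (c := fun y => (y.2 : ℕ) < y.1.2) hB' hA'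
        refine PT.comp (f := fun (y : Σ x : Σ i, Fin (n i), Fin (n x.1)) c =>
          K y.1.1 y.1.2 c y.2) ?_ DT.id.fst
        convert this using 3 with y c
        simp only [K]
        split_ifs <;> rfl
      · exact DT.prodMk DT.id.fst.fst (DT.update DT.id.snd DT.id.fst.snd)
    have hX : ∀ x : Σ i, Fin (n i), ((P x.1).bind fun c =>
        (_root_.indep (n x.1) (K x.1 x.2 c)).map fun z => (c, z)) =
        ((P x.1).bind fun c => (A x.1 x.2 c).map fun z => (c, z)).bind (G x) := by
      intro x
      simp only [PMF.bind_bind, PMF.bind_map, G, Function.comp_def]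
      refine congrArg _ (funext fun c => ?_)
      rw [PMF.bind_comm]
      have : K x.1 x.2 c = Function.update (K x.1 x.2 c) x.2 (A x.1 x.2 c) := by
        funext j
        by_cases hj : j = x.2
        · subst hj; simp [K]
        · rw [Function.update_of_ne hj]
      conv_lhs => rw [this, indep_update]
      rw [PMF.map_bind]
      simp only [PMF.map_comp]
      rfl
    have hY : ∀ x : Σ i, Fin (n i), ((P x.1).bind fun c =>
        (_root_.indep (n x.1) (K x.1 (x.2 + 1) c)).map fun z => (c, z)) =
        ((P x.1).bind fun c => (B x.1 x.2 c).map fun z => (c, z)).bind (G x) := by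
      intro x
      simp only [PMF.bind_bind, PMF.bind_map, G, Function.comp_def]
      refine congrArg _ (funext fun c => ?_)
      rw [PMF.bind_comm]
      have : K x.1 (x.2 + 1) c = Function.update (K x.1 x.2 c) x.2 (B x.1 x.2 c) := by
        funext j
        by_cases hj : j = x.2
        · subst hj; simp [K]
        · have : (j : ℕ) ≠ x.2 := fun h => hj (Fin.ext h)
          rw [Function.update_of_ne hj]
          simp only [K, show (j : ℕ) < x.2 + 1 ↔ (j : ℕ) < x.2 by omega]
      conv_lhs => rw [this, indep_update]
      rw [PMF.map_bind]
      simp only [PMF.map_comp]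
      rfl
    exact (CI.of_eq hX).trans ((h.bind_pt hG).trans (CI.of_eq hY).symm)

end

/- ### Indistinguishability for all sequences of parameters -/

theorem toReal_true_sub_le {a b : ENNReal} {ε : NNReal} (ha : a ≤ 1) (hb : b ≤ 1)
    (h1 : a ≤ b + ε) (h2 : b ≤ a + ε) : |a.toReal - b.toReal| ≤ ε := by
  lift a to NNReal using (ha.trans_lt ENNReal.one_lt_top).ne
  lift b to NNReal using (hb.trans_lt ENNReal.one_lt_top).ne
  norm_cast at h1 h2
  rw [abs_le]
  simp only [ENNReal.coe_toReal]
  have h1' : (a : ℝ) ≤ b + ε := by exact_mod_cast h1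
  have h2' : (b : ℝ) ≤ a + ε := by exact_mod_cast h2
  constructor <;> linarith

theorem le_add_of_toReal_sub_le {a b : ENNReal} {ε : NNReal} (ha : a ≤ 1) (hb : b ≤ 1)
    (h : |a.toReal - b.toReal| ≤ ε) : a ≤ b + ε ∧ b ≤ a + ε := by
  lift a to NNReal using (ha.trans_lt ENNReal.one_lt_top).ne
  lift b to NNReal using (hb.trans_lt ENNReal.one_lt_top).ne
  rw [abs_le] at h
  simp only [ENNReal.coe_toReal] at h
  norm_cast
  constructor
  · have : (a : ℝ) ≤ b + ε := by linarith
    exact_mod_cast this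
  · have : (b : ℝ) ≤ a + ε := by linarith
    exact_mod_cast this

section

variable {q : ℕ → ℕ} [∀ κ, Fact (q κ).Prime] {α : ℕ → Type} [∀ κ, Data (q κ) (α κ)]

theorem CI.indist {X Y : ∀ κ, PMF (α κ)} (h : CI (fun κ => κ) q X Y) : Indist q X Y := by
  rintro D ⟨C, ⟨P, hP⟩, hC⟩
  obtain ⟨ε, hε, h⟩ := h P
  refine hε.of_le (Eventually.of_forall fun κ => ?_)
  have := h κ (D κ) ⟨C κ, hP κ, hC κ⟩
  rw [abs_of_nonneg (ε κ).coe_nonneg, prob_singleton, prob_singleton]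
  exact toReal_true_sub_le (PMF.coe_le_one _ _) (PMF.coe_le_one _ _) this.1 this.2

/-- The distinguisher is treated as a further parameter. A sequence consisting of a parameter and a
distinguisher of bounded size at each level is again admissible in the hypothesis, so the advantages
have a bound uniform in both. -/
theorem CI.of_indist {Z : ℕ → Type} [∀ κ, Nonempty (Z κ)] {X Y : ∀ κ, Z κ → PMF (α κ)}
    (h : ∀ z : ∀ κ, Z κ, Indist q (fun κ => X κ (z κ)) fun κ => Y κ (z κ)) :
    CI (I := Σ κ, Z κ) (fun x => x.1) (fun x => q x.1) (fun x => X x.1 x.2)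
      fun x => Y x.1 x.2 := fun P => by
  -- The additional gate guarantees that this set of tests is nonempty: a constant test costs one
  -- gate, whereas `P` may vanish.
  let T : ℕ → Type := fun κ => {D : α κ → PMF Bool // HasCost (q κ) D (P.eval κ + 1)}
  have hT : ∀ κ, Nonempty (T κ) := fun κ =>
    ⟨⟨fun _ => PMF.pure true, (HasCost.bool_iff.2 (HasCost.constF (bitF (q κ) true))).mono
      (by omega)⟩⟩
  obtain ⟨ε, hε, hb⟩ := exists_negligible_bound (W := fun κ => Z κ × T κ)
    (fun κ w => |prob ((X κ w.1).bind w.2.1) {true} - prob ((Y κ w.1).bind w.2.1) {true}|)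
    (fun κ w => abs_nonneg _)
    (fun κ w => by
      have h1 := prob_nonneg ((X κ w.1).bind w.2.1) {true}
      have h2 := prob_nonneg ((Y κ w.1).bind w.2.1) {true}
      have h3 := prob_le_one ((X κ w.1).bind w.2.1) {true}
      have h4 := prob_le_one ((Y κ w.1).bind w.2.1) {true}
      rw [abs_le]
      constructor <;> linarith)
    (fun w => by
      have := h (fun κ => (w κ).1) (fun κ => (w κ).2.1) (PT.polyTime
        (PT.of_cost ((polyBdd_eval P).add (polyBdd_const 1)) fun κ => (w κ).2.2))
      exact this.of_le (Eventually.of_forall fun κ => by rw [abs_abs]))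
  refine ⟨ε, hε, fun i D hD => ?_⟩
  have := hb i.1 (i.2, ⟨D, hD.mono (Nat.le_succ _)⟩)
  simp only [prob_singleton] at this
  exact le_add_of_toReal_sub_le (PMF.coe_le_one _ _) (PMF.coe_le_one _ _) this

end

/- ## Garbled Bloom filters -/

/-- Permutations of `W` carry the fibre over any point of `S` to the fibre over any other, so all
points of `S` have equal mass. -/
theorem map_unif_eq_uniformOfFinset {W α : Type} [Fintype W] [Nonempty W] (g : W → α)
    (S : Finset α) (hS : S.Nonempty) (hg : ∀ w, g w ∈ S)
    (h : ∀ a ∈ S, ∀ b ∈ S, ∃ e : W ≃ W, ∀ w, g w = a ↔ g (e w) = b) :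
    (unif W).map g = PMF.uniformOfFinset S hS := by
  classical
  have hconst : ∀ a ∈ S, ∀ b ∈ S, ((unif W).map g) a = ((unif W).map g) b := by
    intro a ha b hb
    obtain ⟨e, he⟩ := h a ha b hb
    simp only [PMF.map_apply, unif, PMF.uniformOfFintype_apply]
    rw [← e.tsum_eq fun w => if b = g w then (Fintype.card W : ENNReal)⁻¹ else 0]
    refine tsum_congr fun w => ?_
    simp only [eq_comm (b := g _), he w]
  have hzero : ∀ a ∉ S, ((unif W).map g) a = 0 := by
    intro a ha
    rw [PMF.apply_eq_zero_iff, PMF.mem_support_map_iff]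
    rintro ⟨w, -, rfl⟩
    exact ha (hg w)
  ext a
  by_cases ha : a ∈ S
  · rw [PMF.uniformOfFinset_apply_of_mem hS ha]
    have h1 : ∑ b ∈ S, ((unif W).map g) b = 1 := by
      rw [← ((unif W).map g).tsum_coe, tsum_eq_sum hzero]
    rw [Finset.sum_congr rfl fun b hb => hconst b hb a ha, Finset.sum_const, nsmul_eq_mul] at h1
    exact ENNReal.eq_inv_of_mul_eq_one_left (by rwa [mul_comm])
  · rw [PMF.uniformOfFinset_apply_of_notMem hS ha, hzero a ha]

section

variable {p k m : ℕ} [Fact p.Prime]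

/-- The empty positions that the next insertion fills. -/
def gbfNew (T : GBFTable p m) (pos : Fin k → Fin m) (q : Fin m) : Prop :=
  T q = none ∧ ∃ j, pos j = q

/-- The first position that the next insertion fills. -/
def gbfPivot (T : GBFTable p m) (pos : Fin k → Fin m) (q : Fin m) : Prop :=
  gbfNew T pos q ∧ ∀ q' < q, ¬gbfNew T pos q'

open Classical in
/-- The entries before the pivot is filled. -/
def gbfBase (T : GBFTable p m) (pos : Fin k → Fin m) (w : Fin m → ZMod p) (q : Fin m) : ZMod p :=
  if gbfNew T pos q then (if gbfPivot T pos q then 0 else w q) else (T q).getD 0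

open Classical in
/-- The number of hash functions that hit the pivot. -/
def gbfMult (T : GBFTable p m) (pos : Fin k → Fin m) : ZMod p :=
  ∑ j, if gbfPivot T pos (pos j) then 1 else 0

open Classical in
/-- One insertion: the new positions are filled with the values `w`, except for the first one,
whose value is determined by the required sum. -/
def gbfStep (T : GBFTable p m) (pos : Fin k → Fin m) (v : ZMod p) (w : Fin m → ZMod p) :
    GBFTable p m := fun q =>
  if gbfNew T pos q then
    some (if gbfPivot T pos q then
      (v - ∑ j, gbfBase T pos w (pos j)) * gbfMult T pos ^ (p - 2) else w q)
  else T q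

variable {T : GBFTable p m} {pos : Fin k → Fin m}

theorem exists_gbfPivot (h : ∃ j, T (pos j) = none) : ∃ q, gbfPivot T pos q := by
  obtain ⟨j, hj⟩ := h
  obtain ⟨q, hq, hmin⟩ := WellFounded.has_min (wellFounded_lt (α := Fin m))
    {q | gbfNew T pos q} ⟨pos j, hj, j, rfl⟩
  exact ⟨q, hq, fun q' hq' h => hmin q' h hq'⟩

theorem gbfPivot_unique {q q' : Fin m} (h : gbfPivot T pos q) (h' : gbfPivot T pos q') :
    q = q' := by
  rcases lt_trichotomy q q' with hlt | heq | hlt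
  · exact absurd h.1 (h'.2 q hlt)
  · exact heq
  · exact absurd h'.1 (h.2 q' hlt)

/-- Several hash functions may hit the pivot, so its entry occurs in the sum with a multiplicity.
This lies between 1 and k and hence does not vanish modulo p. -/
theorem gbfMult_ne_zero (hk : k < p) (h : ∃ j, T (pos j) = none) : gbfMult T pos ≠ 0 := by
  classical
  obtain ⟨q, hq⟩ := exists_gbfPivot h
  obtain ⟨j, hj⟩ := hq.1.2
  rw [gbfMult, Finset.sum_boole, Ne, ZMod.natCast_eq_zero_iff]
  intro hd
  have h1 : 0 < (Finset.univ.filter fun j => gbfPivot T pos (pos j)).card :=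
    Finset.card_pos.2 ⟨j, by simpa [hj] using hq⟩
  have h2 := (Finset.card_filter_le Finset.univ fun j => gbfPivot T pos (pos j))
  rw [Finset.card_univ, Fintype.card_fin] at h2
  have := Nat.le_of_dvd h1 hd
  omega

/-- Fermat's theorem supplies the inverse by which the pivot entry is solved for; circuits have no
division gate. -/
theorem mul_pow_sub_two {c : ZMod p} (hc : c ≠ 0) : c * c ^ (p - 2) = 1 := by
  have hp := (Fact.out : p.Prime).two_le
  rw [← pow_succ', show p - 2 + 1 = p - 1 by omega, ZMod.pow_card_sub_one_eq_one hc]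

/-- With all other entries given, the sum is affine in the pivot entry, with slope `gbfMult`. -/
theorem sum_getD_of_base {T' : GBFTable p m} {w : Fin m → ZMod p} {q₀ : Fin m}
    (hq₀ : gbfPivot T pos q₀) (h1 : ∀ q, ¬gbfNew T pos q → T' q = T q)
    (h2 : ∀ q, gbfNew T pos q → q ≠ q₀ → T' q = some (w q)) :
    ∑ j, (T' (pos j)).getD 0 =
      ∑ j, gbfBase T pos w (pos j) + gbfMult T pos * (T' q₀).getD 0 := by
  classical
  rw [gbfMult, Finset.sum_mul, ← Finset.sum_add_distrib]
  refine Finset.sum_congr rfl fun j _ => ?_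
  unfold gbfBase
  by_cases hn : gbfNew T pos (pos j)
  · by_cases hp : gbfPivot T pos (pos j)
    · obtain rfl := gbfPivot_unique hp hq₀
      simp [hn, hp]
    · have : pos j ≠ q₀ := fun h => hp (h ▸ hq₀)
      simp [hn, hp, h2 _ hn this]
  · have hp : ¬gbfPivot T pos (pos j) := fun h => hn h.1
    simp [hn, hp, h1 _ hn]

/-- The required sum is an affine equation for the pivot entry with invertible slope. So a filling
is determined by its new entries other than the pivot, and these can be prescribed freely. -/
theorem gbfStep_eq_iff (hk : k < p) (h : ∃ j, T (pos j) = none) {v : ZMod p}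
    {w : Fin m → ZMod p} {T' : GBFTable p m} :
    gbfStep T pos v w = T' ↔ T' ∈ gbfFillings T pos v ∧
      ∀ q, gbfNew T pos q → ¬gbfPivot T pos q → T' q = some (w q) := by
  classical
  obtain ⟨q₀, hq₀⟩ := exists_gbfPivot h
  have hc := mul_pow_sub_two (gbfMult_ne_zero hk h)
  have hne : ∀ q, gbfNew T pos q → (q ≠ q₀ ↔ ¬gbfPivot T pos q) := fun q _ =>
    ⟨fun h1 h2 => h1 (gbfPivot_unique h2 hq₀), fun h1 h2 => h1 (h2 ▸ hq₀)⟩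
  have hnew : ∀ q, (T q ≠ none ∨ ∀ j, pos j ≠ q) ↔ ¬gbfNew T pos q := fun q => by
    rw [gbfNew, not_and_or, not_exists]
  simp only [gbfFillings, Finset.mem_filter, Finset.mem_univ, true_and, hnew]
  constructor
  · rintro rfl
    have h1 : ∀ q, ¬gbfNew T pos q → gbfStep T pos v w q = T q := fun q hq => by
      simp [gbfStep, hq]
    have h2 : ∀ q, gbfNew T pos q → ¬gbfPivot T pos q → gbfStep T pos v w q = some (w q) :=
      fun q hq hq' => by simp [gbfStep, hq, hq']
    refine ⟨⟨h1, fun j => ?_, ?_⟩, h2⟩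
    · by_cases hj : gbfNew T pos (pos j)
      · simp [gbfStep, hj]
      · rw [h1 _ hj]
        exact fun h => hj ⟨h, j, rfl⟩
    · rw [sum_getD_of_base hq₀ h1 fun q hq hq' => h2 q hq ((hne q hq).1 hq')]
      simp only [gbfStep, hq₀.1, hq₀, if_true, Option.getD_some]
      linear_combination (v - ∑ j, gbfBase T pos w (pos j)) * hc
  · rintro ⟨⟨h1, h2, h3⟩, h4⟩
    funext q
    by_cases hq : gbfNew T pos q
    · by_cases hq' : gbfPivot T pos q
      · obtain rfl := gbfPivot_unique hq' hq₀
        rw [sum_getD_of_base hq₀ h1 fun q hq hq' => h4 q hq ((hne q hq).1 hq')] at h3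
        obtain ⟨j, rfl⟩ := hq.2
        obtain ⟨y, hy⟩ := Option.ne_none_iff_exists'.1 (h2 j)
        rw [hy] at h3 ⊢
        simp only [gbfStep, hq, hq', if_true, Option.some.injEq]
        rw [Option.getD_some] at h3
        linear_combination (-(gbfMult T pos ^ (p - 2))) * h3 + y * hc
      · simp [gbfStep, hq, hq', h4 q hq hq']
    · simp [gbfStep, hq, h1 q hq]

theorem gbfStep_mem (hk : k < p) (h : ∃ j, T (pos j) = none) (v : ZMod p) (w : Fin m → ZMod p) :
    gbfStep T pos v w ∈ gbfFillings T pos v :=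
  ((gbfStep_eq_iff hk h).1 rfl).1

/-- Translating `w` by the difference of two fillings maps the fibre of one onto that of the other,
so the fibres have the same size. The uniform choice from an implicitly described set thus becomes a
direct computation from uniform field elements. -/
theorem uniformOfFinset_gbfFillings (hk : k < p) (h : ∃ j, T (pos j) = none) (v : ZMod p)
    (hne : (gbfFillings T pos v).Nonempty) :
    PMF.uniformOfFinset (gbfFillings T pos v) hne =
      (unif (Fin m → ZMod p)).map (gbfStep T pos v) := by
  classical
  refine (map_unif_eq_uniformOfFinset _ _ hne (gbfStep_mem hk h v) fun T₁ h₁ T₂ h₂ => ?_).symm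
  refine ⟨Equiv.addRight fun q => (T₂ q).getD 0 - (T₁ q).getD 0, fun w => ?_⟩
  rw [gbfStep_eq_iff hk h, gbfStep_eq_iff hk h]
  simp only [h₁, h₂, true_and]
  refine forall_congr' fun q => imp_congr_right fun hq => imp_congr_right fun _ => ?_
  obtain ⟨j, rfl⟩ := hq.2
  simp only [gbfFillings, Finset.mem_filter] at h₁ h₂
  obtain ⟨y₁, hy₁⟩ := Option.ne_none_iff_exists'.1 (h₁.2.2.1 j)
  obtain ⟨y₂, hy₂⟩ := Option.ne_none_iff_exists'.1 (h₂.2.2.1 j)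
  simp only [Equiv.coe_addRight, Pi.add_apply, hy₁, hy₂, Option.getD_some, Option.some.injEq]
  constructor
  · rintro rfl; ring
  · intro h; linear_combination h

/-- Insertion of all values in the case where it cannot fail. -/
def gbfSample {n : ℕ} (pos : Fin n → Fin k → Fin m) (v : Fin n → ZMod p) (T : GBFTable p m) :
    PMF (GBFTable p m) :=
  iterP n (fun i T => (unif (Fin m → ZMod p)).map (gbfStep T (pos i) (v i))) T

/-- Each insertion finds an empty position. -/
def GBFInsertable {n : ℕ} (pos : Fin n → Fin k → Fin m) (T : GBFTable p m) : Prop :=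
  ∀ i, ∃ j, T (pos i j) = none ∧ ∀ i' < i, ∀ j', pos i' j' ≠ pos i j

theorem GBFInsertable.head {n : ℕ} {pos : Fin (n + 1) → Fin k → Fin m}
    (h : GBFInsertable pos T) : ∃ j, T (pos 0 j) = none :=
  let ⟨j, hj, _⟩ := h 0
  ⟨j, hj⟩

theorem GBFInsertable.tail {n : ℕ} {pos : Fin (n + 1) → Fin k → Fin m}
    (h : GBFInsertable pos T) (v : ZMod p) (w : Fin m → ZMod p) :
    GBFInsertable (fun i => pos i.succ) (gbfStep T (pos 0) v w) := by
  classical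
  intro i
  obtain ⟨j, hj, hj'⟩ := h i.succ
  refine ⟨j, ?_, fun i' hi' => hj' _ (Fin.succ_lt_succ_iff.2 hi')⟩
  have : ¬gbfNew T (pos 0) (pos i.succ j) := fun hn =>
    let ⟨j', h'⟩ := hn.2
    hj' 0 (Fin.succ_pos i) j' h'
  simp [gbfStep, this, hj]

/-- An insertion with an empty position always has a filling, so the failing branch is never taken
and the success flag is constant. -/
theorem gbfInsertAll_eq_gbfSample (hk : k < p) {n : ℕ} {pos : Fin n → Fin k → Fin m}
    (v : Fin n → ZMod p) (h : GBFInsertable pos T) :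
    gbfInsertAll (List.ofFn fun i => (pos i, v i)) T =
      (gbfSample pos v T).map fun T => (T, true) := by
  induction n generalizing T with
  | zero => simp [gbfInsertAll, gbfSample, iterP, PMF.pure_map]
  | succ n ih =>
    have hne : (gbfFillings T (pos 0) (v 0)).Nonempty := ⟨_, gbfStep_mem hk h.head _ 0⟩
    rw [List.ofFn_succ, gbfInsertAll, dif_pos hne, uniformOfFinset_gbfFillings hk h.head,
      gbfSample, iterP, PMF.bind_map, PMF.bind_map, PMF.map_bind]
    congr 1
    funext w
    exact ih (fun i => v i.succ) (h.tail _ _)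

/-- Filled entries are never changed again, so the sum arranged when a key is inserted survives all
later insertions. -/
theorem gbfSample_spec (hk : k < p) {n : ℕ} {pos : Fin n → Fin k → Fin m}
    {v : Fin n → ZMod p} (h : GBFInsertable pos T) {T' : GBFTable p m}
    (hT' : T' ∈ (gbfSample pos v T).support) :
    (∀ q, T q ≠ none → T' q = T q) ∧
      ∀ i, (∀ j, T' (pos i j) ≠ none) ∧ ∑ j, (T' (pos i j)).getD 0 = v i := by
  classical
  induction n generalizing T with
  | zero =>
    rw [gbfSample, iterP, PMF.mem_support_pure_iff] at hT'
    exact ⟨fun _ _ => by rw [hT'], fun i => i.elim0⟩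
  | succ n ih =>
    rw [gbfSample, iterP, PMF.bind_map, PMF.mem_support_bind_iff] at hT'
    obtain ⟨w, -, hw⟩ := hT'
    obtain ⟨h1, h2⟩ := ih (h.tail (v 0) w) (v := fun i => v i.succ) hw
    have hm := gbfStep_mem hk h.head (v 0) w
    simp only [gbfFillings, Finset.mem_filter, Finset.mem_univ, true_and] at hm
    obtain ⟨m1, m2, m3⟩ := hm
    refine ⟨fun q hq => ?_, fun i => Fin.cases ⟨fun j => ?_, ?_⟩ h2 i⟩
    · rw [h1 q, m1 q (Or.inl hq)]
      rwa [m1 q (Or.inl hq)]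
    · rw [h1 _ (m2 j)]
      exact m2 j
    · rw [← m3]
      exact Finset.sum_congr rfl fun j _ => by rw [h1 _ (m2 j)]

theorem gbfFinish_spec {T : GBFTable p m} {g : Fin m → ZMod p} (hg : g ∈ (gbfFinish T).support)
    {q : Fin m} (hq : T q ≠ none) : g q = (T q).getD 0 := by
  change g ∈ (PMF.bind _ fun w : Fin m → ZMod p => PMF.pure fun q => (T q).getD (w q)).support at hg
  rw [PMF.mem_support_bind_iff] at hg
  obtain ⟨w, -, hw'⟩ := hg
  rw [PMF.mem_support_pure_iff] at hw'
  obtain ⟨y, hy⟩ := Option.ne_none_iff_exists'.1 hq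
  simp [hw', hy]

end

/- ### Circuits for garbled Bloom filters -/

section

variable {I : Type} {N p : I → ℕ} [∀ i, Fact (p i).Prime] {α : I → Type} [∀ i, Data (p i) (α i)]
  {k m n : I → ℕ}

theorem DT.component {β : I → Type} [∀ i, Data (p i) (β i)] {f : ∀ i, α i → Fin (n i) → β i}
    (h : DT N p f) :
    DT (I := Σ i, Fin (n i)) (fun x => N x.1) (fun x => p x.1) (α := fun x => α x.1)
      (β := fun x => β x.1) fun x a => f x.1 a x.2 :=
  (h.reindex (Sigma.fst : (Σ i, Fin (n i)) → I)).eval fun x => x.2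

theorem boole_exists {p : ℕ} {k : ℕ} (P : Fin k → Prop) [DecidablePred P] [Decidable (∃ j, P j)] :
    (if ∃ j, P j then (1 : ZMod p) else 0) = 1 - ∏ j, (1 - if P j then 1 else 0) := by
  by_cases h : ∃ j, P j
  · obtain ⟨j, hj⟩ := h
    rw [if_pos ⟨j, hj⟩, Finset.prod_eq_zero (Finset.mem_univ j) (by simp [hj]), sub_zero]
  · rw [if_neg h]
    simp only [not_exists] at h
    simp [h]

theorem boole_forall {p : ℕ} {k : ℕ} (P : Fin k → Prop) [DecidablePred P] [Decidable (∀ j, P j)] :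
    (if ∀ j, P j then (1 : ZMod p) else 0) = ∏ j, if P j then 1 else 0 := by
  rw [Finset.prod_ite_zero]
  simp

/-- Indices are represented by indicator vectors, so comparison with a fixed position only reads one
wire. -/
theorem DT.boole_fin_eq {pos : ∀ i, α i → Fin (m i)} (h : DT N p pos) (q : ∀ i, Fin (m i)) :
    DT N p fun i a => (if pos i a = q i then (1 : ZMod (p i)) else 0) := by
  have := h.wire q
  convert this using 3 with i a
  change _ = _root_.bitF (p i) (decide (q i = pos i a))
  simp [_root_.bitF, eq_comm]

theorem DT.getD {T : ∀ i, α i → Option (ZMod (p i))} (h : DT N p T) :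
    DT N p fun i a => (T i a).getD 0 := by
  have := h.wire fun _ => Option.some ()
  convert this using 3 with i a
  change _ = Option.elim (T i a) 0 _
  cases T i a <;> rfl

theorem DT.boole_eq_none {T : ∀ i, α i → Option (ZMod (p i))} (h : DT N p T) :
    DT N p fun i a => (if T i a = none then (1 : ZMod (p i)) else 0) := by
  have := (DT.constF fun _ => 1).sub (h.wire fun _ => Option.none)
  convert this using 3 with i a
  change _ = 1 - Option.elim (T i a) 0 _
  cases T i a <;> simp

variable {T : ∀ i, α i → GBFTable (p i) (m i)} {pos : ∀ i, α i → Fin (k i) → Fin (m i)}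
  {v : ∀ i, α i → ZMod (p i)} {w : ∀ i, α i → Fin (m i) → ZMod (p i)}

open Classical in
theorem DT.gbfNew (hk : PolyBdd N k) (hT : DT N p T) (hpos : DT N p pos) (q : ∀ i, Fin (m i)) :
    DT N p fun i a => (if gbfNew (T i a) (pos i a) (q i) then (1 : ZMod (p i)) else 0) := by
  have h1 := (hT.eval q).boole_eq_none
  have h2 : DT N p fun i a => (if ∃ j, pos i a j = q i then (1 : ZMod (p i)) else 0) := by
    simp only [boole_exists]
    refine (DT.constF fun _ => 1).sub (DT.prod hk ?_)
    refine (DT.constF fun _ => 1).sub ?_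
    exact DT.boole_fin_eq hpos.component fun x => q x.1
  convert h1.mul h2 using 3 with i a
  by_cases c1 : T i a (q i) = none <;> by_cases c2 : ∃ j, pos i a j = q i <;>
    simp only [_root_.gbfNew, c1, c2, and_self, and_true, and_false, if_true, if_false, mul_one,
      mul_zero]

open Classical in
theorem DT.gbfPivot (hk : PolyBdd N k) (hm : PolyBdd N m) (hT : DT N p T) (hpos : DT N p pos)
    (q : ∀ i, Fin (m i)) :
    DT N p fun i a => (if gbfPivot (T i a) (pos i a) (q i) then (1 : ZMod (p i)) else 0) := by
  have h1 := DT.gbfNew hk hT hpos q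
  have h2 : DT N p fun i a => (if ∀ q', q' < q i → ¬_root_.gbfNew (T i a) (pos i a) q' then
      (1 : ZMod (p i)) else 0) := by
    simp only [boole_forall]
    refine DT.prod hm ?_
    have h3 : DT (fun x : Σ i, Fin (m i) => N x.1) (fun x => p x.1) fun x (a : α x.1) =>
        1 - (if x.2 < q x.1 then (1 : ZMod (p x.1)) else 0) *
          (if _root_.gbfNew (T x.1 a) (pos x.1 a) x.2 then 1 else 0) :=
      (DT.constF fun _ => 1).sub ((DT.constF fun x : Σ i, Fin (m i) =>
        (if x.2 < q x.1 then (1 : ZMod (p x.1)) else 0)).mul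
        (DT.gbfNew (hk.reindex Sigma.fst) (hT.reindex Sigma.fst) (hpos.reindex Sigma.fst)
          fun x : Σ i, Fin (m i) => x.2))
    convert h3 using 3 with x a
    by_cases h : x.2 < q x.1 <;> by_cases h' : _root_.gbfNew (T x.1 a) (pos x.1 a) x.2 <;>
      simp [h, h']
  convert h1.mul h2 using 3 with i a
  by_cases c1 : _root_.gbfNew (T i a) (pos i a) (q i)
  · simp only [_root_.gbfPivot, c1, true_and, if_true, one_mul]
  · simp only [_root_.gbfPivot, c1, false_and, if_false, zero_mul]

theorem DT.gbfBase (hk : PolyBdd N k) (hm : PolyBdd N m) (hT : DT N p T) (hpos : DT N p pos)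
    (hw : DT N p w) (q : ∀ i, Fin (m i)) :
    DT N p fun i a => gbfBase (T i a) (pos i a) (w i a) (q i) := by
  classical
  have h1 := DT.gbfNew hk hT hpos q
  have h2 := DT.gbfPivot hk hm hT hpos q
  convert (h1.mul (((DT.constF fun _ => 1).sub h2).mul (hw.eval q))).add
    (((DT.constF fun _ => 1).sub h1).mul (hT.eval q).getD) using 3 with i a
  unfold _root_.gbfBase
  split_ifs <;> simp

/-- Looking up a table at a computed position is the inner product of the table with the indicator
vector of that position. -/
theorem sum_comp_fin {p k m : ℕ} (pos : Fin k → Fin m) (f : Fin m → ZMod p) :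
    ∑ j, f (pos j) = ∑ j, ∑ q, (if pos j = q then 1 else 0) * f q := by
  simp

theorem DT.sum_comp (hk : PolyBdd N k) (hm : PolyBdd N m) (hpos : DT N p pos)
    {f : ∀ i, α i → Fin (m i) → ZMod (p i)}
    (hf : DT (I := Σ i, Fin (m i)) (fun x => N x.1) (fun x => p x.1) (α := fun x => α x.1)
      (β := fun x => ZMod (p x.1)) fun x a => f x.1 a x.2) :
    DT N p fun i a => ∑ j, f i a (pos i a j) := by
  simp only [sum_comp_fin]
  refine DT.sum hk (DT.sum (hm.reindex Sigma.fst) ?_)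
  refine DT.mul (DT.boole_fin_eq (hpos.component.reindex
    (Sigma.fst : (Σ y : Σ i, Fin (k i), Fin (m y.1)) → _)) fun x => x.2) ?_
  exact hf.reindex fun x : (Σ y : Σ i, Fin (k i), Fin (m y.1)) => ⟨x.1.1, x.2⟩

theorem DT.gbfStep (hk : PolyBdd N k) (hm : PolyBdd N m) (hp : PolyBdd N fun i => (p i).size)
    (hT : DT N p T) (hpos : DT N p pos) (hv : DT N p v) (hw : DT N p w) :
    DT N p fun i a => gbfStep (T i a) (pos i a) (v i a) (w i a) := by
  classical
  have hS : DT N p fun i a => ∑ j, _root_.gbfBase (T i a) (pos i a) (w i a) (pos i a j) :=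
    DT.sum_comp hk hm hpos (DT.gbfBase (hk.reindex Sigma.fst) (hm.reindex Sigma.fst)
      (hT.reindex Sigma.fst) (hpos.reindex Sigma.fst) (hw.reindex Sigma.fst)
      fun x : Σ i, Fin (m i) => x.2)
  have hM : DT N p fun i a => gbfMult (T i a) (pos i a) :=
    DT.sum_comp hk hm hpos (f := fun i a q => if _root_.gbfPivot (T i a) (pos i a) q then 1 else 0)
      (DT.gbfPivot (hk.reindex Sigma.fst) (hm.reindex Sigma.fst)
      (hT.reindex Sigma.fst) (hpos.reindex Sigma.fst) fun x : Σ i, Fin (m i) => x.2)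
  have hX := (hv.sub hS).mul (hM.pow (e := fun i => p i - 2)
    (hp.mono fun i => Nat.size_le_size (Nat.sub_le _ _)))
  refine DT.pi hm ?_
  have hN := DT.gbfNew (hk.reindex Sigma.fst) (hT.reindex Sigma.fst) (hpos.reindex Sigma.fst)
    (fun x : Σ i, Fin (m i) => x.2)
  have hP := DT.gbfPivot (hk.reindex Sigma.fst) (hm.reindex Sigma.fst) (hT.reindex Sigma.fst)
    (hpos.reindex Sigma.fst) (fun x : Σ i, Fin (m i) => x.2)
  have hX' := hX.reindex (Sigma.fst : (Σ i, Fin (m i)) → I)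
  have hw' := hw.component
  have hT' := hT.component
  have hb : DT (fun x : Σ i, Fin (m i) => N x.1) (fun x => p x.1) fun x (a : α x.1) =>
      decide (_root_.gbfNew (T x.1 a) (pos x.1 a) x.2) :=
    DT.of_bool (by simpa only [_root_.bitF, decide_eq_true_eq] using hN)
  have hc : DT (fun x : Σ i, Fin (m i) => N x.1) (fun x => p x.1) fun x (a : α x.1) =>
      decide (_root_.gbfPivot (T x.1 a) (pos x.1 a) x.2) :=
    DT.of_bool (by simpa only [_root_.bitF, decide_eq_true_eq] using hP)
  have := DT.ite fewWires_zmod.option hb (DT.some (DT.ite fewWires_zmod hc hX' hw')) hT'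
  simp only [decide_eq_true_eq] at this
  convert this using 3 with x a
  rw [_root_.gbfStep]

theorem PT.gbfSample (hk : PolyBdd N k) (hm : PolyBdd N m) (hn : PolyBdd N n)
    (hp : PolyBdd N fun i => (p i).size) {pos : ∀ i, α i → Fin (n i) → Fin (k i) → Fin (m i)}
    {v : ∀ i, α i → Fin (n i) → ZMod (p i)} (hpos : DT N p pos) (hv : DT N p v)
    (hT : DT N p T) : PT N p fun i a => gbfSample (pos i a) (v i a) (T i a) := by
  refine PT.comp (f := fun i (x : α i × GBFTable (p i) (m i)) =>
    _root_.gbfSample (pos i x.1) (v i x.1) x.2) ?_ (DT.id.prodMk hT)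
  refine PT.iterP hn (f := fun i j a T =>
    (unif (Fin (m i) → ZMod (p i))).map (_root_.gbfStep T (pos i a j) (v i a j))) ?_
  refine PT.bind (PT.unif_pi (hm.reindex Sigma.fst) PT.rand) ?_
  refine DT.gbfStep (hk.reindex Sigma.fst) (hm.reindex Sigma.fst) (hp.reindex Sigma.fst)
    DT.id.fst.snd ?_ ?_ DT.id.snd
  · exact hpos.component.comp DT.id.fst.fst
  · exact hv.component.comp DT.id.fst.fst

theorem PT.gbfFinish (hm : PolyBdd N m) (hT : DT N p T) :
    PT N p fun i a => gbfFinish (T i a) := by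
  classical
  refine PT.bind (PT.unif_pi hm PT.rand) (DT.pi hm ?_)
  have h1 := hT.component.comp
    (DT.id (α := fun x : Σ i, Fin (m i) => α x.1 × (Fin (m x.1) → ZMod (p x.1)))).fst
  have h2 := (DT.id (N := fun x => N x.1) (p := fun x => p x.1)
    (α := fun x : Σ i, Fin (m i) => α x.1 × (Fin (m x.1) → ZMod (p x.1)))).snd.eval fun x => x.2
  convert h1.getD.add (h1.boole_eq_none.mul h2) using 3 with x a
  cases T x.1 a.1 x.2 <;> simp

end

/- ## Residues -/

theorem modIdx_eq_iff {k : ℕ} {a b : ℤ} : modIdx k a = modIdx k b ↔ ((k : ℤ) + 1) ∣ a - b := by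
  have h1 := Int.emod_nonneg a (show (k : ℤ) + 1 ≠ 0 by omega)
  have h2 := Int.emod_nonneg b (show (k : ℤ) + 1 ≠ 0 by omega)
  rw [Int.dvd_iff_emod_eq_zero, ← Int.emod_eq_emod_iff_emod_sub_eq_zero, modIdx, modIdx,
    Fin.mk.injEq]
  omega

/-- Here `v` is the client's mask and c - v the server's decrypted value. The two positions differ
by k - c modulo k+1, and 0 ≤ k - c ≤ k leaves c = k as the only coincidence. -/
theorem modIdx_membership {k c : ℕ} (hc : c ≤ k) (v : ℤ) :
    modIdx k v = modIdx k ((k : ℤ) - ((c : ℤ) - v)) ↔ c = k := by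
  rw [modIdx_eq_iff, show v - ((k : ℤ) - (c - v)) = -((k - c : ℕ) : ℤ) by push_cast [hc]; ring,
    dvd_neg]
  constructor
  · intro h
    have h' : k + 1 ∣ k - c := by exact_mod_cast h
    have := Nat.eq_zero_of_dvd_of_lt h' (by omega)
    omega
  · rintro rfl
    simp

theorem expect_unif_ite_le {p : ℕ} [Fact p.Prime] (s : ZMod p → Prop) [DecidablePred s]
    {n : ℕ} (f : Fin n → ZMod p) (h : ∀ x, ¬s x → ∃ i, f i = x) :
    (expect (unif (ZMod p)) fun x => if s x then 0 else 1) ≤ n * (p : ℝ≥0∞)⁻¹ := by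
  classical
  rw [expect, tsum_fintype]
  simp only [unif, PMF.uniformOfFintype_apply, ZMod.card, mul_ite, mul_zero, mul_one]
  rw [Finset.sum_ite, Finset.sum_const_zero, zero_add, Finset.sum_const, nsmul_eq_mul]
  gcongr
  calc (Finset.univ.filter fun x => ¬s x).card ≤ (Finset.univ.image f).card := by
        refine Finset.card_le_card fun x hx => ?_
        obtain ⟨i, hi⟩ := h x (Finset.mem_filter.1 hx).2
        exact Finset.mem_image.2 ⟨i, Finset.mem_univ _, hi⟩
    _ ≤ n := Finset.card_image_le.trans (by simp)

/-- For p = 2e + 1 the representatives fill the symmetric interval from -e to e. Since c ≥ 0, the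
number c minus the representative of `x` can leave it only at the top, that is, when the
representative plus e is one of 0, …, c - 1; these are the c excluded values. For p = 2 the interval
is not symmetric and negation alone may leave it. -/
theorem valMinAbs_sub_eq {p c : ℕ} [Fact p.Prime] (hp : p ≠ 2) {x : ZMod p}
    (h : ∀ i : Fin c, ((i : ℕ) : ZMod p) - ((p / 2 : ℕ) : ZMod p) ≠ x) :
    ((c : ZMod p) - x).valMinAbs = (c : ℤ) - x.valMinAbs := by
  have hpp := (Fact.out : p.Prime)
  have hodd := hpp.odd_of_ne_two hp
  have : NeZero p := ⟨hpp.ne_zero⟩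
  obtain ⟨e, he⟩ := hodd
  have h1 := (ZMod.valMinAbs_mem_Ioc x)
  rw [Set.mem_Ioc] at h1
  rw [ZMod.valMinAbs_spec]
  refine ⟨by push_cast [ZMod.coe_valMinAbs]; rfl, ?_⟩
  rw [Set.mem_Ioc]
  refine ⟨by omega, ?_⟩
  by_contra hcon
  push Not at hcon
  have hlt : (x.valMinAbs + e).toNat < c := by omega
  refine h ⟨(x.valMinAbs + e).toNat, hlt⟩ ?_
  have h2 : (((x.valMinAbs + e).toNat : ℕ) : ℤ) = x.valMinAbs + e := Int.toNat_of_nonneg (by omega)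
  have h3 : (((x.valMinAbs + e).toNat : ℕ) : ZMod p) = x + (e : ZMod p) := by
    have := congrArg (Int.cast : ℤ → ZMod p) h2
    push_cast [ZMod.coe_valMinAbs] at this
    exact this
  rw [h3, show p / 2 = e by omega]
  ring

/-- Reduction modulo `p` rarely interferes with subtraction of small numbers. -/
theorem expect_wrap_le {p c k : ℕ} [Fact p.Prime] (hp : p ≠ 2) (hc : c ≤ k) :
    (expect (unif (ZMod p)) fun x =>
      if ((c : ZMod p) - x).valMinAbs = (c : ℤ) - x.valMinAbs then 0 else 1) ≤
      k * (p : ℝ≥0∞)⁻¹ := by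
  refine (expect_unif_ite_le _ (fun i : Fin c => ((i : ℕ) : ZMod p) - ((p / 2 : ℕ) : ZMod p))
    fun x hx => ?_).trans (by gcongr)
  by_contra h
  push Not at h
  exact hx (valMinAbs_sub_eq hp h)

/- ## The online phase with ideal subroutines -/

section

variable {α β : Type}

theorem SD.bind_add {P : PMF α} {ε : α → ℝ≥0∞} {δ : ℝ≥0∞} {f g : α → PMF β}
    (h : ∀ a ∈ P.support, SD (ε a + δ) (f a) (g a)) :
    SD (expect P ε + δ) (P.bind f) (P.bind g) := by
  have := SD.bind_right h
  rwa [expect_add, expect_const] at this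

theorem SD.bind_add_add {P : PMF α} {ε ε' : α → ℝ≥0∞} {δ : ℝ≥0∞} {f g : α → PMF β}
    (h : ∀ a ∈ P.support, SD (ε a + (ε' a + δ)) (f a) (g a)) :
    SD (expect P ε + (expect P ε' + δ)) (P.bind f) (P.bind g) := by
  have := SD.bind_right h
  rwa [expect_add, expect_add, expect_const] at this

/-- If `c` fails, the full distance 1 is paid. Combined with `SD.bind_add`, this charge averages to
the probability of failure. -/
theorem SD.of_ite {c : Prop} [Decidable c] {δ : ℝ≥0∞} {X Y : PMF β} (h : c → SD δ X Y) :
    SD ((if c then 0 else 1) + δ) X Y := by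
  by_cases hc : c
  · simpa [hc] using h hc
  · exact (SD.one X Y).mono (by simp [hc])

end

section

variable {p l k m : ℕ}

abbrev Scalars (p : ℕ) : Type := ZMod p × Bool × ZMod p × ZMod p × ZMod p

/-- In the order of use: `ωsum`, `ωμ`, `ων` for the first ciphertext, then `ωsum'`, `ωs`, `ωmul`,
`ωδ`, `ων'` for the second. -/
abbrev QueryTapes (B : Blocks p l k m) : Type :=
  Bits (B.he.sumLen k) × Bits B.he.encLen × Bits (B.he.sumLen 2) × Bits (B.he.sumLen k) ×
    Bits B.he.encLen × Bits (B.he.mulLen 2) × Bits B.he.encLen × Bits (B.he.sumLen 2)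

namespace Scalars

def μ (σ : Scalars p) : ZMod p := σ.1
def b (σ : Scalars p) : Bool := σ.2.1
def δ (σ : Scalars p) : ZMod p := σ.2.2.1
def Δ (σ : Scalars p) : ZMod p := σ.2.2.2.1
def α (σ : Scalars p) : ZMod p := σ.2.2.2.2

end Scalars

/-- The sender's bits in the first oblivious transfer. -/
def senderBits (k : ℕ) (b : Bool) (x : ZMod p) (i : Fin (k + 1)) : Bool :=
  if i = modIdx k ((k : ℤ) - x.valMinAbs) then !b else b

/-- The client's values in the second oblivious transfer. -/
def clientValues (b₀ : Bool) (δ Δ : ZMod p) : Fin 2 → ZMod p :=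
  ![Δ + bitF p b₀ * δ, Δ + (1 - bitF p b₀) * δ]

/-- The server's values in the third oblivious transfer. -/
def serverValues (b₁ : Bool) (r ρ α : ZMod p) : Fin 2 → ZMod p :=
  ![r + bitF p b₁ * (ρ - α) - (1 - bitF p b₁) * α,
    r + (1 - bitF p b₁) * (ρ - α) - bitF p b₁ * α]

/-- The xor of the two parties' bits is `pass`, so what the server obtains contains δ exactly when
the membership test succeeds, and is masked by Δ in any case. -/
theorem clientValues_choice (b₁ pass : Bool) (δ Δ : ZMod p) :
    clientValues (xor b₁ pass) δ Δ (choice b₁) = Δ + bitF p pass * δ := by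
  cases b₁ <;> cases pass <;> simp [clientValues, choice, bitF]

/-- With r = Δ + pass·δ and ρ = s·G - δ, the mask δ cancels and the client obtains Δ + pass·s·G - α.
-/
theorem serverValues_choice (b₁ pass : Bool) (r ρ α : ZMod p) :
    serverValues b₁ r ρ α (choice (xor b₁ pass)) = r + bitF p pass * ρ - α := by
  cases b₁ <;> cases pass <;> simp [serverValues, choice, bitF] <;> ring

variable (B : Blocks p l k m)

def ctν (pk : B.he.PK) (cts : Fin k → B.he.CT) (μ : ZMod p) (ωsum : Bits (B.he.sumLen k))
    (ωμ : Bits B.he.encLen) (ων : Bits (B.he.sumLen 2)) : B.he.CT :=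
  B.he.evalSum pk 2 ![B.he.evalSum pk k cts ωsum, B.he.enc pk (-μ) ωμ] ων

def ctν' (pk : B.he.PK) (cts : Fin k → B.he.CT) (s δ : ZMod p) (ωsum' : Bits (B.he.sumLen k))
    (ωs : Bits B.he.encLen) (ωmul : Bits (B.he.mulLen 2)) (ωδ : Bits B.he.encLen)
    (ων' : Bits (B.he.sumLen 2)) : B.he.CT :=
  B.he.evalSum pk 2
    ![B.he.evalMul pk 2 ![B.he.enc pk s ωs, B.he.evalSum pk k cts ωsum'] ωmul,
      B.he.enc pk (-δ) ωδ] ων'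

/-- The components b and α of `σ` belong to the server and are not read. The client's simulator may
therefore put arbitrary values in their places. -/
def clientQueryView (σ : Scalars p) (τ : QueryTapes B) (v₁ : B.otB.View₁) (v₂ : B.otF.View₀)
    (v₃ : B.otF.View₁) : ClientQueryView B :=
  { μ := σ.μ, δ := σ.δ, Δ := σ.Δ, ωsum := τ.1, ωμ := τ.2.1, ων := τ.2.2.1, ωsum' := τ.2.2.2.1,
    ωs := τ.2.2.2.2.1, ωmul := τ.2.2.2.2.2.1, ωδ := τ.2.2.2.2.2.2.1, ων' := τ.2.2.2.2.2.2.2,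
    ot₁ := v₁, ot₂ := v₂, ot₃ := v₃ }

variable [Fact p.Prime]

def scalars (p : ℕ) [Fact p.Prime] : PMF (Scalars p) :=
  (unif (ZMod p)).bind fun μ => (unif Bool).bind fun b => (unif (ZMod p)).bind fun δ =>
    (unif (ZMod p)).bind fun Δ => (unif (ZMod p)).bind fun α => PMF.pure (μ, b, δ, Δ, α)

def queryTapes : PMF (QueryTapes B) :=
  (unif (Bits (B.he.sumLen k))).bind fun ωsum => (unif (Bits B.he.encLen)).bind fun ωμ =>
    (unif (Bits (B.he.sumLen 2))).bind fun ων => (unif (Bits (B.he.sumLen k))).bind fun ωsum' =>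
      (unif (Bits B.he.encLen)).bind fun ωs => (unif (Bits (B.he.mulLen 2))).bind fun ωmul =>
        (unif (Bits B.he.encLen)).bind fun ωδ => (unif (Bits (B.he.sumLen 2))).bind fun ων' =>
          PMF.pure (ωsum, ωμ, ων, ωsum', ωs, ωmul, ωδ, ων')

/-- The online phase in which the results of decryption (`d₁`, `d₂`) and of the oblivious
transfers (`f₁`, `f₂`, `f₃`) may be replaced, and the server's inputs to the oblivious transfers
may be modified (`g₁`, `g₃`). -/
def onlineWith (pk : B.he.PK) (cB cG : Fin k → B.he.CT) (s : ZMod p)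
    (d₁ d₂ : ZMod p → B.he.CT → ZMod p) (f₁ : Bool → Bool → Bool)
    (f₂ f₃ : ZMod p → ZMod p → ZMod p → ZMod p)
    (g₁ : Bool → ZMod p → (Fin (k + 1) → Bool) → Fin (k + 1) → Bool)
    (g₃ : Bool → ZMod p → ZMod p → (Fin 2 → ZMod p) → Fin 2 → ZMod p) :
    PMF (ClientQueryView B × ServerQueryView B × ZMod p × ZMod p) :=
  (unif (ZMod p)).bind fun μ =>
  (unif (Bits (B.he.sumLen k))).bind fun ωsum =>
  (unif (Bits B.he.encLen)).bind fun ωμ =>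
  (unif (Bits (B.he.sumLen 2))).bind fun ων =>
  (unif Bool).bind fun b₁ =>
  (B.otB.exec (g₁ b₁ μ (senderBits k b₁ (d₁ μ (ctν B pk cB μ ωsum ωμ ων))))
    (modIdx k μ.valMinAbs)).bind fun ot₁ =>
  (unif (ZMod p)).bind fun δ =>
  (unif (Bits (B.he.sumLen k))).bind fun ωsum' =>
  (unif (Bits B.he.encLen)).bind fun ωs =>
  (unif (Bits (B.he.mulLen 2))).bind fun ωmul =>
  (unif (Bits B.he.encLen)).bind fun ωδ =>
  (unif (Bits (B.he.sumLen 2))).bind fun ων' =>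
  (unif (ZMod p)).bind fun Δ =>
  (B.otF.exec (clientValues (f₁ b₁ ot₁.2.2.2) δ Δ) (choice b₁)).bind fun ot₂ =>
  (unif (ZMod p)).bind fun α =>
  (B.otF.exec (g₃ b₁ Δ α (serverValues b₁ (f₂ δ Δ ot₂.2.2.2)
      (d₂ δ (ctν' B pk cG s δ ωsum' ωs ωmul ωδ ων')) α)) (choice (f₁ b₁ ot₁.2.2.2))).bind fun ot₃ =>
  PMF.pure (clientQueryView B (μ, b₁, δ, Δ, α) (ωsum, ωμ, ων, ωsum', ωs, ωmul, ωδ, ων')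
      ot₁.2.1 ot₂.1 ot₃.2.1,
    { b := b₁, α := α, ν := ctν B pk cB μ ωsum ωμ ων,
      ν' := ctν' B pk cG s δ ωsum' ωs ωmul ωδ ων',
      ot₁ := ot₁.1, ot₂ := ot₂.2.1, ot₃ := ot₃.1 },
    f₃ Δ α ot₃.2.2.2 - Δ, α)

/-- The online phase when decryption and the oblivious transfers give the intended results. If
`adj` is set, then the server's inputs to the oblivious transfers agree with these results. -/
def onlineIdeal (adj : Bool) (pk : B.he.PK) (cB cG : Fin k → B.he.CT) (s C G u : ZMod p) (pass : Bool) :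
    PMF (ClientQueryView B × ServerQueryView B × ZMod p × ZMod p) :=
  onlineWith B pk cB cG s (fun μ _ => C - μ) (fun δ _ => s * G - δ) (fun b₁ _ => xor b₁ pass)
    (fun δ Δ _ => Δ + bitF p pass * δ) (fun Δ α _ => u - α + Δ)
    (fun b₁ μ a => if adj then Function.update a (modIdx k μ.valMinAbs) (xor b₁ pass) else a)
    fun b₁ Δ α a => if adj then Function.update a (choice (xor b₁ pass)) (u - α + Δ) else a

/-- The probability that decryption of the first ciphertext of a query fails. -/
def decErr₁ (pk : B.he.PK) (sk : B.he.SK) (cB : Fin k → B.he.CT) (C : ZMod p) : ℝ≥0∞ :=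
  expect (unif (ZMod p)) fun μ =>
  expect (unif (Bits (B.he.sumLen k))) fun ωsum =>
  expect (unif (Bits B.he.encLen)) fun ωμ =>
  expect (unif (Bits (B.he.sumLen 2))) fun ων =>
    if B.he.dec sk (ctν B pk cB μ ωsum ωμ ων) = C - μ then 0 else 1

/-- The probability that decryption of the second ciphertext of a query fails. -/
def decErr₂ (pk : B.he.PK) (sk : B.he.SK) (cG : Fin k → B.he.CT) (s G : ZMod p) : ℝ≥0∞ :=
  expect (unif (ZMod p)) fun δ =>
  expect (unif (Bits (B.he.sumLen k))) fun ωsum' =>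
  expect (unif (Bits B.he.encLen)) fun ωs =>
  expect (unif (Bits (B.he.mulLen 2))) fun ωmul =>
  expect (unif (Bits B.he.encLen)) fun ωδ =>
  expect (unif (Bits (B.he.sumLen 2))) fun ων' =>
    if B.he.dec sk (ctν' B pk cG s δ ωsum' ωs ωmul ωδ ων') = s * G - δ then 0 else 1

/-- The probability that an oblivious transfer yields a wrong result is at most `ε`. -/
def OTCorrect {N : ℕ} {M : Type} [DecidableEq M] (π : OTProtocol N M) (ε : ℝ≥0∞) : Prop :=
  ∀ a c, (expect (π.exec a c) fun e => if e.2.2.2 = a c then 0 else 1) ≤ ε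

theorem OTCorrect.bind {N : ℕ} {M β : Type} [DecidableEq M] {π : OTProtocol N M} {ε δ : ℝ≥0∞}
    (h : OTCorrect π ε) (a : Fin N → M) (c : Fin N)
    {f g : π.View₀ × π.View₁ × Unit × M → PMF β} (hfg : ∀ e, e.2.2.2 = a c → SD δ (f e) (g e)) :
    SD (ε + δ) ((π.exec a c).bind f) ((π.exec a c).bind g) := by
  refine (SD.bind_add fun e _ => SD.of_ite (hfg e)).mono ?_
  gcongr
  exact h a c

/-- The summands are, in order: wrong decryption of ν, wrap-around modulo p, a wrong first OT, wrong
decryption of ν', and wrong second and third OTs. Outside these events the two experiments coincide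
draw by draw. -/
theorem sd_onlineIdeal {adj : Bool} {pk : B.he.PK} {sk : B.he.SK} {cB cG : Fin k → B.he.CT}
    {s C G u : ZMod p} {pass : Bool} {c : ℕ} {ε₁ ε₂ : ℝ≥0∞} (hp : p ≠ 2)
    (hC : C = c) (hc : c ≤ k) (hpass : pass = decide (c = k)) (hu : u = bitF p pass * (s * G))
    (h₁ : OTCorrect B.otB ε₁) (h₂ : OTCorrect B.otF ε₂) :
    SD (decErr₁ B pk sk cB C + (k * (p : ℝ≥0∞)⁻¹ +
        (ε₁ + (decErr₂ B pk sk cG s G + (ε₂ + ε₂)))))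
      (onlineWith B pk cB cG s (fun _ => B.he.dec sk) (fun _ => B.he.dec sk) (fun _ o => o)
        (fun _ _ o => o) (fun _ _ o => o) (fun _ _ a => a) fun _ _ _ a => a)
      (onlineIdeal B adj pk cB cG s C G u pass) := by
  subst hC
  -- The wrap-around bound is turned back into an expectation over the mask, so that it and the
  -- first decryption error are charged under the same draw of `μ`.
  refine SD.mono (ε := _ + ((expect (unif (ZMod p)) fun x => if ((c : ZMod p) - x).valMinAbs =
    (c : ℤ) - x.valMinAbs then 0 else 1) + _)) ?_
      (add_le_add_right (add_le_add_left (expect_wrap_le hp hc) _) _)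
  refine SD.bind_add_add fun μ _ => ?_
  refine SD.bind_add fun ωsum _ => SD.bind_add fun ωμ _ => SD.bind_add fun ων _ => ?_
  refine SD.of_ite fun hdec => SD.of_ite fun hwrap => ?_
  beta_reduce
  rw [hdec]
  refine SD.bind_right_const fun b₁ _ => ?_
  have hout : senderBits k b₁ ((c : ZMod p) - μ) (modIdx k μ.valMinAbs) = xor b₁ pass := by
    rw [senderBits, hwrap, hpass]
    simp only [modIdx_membership hc]
    by_cases h : c = k <;> cases b₁ <;> simp [h]
  -- On this branch the selected entry already equals the intended bit, so overwriting it changes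
  -- nothing.
  have hadj : (if adj then Function.update (senderBits k b₁ ((c : ZMod p) - μ))
      (modIdx k μ.valMinAbs) (xor b₁ pass) else senderBits k b₁ ((c : ZMod p) - μ)) =
      senderBits k b₁ ((c : ZMod p) - μ) := by
    rw [← hout, Function.update_eq_self, ite_self]
  rw [hadj]
  refine h₁.bind _ _ fun ot₁ ho₁ => ?_
  rw [hout] at ho₁
  simp only [ho₁]
  refine SD.bind_add fun δ _ => SD.bind_add fun ωsum' _ => SD.bind_add fun ωs _ =>
    SD.bind_add fun ωmul _ => SD.bind_add fun ωδ _ => SD.bind_add fun ων' _ =>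
    SD.of_ite fun hdec' => ?_
  rw [hdec']
  refine SD.bind_right_const fun Δ _ => h₂.bind _ _ fun ot₂ ho₂ => ?_
  rw [clientValues_choice] at ho₂
  simp only [ho₂]
  refine SD.bind_right_const fun α _ => ?_
  rw [← add_zero ε₂]
  have hout₃ : serverValues b₁ (Δ + bitF p pass * δ) (s * G - δ) α (choice (xor b₁ pass)) =
      u - α + Δ := by
    rw [serverValues_choice, hu]
    ring
  have hadj₃ : (if adj then Function.update
      (serverValues b₁ (Δ + bitF p pass * δ) (s * G - δ) α) (choice (xor b₁ pass)) (u - α + Δ)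
      else serverValues b₁ (Δ + bitF p pass * δ) (s * G - δ) α) =
      serverValues b₁ (Δ + bitF p pass * δ) (s * G - δ) α := by
    rw [← hout₃, Function.update_eq_self, ite_self]
  rw [hadj₃]
  refine h₂.bind _ _ fun ot₃ ho₃ => SD.of_eq ?_
  rw [hout₃] at ho₃
  simp only [ho₃]

/-- The ideal online phase with the random choices in a convenient order. -/
theorem onlineIdeal_eq (adj : Bool) (pk : B.he.PK) (cB cG : Fin k → B.he.CT) (s C G u : ZMod p)
    (pass : Bool) :
    onlineIdeal B adj pk cB cG s C G u pass =
      (scalars p).bind fun σ => (queryTapes B).bind fun τ =>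
      (B.otB.exec (if adj then Function.update (senderBits k σ.b (C - σ.μ))
        (modIdx k σ.μ.valMinAbs) (xor σ.b pass) else senderBits k σ.b (C - σ.μ))
        (modIdx k σ.μ.valMinAbs)).bind fun ot₁ =>
      (B.otF.exec (clientValues (xor σ.b pass) σ.δ σ.Δ) (choice σ.b)).bind fun ot₂ =>
      (B.otF.exec (if adj then Function.update (serverValues σ.b (σ.Δ + bitF p pass * σ.δ)
        (s * G - σ.δ) σ.α) (choice (xor σ.b pass)) (u - σ.α + σ.Δ) else
        serverValues σ.b (σ.Δ + bitF p pass * σ.δ) (s * G - σ.δ) σ.α)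
        (choice (xor σ.b pass))).bind fun ot₃ =>
      PMF.pure (clientQueryView B σ τ ot₁.2.1 ot₂.1 ot₃.2.1,
        { b := σ.b, α := σ.α, ν := ctν B pk cB σ.μ τ.1 τ.2.1 τ.2.2.1,
          ν' := ctν' B pk cG s σ.δ τ.2.2.2.1 τ.2.2.2.2.1 τ.2.2.2.2.2.1 τ.2.2.2.2.2.2.1
            τ.2.2.2.2.2.2.2,
          ot₁ := ot₁.1, ot₂ := ot₂.2.1, ot₃ := ot₃.1 },
        u - σ.α, σ.α) := by
  -- Commutation of independent draws, oriented so that rewriting terminates: field elements and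
  -- bits move in front of tapes, and all uniform draws in front of the oblivious transfers.
  have r1 : ∀ {β : Type} (n : ℕ) (f : Bits n → ZMod p → PMF β),
      ((unif (Bits n)).bind fun ω => (unif (ZMod p)).bind (f ω)) =
        (unif (ZMod p)).bind fun x => (unif (Bits n)).bind fun ω => f ω x :=
    fun n f => PMF.bind_comm _ _ f
  have r2 : ∀ {β : Type} (n : ℕ) (f : Bits n → Bool → PMF β),
      ((unif (Bits n)).bind fun ω => (unif Bool).bind (f ω)) =
        (unif Bool).bind fun x => (unif (Bits n)).bind fun ω => f ω x :=
    fun n f => PMF.bind_comm _ _ f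
  have r3 : ∀ {β γ : Type} [Fintype γ] [Nonempty γ] (a : Fin (k + 1) → Bool) (c : Fin (k + 1))
      (f : B.otB.View₀ × B.otB.View₁ × Unit × Bool → γ → PMF β),
      ((B.otB.exec a c).bind fun ω => (unif γ).bind (f ω)) =
        (unif γ).bind fun x => (B.otB.exec a c).bind fun ω => f ω x :=
    fun a c f => PMF.bind_comm _ _ f
  have r4 : ∀ {β γ : Type} [Fintype γ] [Nonempty γ] (a : Fin 2 → ZMod p) (c : Fin 2)
      (f : B.otF.View₀ × B.otF.View₁ × Unit × ZMod p → γ → PMF β),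
      ((B.otF.exec a c).bind fun ω => (unif γ).bind (f ω)) =
        (unif γ).bind fun x => (B.otF.exec a c).bind fun ω => f ω x :=
    fun a c f => PMF.bind_comm _ _ f
  unfold onlineIdeal onlineWith
  simp only [r1, r2, r3, r4]
  simp only [scalars, queryTapes, PMF.bind_bind, PMF.pure_bind, Scalars.μ, Scalars.b, Scalars.δ,
    Scalars.Δ, Scalars.α, add_sub_cancel_right]

end

/- ## The execution with ideal subroutines -/

section

variable {p l k m t n : ℕ} [Fact p.Prime] (B : Blocks p l k m) (XS : Fin t → Bits l × ZMod p)
  (YG : Fin n → Bits l × ZMod p)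

open Classical in
/-- The entries of the Bloom filter, as plaintexts. -/
def bfEntry (seed : Bits B.hf.seedLen) (q : Fin m) : ZMod p :=
  if BFSet (B.hf.hash seed) (Set.range fun i => (YG i).1) q then 1 else 0

/-- The position of the `a`-th hash value of query `j`. -/
def queryPos (seed : Bits B.hf.seedLen) (j : Fin t) (a : Fin k) : Fin m :=
  B.hf.hash seed a (XS j).1

def keyPos (seed : Bits B.hf.seedLen) (i : Fin n) (a : Fin k) : Fin m :=
  B.hf.hash seed a (YG i).1

/-- The number of hash functions that hit the Bloom filter, modulo `p`. -/
def bfSum (seed : Bits B.hf.seedLen) (j : Fin t) : ZMod p :=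
  ∑ a, bfEntry B YG seed (queryPos B XS seed j a)

def gbfSum (seed : Bits B.hf.seedLen) (gbf : Fin m → ZMod p) (j : Fin t) : ZMod p :=
  ∑ a, gbf (queryPos B XS seed j a)

open Classical in
def isMember (j : Fin t) : Bool := decide (∃ i, (XS j).1 = (YG i).1)

/-- Encryption of all entries of a table. -/
def encTable (pk : B.he.PK) (f : Fin m → ZMod p) (ω : Fin m → Bits B.he.encLen) (q : Fin m) :
    B.he.CT :=
  B.he.enc pk (f q) (ω q)

/-- The views and outputs, given the results of the queries. -/
def assemble (seed : Bits B.hf.seedLen) (gen : Bits B.he.genLen) (T : GBFTable p m)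
    (gbf : Fin m → ZMod p) (ωB ωG : Fin m → Bits B.he.encLen)
    (res : Fin t → ClientQueryView B × ServerQueryView B × ZMod p × ZMod p) :
    ClientView B t × ServerView B t × Option (Fin t → ZMod p) × Option (Fin t → ZMod p) :=
  ({ seed := seed, pk := (B.he.keyGen gen).1,
     rest := some (encTable B (B.he.keyGen gen).1 (bfEntry B YG seed) ωB,
       encTable B (B.he.keyGen gen).1 gbf ωG, fun j => (res j).1) },
   { seed := seed, gen := gen, table := T, rest := some (gbf, ωB, ωG, fun j => (res j).2.1) },
   some fun j => (res j).2.2.1, some fun j => (res j).2.2.2)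

theorem ssip₁_eq : ssip₁ B XS YG =
    (unif (Bits B.hf.seedLen)).bind fun seed => (unif (Bits B.he.genLen)).bind fun gen =>
    (gbfInsertAll (List.ofFn fun i => (keyPos B YG seed i, (YG i).2)) fun _ => none).bind fun T =>
    if T.2 then
      (gbfFinish T.1).bind fun gbf => (unif (Fin m → Bits B.he.encLen)).bind fun ωB =>
      (unif (Fin m → Bits B.he.encLen)).bind fun ωG =>
      (indep t fun j => ssipOnline B seed (B.he.keyGen gen).1 (B.he.keyGen gen).2
        (encTable B (B.he.keyGen gen).1 (bfEntry B YG seed) ωB)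
        (encTable B (B.he.keyGen gen).1 gbf ωG) (XS j).1 (XS j).2).bind fun res =>
      PMF.pure (assemble B YG seed gen T.1 gbf ωB ωG res)
    else PMF.pure ({ seed := seed, pk := (B.he.keyGen gen).1, rest := none },
      { seed := seed, gen := gen, table := T.1, rest := none }, none, none) :=
  rfl

/-- The execution in which the server never aborts, and decryption and the oblivious transfers
give the intended results. -/
def ssipIdeal (adj : Bool) : PMF (ClientView B t × ServerView B t ×
    Option (Fin t → ZMod p) × Option (Fin t → ZMod p)) :=
  (unif (Bits B.hf.seedLen)).bind fun seed =>
  (gbfSample (keyPos B YG seed) (fun i => (YG i).2) fun _ => none).bind fun T =>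
  (gbfFinish T).bind fun gbf => (unif (Bits B.he.genLen)).bind fun gen =>
  (unif (Fin m → Bits B.he.encLen)).bind fun ωB => (unif (Fin m → Bits B.he.encLen)).bind fun ωG =>
  (indep t fun j => onlineIdeal B adj (B.he.keyGen gen).1
    (fun a => encTable B (B.he.keyGen gen).1 (bfEntry B YG seed) ωB (queryPos B XS seed j a))
    (fun a => encTable B (B.he.keyGen gen).1 gbf ωG (queryPos B XS seed j a))
    (XS j).2 (bfSum B XS YG seed j) (gbfSum B XS seed gbf j) (ssipTarget XS YG j)
    (isMember XS YG j)).bind fun res =>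
  PMF.pure (assemble B YG seed gen T gbf ωB ωG res)

/-- The hash functions produce neither a false positive nor an insertion without an empty
position. -/
def GoodSeed (seed : Bits B.hf.seedLen) : Prop :=
  (∀ j, (∀ i, (XS j).1 ≠ (YG i).1) →
    ¬∀ a, BFSet (B.hf.hash seed) (Set.range fun i => (YG i).1) (B.hf.hash seed a (XS j).1)) ∧
  ∀ i, ¬∀ a, BFSet (B.hf.hash seed) {y | ∃ i' < i, (YG i').1 = y} (B.hf.hash seed a (YG i).1)

variable {B XS YG}

/-- If all positions of a key were hit by earlier keys, that key would be a false positive for the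
set of earlier keys. -/
theorem GoodSeed.insertable {seed : Bits B.hf.seedLen} (h : GoodSeed B XS YG seed) :
    GBFInsertable (p := p) (keyPos B YG seed) fun _ => none := by
  intro i
  have := h.2 i
  push Not at this
  obtain ⟨a, ha⟩ := this
  exact ⟨a, rfl, fun i' hi' j' h' => ha ⟨(YG i').1, ⟨i', hi', rfl⟩, j', h'⟩⟩

/-- The number `c` counts the query's hash functions that hit the Bloom filter. A member hits it
with all k, and a nonmember cannot, for lack of false positives. A member has the positions of its
matching key, where the garbled entries sum to the associated value; for a nonmember the factor 0
makes the sum irrelevant. -/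
theorem GoodSeed.query {seed : Bits B.hf.seedLen} (h : GoodSeed B XS YG seed) (hk : k < p)
    {T : GBFTable p m} {gbf : Fin m → ZMod p}
    (hT : T ∈ (gbfSample (keyPos B YG seed) (fun i => (YG i).2) fun _ => none).support)
    (hgbf : gbf ∈ (gbfFinish T).support) (j : Fin t) :
    ∃ c : ℕ, bfSum B XS YG seed j = c ∧ c ≤ k ∧ isMember XS YG j = decide (c = k) ∧
      ssipTarget XS YG j =
        bitF p (isMember XS YG j) * ((XS j).2 * gbfSum B XS seed gbf j) := by
  classical
  let S := Finset.univ.filter fun a =>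
    BFSet (B.hf.hash seed) (Set.range fun i => (YG i).1) (queryPos B XS seed j a)
  have hS : S.card ≤ k := (Finset.card_le_univ S).trans (by simp)
  have hcard : S.card = k ↔ ∀ a,
      BFSet (B.hf.hash seed) (Set.range fun i => (YG i).1) (queryPos B XS seed j a) := by
    have : S.card = k ↔ S = Finset.univ := by
      rw [← Finset.card_eq_iff_eq_univ, Fintype.card_fin]
    rw [this, Finset.filter_eq_self]
    simp
  have hmem : (∃ i, (XS j).1 = (YG i).1) ↔ S.card = k := by
    rw [hcard]
    constructor
    · rintro ⟨i, hi⟩ a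
      exact ⟨_, ⟨i, rfl⟩, a, by rw [queryPos, hi]⟩
    · intro ha
      by_contra hcon
      push Not at hcon
      exact h.1 j hcon ha
  refine ⟨S.card, ?_, hS, ?_, ?_⟩
  · simp only [bfSum, bfEntry, Finset.sum_boole]
    rfl
  · rw [isMember]
    simp only [hmem]
  · by_cases hx : ∃ i, (XS j).1 = (YG i).1
    · have hspec := (gbfSample_spec hk h.insertable hT).2 hx.choose
      have hG : gbfSum B XS seed gbf j = (YG hx.choose).2 := by
        rw [← hspec.2, gbfSum]
        refine Finset.sum_congr rfl fun a _ => ?_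
        have : queryPos B XS seed j a = keyPos B YG seed hx.choose a := by
          exact congrArg (B.hf.hash seed a) hx.choose_spec
        rw [this]
        exact gbfFinish_spec hgbf (hspec.1 a)
      simp [ssipTarget, isMember, hx, bitF, hG]
    · simp [ssipTarget, isMember, hx, bitF]

variable (B XS YG)

/-- Bounds for the failure probability of decryption. -/
def DecCorrect (ε : ℝ≥0∞) : Prop :=
  ∀ (f : Fin m → ZMod p) (pos : Fin k → Fin m) (s : ZMod p),
    (expect (unif (Bits B.he.genLen)) fun gen => expect (unif (Fin m → Bits B.he.encLen)) fun ω =>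
      decErr₁ B (B.he.keyGen gen).1 (B.he.keyGen gen).2
        (fun a => encTable B (B.he.keyGen gen).1 f ω (pos a)) (∑ a, f (pos a))) ≤ ε ∧
    (expect (unif (Bits B.he.genLen)) fun gen => expect (unif (Fin m → Bits B.he.encLen)) fun ω =>
      decErr₂ B (B.he.keyGen gen).1 (B.he.keyGen gen).2
        (fun a => encTable B (B.he.keyGen gen).1 f ω (pos a)) s (∑ a, f (pos a))) ≤ ε

def BFReliableWith (n : ℕ) (ε : ℝ≥0∞) : Prop :=
  ∀ (Q : Finset (Bits l)) (x : Bits l), Q.card ≤ n → x ∉ Q →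
    (unif (Bits B.hf.seedLen)).toOuterMeasure
      {s | ∀ i, BFSet (B.hf.hash s) Q (B.hf.hash s i x)} ≤ ε

open Classical in
-- Union bound over t queries, tested against all keys, and n keys, each tested against those
-- inserted before it. Distinctness of the keys puts a key outside the set of its predecessors.
theorem expect_goodSeed_le (hY : Function.Injective fun i => (YG i).1) {ε : ℝ≥0∞}
    (h : BFReliableWith B n ε) :
    (expect (unif (Bits B.hf.seedLen)) fun seed => if GoodSeed B XS YG seed then 0 else 1) ≤
      t * ε + n * ε := by
  let A : Fin t → Set (Bits B.hf.seedLen) := fun j => {seed | (∀ i, (XS j).1 ≠ (YG i).1) ∧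
    ∀ a, BFSet (B.hf.hash seed) (Set.range fun i => (YG i).1) (B.hf.hash seed a (XS j).1)}
  let A' : Fin n → Set (Bits B.hf.seedLen) := fun i => {seed |
    ∀ a, BFSet (B.hf.hash seed) {y | ∃ i' < i, (YG i').1 = y} (B.hf.hash seed a (YG i).1)}
  have h1 : ∀ j, (unif (Bits B.hf.seedLen)).toOuterMeasure (A j) ≤ ε := by
    intro j
    by_cases hj : ∀ i, (XS j).1 ≠ (YG i).1
    · have hA : A j = {s | ∀ a, BFSet (B.hf.hash s)
          (Finset.univ.image fun i => (YG i).1 : Finset (Bits l)) (B.hf.hash s a (XS j).1)} := by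
        ext seed
        simp [A, hj]
      rw [hA]
      refine h _ _ (Finset.card_image_le.trans (by simp)) ?_
      simpa [eq_comm] using hj
    · have hA : A j = ∅ := by
        ext seed
        simp only [A, hj, false_and, Set.ofPred_false]
      rw [hA]
      simp
  have h2 : ∀ i, (unif (Bits B.hf.seedLen)).toOuterMeasure (A' i) ≤ ε := by
    intro i
    have hA : A' i = {s | ∀ a, BFSet (B.hf.hash s)
        ((Finset.univ.filter (· < i)).image fun i => (YG i).1 : Finset (Bits l))
        (B.hf.hash s a (YG i).1)} := by
      ext seed
      simp only [A', Finset.coe_image, Finset.coe_filter, Finset.mem_univ, true_and]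
      rfl
    rw [hA]
    refine h _ _ ((Finset.card_image_le.trans (Finset.card_filter_le _ _)).trans (by simp)) ?_
    simp only [Finset.mem_image, Finset.mem_filter, Finset.mem_univ, true_and, not_exists, not_and]
    exact fun i' hi' h' => hi'.ne (hY h')
  calc (expect (unif (Bits B.hf.seedLen)) fun seed => if GoodSeed B XS YG seed then 0 else 1)
      ≤ expect (unif (Bits B.hf.seedLen)) fun seed =>
        (∑ j, if seed ∈ A j then 1 else 0) + ∑ i, if seed ∈ A' i then 1 else 0 := by
        refine expect_mono fun seed _ => ?_
        by_cases hg : GoodSeed B XS YG seed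
        · simp [hg]
        · rw [if_neg hg]
          rw [GoodSeed, not_and_or] at hg
          push Not at hg
          rcases hg with ⟨j, hj⟩ | ⟨i, hi⟩
          · refine le_add_right ?_
            refine le_trans ?_ (Finset.single_le_sum (fun _ _ => bot_le) (Finset.mem_univ j))
            rw [if_pos (show seed ∈ A j from hj)]
          · refine le_add_left ?_
            refine le_trans ?_ (Finset.single_le_sum (fun _ _ => bot_le) (Finset.mem_univ i))
            rw [if_pos (show seed ∈ A' i from hi)]
    _ = (∑ j, (unif (Bits B.hf.seedLen)).toOuterMeasure (A j)) +
        ∑ i, (unif (Bits B.hf.seedLen)).toOuterMeasure (A' i) := by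
        rw [expect_add, expect_sum, expect_sum]
        exact congrArg₂ _ (Finset.sum_congr rfl fun j _ => expect_indicator _ _)
          (Finset.sum_congr rfl fun i _ => expect_indicator _ _)
    _ ≤ t * ε + n * ε := by
        gcongr
        · exact (Finset.sum_le_sum fun j _ => h1 j).trans (by simp)
        · exact (Finset.sum_le_sum fun j _ => h2 j).trans (by simp)

/-- A bad seed is charged once; for a good one the t queries contribute their individual errors. The
decryption errors are random, depending on keys and tapes, and only their averages are bounded. -/
theorem sd_ssipIdeal (adj : Bool) (hp : p ≠ 2) (hk : k < p) (hY : Function.Injective fun i => (YG i).1)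
    {ε ε₀ ε₁ ε₂ : ℝ≥0∞} (hBF : BFReliableWith B n ε) (hdec : DecCorrect B ε₀)
    (h₁ : OTCorrect B.otB ε₁) (h₂ : OTCorrect B.otF ε₂) :
    SD (t * ε + n * ε + t * (ε₀ + (k * (p : ℝ≥0∞)⁻¹ + (ε₁ + (ε₀ + (ε₂ + ε₂))))))
      (ssip₁ B XS YG) (ssipIdeal B XS YG adj) := by
  classical
  rw [ssip₁_eq, ssipIdeal]
  refine SD.mono ?_ (add_le_add_left (expect_goodSeed_le B XS YG hY hBF) _)
  refine SD.bind_add fun seed _ => SD.of_ite fun hgood => ?_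
  simp only [gbfInsertAll_eq_gbfSample hk _ hgood.insertable, PMF.bind_map, Function.comp_def,
    if_true]
  -- Key generation is moved behind the choice of the tables, since decryption is reliable only on
  -- average over the keys for plaintexts fixed in advance.
  rw [PMF.bind_comm]
  refine SD.bind_right_const fun T hT => ?_
  rw [PMF.bind_comm]
  refine SD.bind_right_const fun gbf hgbf => ?_
  let E : Bits B.he.genLen → (Fin m → Bits B.he.encLen) → (Fin m → Bits B.he.encLen) →
      Fin t → ℝ≥0∞ := fun gen ωB ωG j =>
    decErr₁ B (B.he.keyGen gen).1 (B.he.keyGen gen).2 (fun a => encTable B (B.he.keyGen gen).1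
      (bfEntry B YG seed) ωB (queryPos B XS seed j a)) (bfSum B XS YG seed j) +
    (k * (p : ℝ≥0∞)⁻¹ + (ε₁ + (decErr₂ B (B.he.keyGen gen).1 (B.he.keyGen gen).2 (fun a =>
      encTable B (B.he.keyGen gen).1 gbf ωG (queryPos B XS seed j a)) (XS j).2
      (gbfSum B XS seed gbf j) + (ε₂ + ε₂))))
  refine SD.mono (ε := expect (unif (Bits B.he.genLen)) fun gen =>
    expect (unif (Fin m → Bits B.he.encLen)) fun ωB =>
    expect (unif (Fin m → Bits B.he.encLen)) fun ωG => ∑ j, E gen ωB ωG j) ?_ ?_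
  · refine SD.bind_right fun gen _ => SD.bind_right fun ωB _ => SD.bind_right fun ωG _ => ?_
    refine SD.bind_left (SD.indep fun j => ?_) _
    obtain ⟨c, hc1, hc2, hc3, hc4⟩ := hgood.query hk hT hgbf j
    exact sd_onlineIdeal B hp hc1 hc2 hc3 hc4 h₁ h₂
  · simp only [expect_sum]
    refine (Finset.sum_le_sum (g := fun _ => ε₀ + (k * (p : ℝ≥0∞)⁻¹ + (ε₁ + (ε₀ + (ε₂ + ε₂)))))
      fun j _ => ?_).trans ?_
    · simp only [E, expect_add, expect_const]
      gcongr
      -- The first ciphertext involves no multiplier, so 0 is a dummy.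
      · exact (hdec _ (queryPos B XS seed j) 0).1
      · exact (hdec gbf (queryPos B XS seed j) (XS j).2).2
    · rw [Finset.sum_const, Finset.card_univ, Fintype.card_fin, nsmul_eq_mul]

end

/- ## Uniform error bounds from the security assumptions -/

theorem expect_eq_outer {α : Type} (P : PMF α) (c : α → Prop) [DecidablePred c] :
    (expect P fun a => if c a then 0 else 1) = P.toOuterMeasure {a | ¬c a} := by
  classical
  rw [← expect_indicator]
  congr 1
  funext a
  by_cases h : c a <;> simp [h]

theorem toOuterMeasure_le_of_prob_le {α : Type} {P : PMF α} {s : Set α} {ε : NNReal}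
    (h : prob P s ≤ ε) : P.toOuterMeasure s ≤ ε := by
  rw [toOuterMeasure_eq_ofReal]
  exact ENNReal.ofReal_le_of_le_toReal (by simpa using h)

section

variable {p : ℕ → ℕ} [∀ κ, Fact (p κ).Prime]

theorem dt_bool_ne : DT (I := Σ _ : ℕ, Bool) (fun x => x.1) (fun x => p x.1)
    fun x (y : Bool) => decide (y ≠ x.2) := by
  refine DT.of_bool ?_
  have h1 := DT.bitF (DT.id (N := fun x : Σ _ : ℕ, Bool => x.1) (p := fun x => p x.1)
    (α := fun _ => Bool))
  have h2 := DT.constF (α := fun _ => Bool) (N := fun x : Σ _ : ℕ, Bool => x.1)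
    (p := fun x => p x.1) fun x => bitF (p x.1) x.2
  -- Inequality of bits is exclusive or, as the polynomial y + c - 2yc.
  convert (h1.add h2).sub ((h1.mul h2).add (h1.mul h2)) using 3 with x y
  obtain ⟨κ, c⟩ := x
  cases y <;> cases c <;> simp [bitF]

/-- By Fermat, the power p - 1 of the difference is the indicator of inequality. It is cheap because
p has polynomially many digits. -/
theorem dt_zmod_ne (hp : PolyBounded fun κ => (p κ).size) :
    DT (I := Σ κ : ℕ, ZMod (p κ)) (fun x => x.1) (fun x => p x.1)
      fun x (y : ZMod (p x.1)) => decide (y ≠ x.2) := by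
  refine DT.of_bool ?_
  have h1 := DT.id (N := fun x : Σ κ : ℕ, ZMod (p κ) => x.1) (p := fun x => p x.1)
    (α := fun x => ZMod (p x.1))
  have h2 := DT.constF (α := fun x => ZMod (p x.1)) (N := fun x : Σ κ : ℕ, ZMod (p κ) => x.1)
    (p := fun x => p x.1) fun x => x.2
  convert (h1.sub h2).pow (e := fun x => p x.1 - 1)
    ((PolyBounded.polyBdd (N := fun x : Σ κ : ℕ, ZMod (p κ) => x.1) hp).mono fun x =>
      Nat.size_le_size (Nat.sub_le (p x.1) 1)) using 3 with x y
  have hpp := (Fact.out : (p x.1).Prime).two_le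
  by_cases h : y = x.2
  · rw [h, sub_self, zero_pow (by omega)]
    simp [bitF]
  · rw [ZMod.pow_card_sub_one_eq_one (sub_ne_zero.2 h)]
    simp [bitF, h]

variable {N : ℕ → ℕ} {M : ℕ → Type} [∀ κ, Data (p κ) (M κ)] {π : ∀ κ, OTProtocol (N κ) (M κ)}

/-- The efficient test for the failure event is itself a distinguisher, so its probability changes
by at most the distinguishing error. -/
theorem CI.expect_le {I : Type} {N q : I → ℕ} [∀ i, Fact (q i).Prime] {α : I → Type}
    [∀ i, Data (q i) (α i)] {X Y : ∀ i, PMF (α i)} (h : CI N q X Y) {c : ∀ i, α i → Prop}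
    [∀ i, DecidablePred (c i)] (hc : DT N q fun i a => decide (¬c i a)) :
    ∃ ε : ℕ → NNReal, Negligible (fun κ => (ε κ : ℝ)) ∧ ∀ i,
      (expect (Y i) fun a => if c i a then 0 else 1) ≤
        (expect (X i) fun a => if c i a then 0 else 1) + ε (N i) := by
  obtain ⟨P, hP⟩ := hc
  obtain ⟨ε, hε, hb⟩ := h P
  refine ⟨ε, hε, fun i => ?_⟩
  have h1 : ∀ Z : PMF (α i), (Z.bind fun a => PMF.pure (decide (¬c i a))) true =
      expect Z fun a => if c i a then 0 else 1 := fun Z => by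
    rw [bind_true]
    refine congrArg _ (funext fun a => ?_)
    by_cases ha : c i a <;> simp [ha]
  have h2 := (hb i _ (hP i)).2
  rwa [h1, h1] at h2

/-- The functionality is deterministic, so the simulation condition reduces to one draw of the view
beside the prescribed output. -/
theorem OTSecure.exists_sender_sim_seq (h : OTSecure p π) :
    ∃ Sim : ∀ κ, (Fin (N κ) → M κ) × Unit → PMF (π κ).View₀, PolyTime p Sim ∧
      ∀ z : ∀ κ, (Fin (N κ) → M κ) × Fin (N κ),
        Indist p (α := fun κ => (π κ).View₀ × Unit × M κ)
          (fun κ => (Sim κ ((z κ).1, ())).map fun v => (v, (), (z κ).1 (z κ).2))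
          fun κ => ((π κ).exec (z κ).1 (z κ).2).map fun e => (e.1, e.2.2.1, e.2.2.2) := by
  obtain ⟨Sim, hS, hSim⟩ := h.2.1
  refine ⟨Sim, hS, fun z => ?_⟩
  have e : ∀ κ, ((otFunctionality (z κ).1 (z κ).2).bind fun o =>
      (Sim κ ((z κ).1, o.1)).bind fun v => PMF.pure (v, o.1, o.2)) =
      ((Sim κ ((z κ).1, ())).map fun v => (v, (), (z κ).1 (z κ).2) :
        PMF ((π κ).View₀ × Unit × M κ)) := fun κ => by
    rw [otFunctionality, PMF.pure_bind]
    rfl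
  rw [← funext e]
  exact hSim _ _ fun _ => trivial

/-- Passes from single input sequences to an error uniform in the sender's inputs and the choice;
the instances ensure that such inputs exist at every level. -/
theorem CI.sender_of_indist [∀ κ, NeZero (N κ)] [∀ κ, Nonempty (M κ)]
    (Sim : ∀ κ, (Fin (N κ) → M κ) × Unit → PMF (π κ).View₀)
    (h : ∀ z : ∀ κ, (Fin (N κ) → M κ) × Fin (N κ),
      Indist p (α := fun κ => (π κ).View₀ × Unit × M κ)
        (fun κ => (Sim κ ((z κ).1, ())).map fun v => (v, (), (z κ).1 (z κ).2))
        fun κ => ((π κ).exec (z κ).1 (z κ).2).map fun e => (e.1, e.2.2.1, e.2.2.2)) :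
    CI (I := Σ κ, (Fin (N κ) → M κ) × Fin (N κ)) (fun x => x.1) (fun x => p x.1)
      (α := fun x => (π x.1).View₀ × Unit × M x.1)
      (fun x => (Sim x.1 (x.2.1, ())).map fun v => (v, (), x.2.1 x.2.2))
      fun x => ((π x.1).exec x.2.1 x.2.2).map fun e => (e.1, e.2.2.1, e.2.2.2) := by
  have hz : ∀ κ, Nonempty ((Fin (N κ) → M κ) × Fin (N κ)) := fun κ => inferInstance
  have key := @CI.of_indist p _ (fun κ => (π κ).View₀ × Unit × M κ) _
    (fun κ => (Fin (N κ) → M κ) × Fin (N κ)) hz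
    (fun κ z => (Sim κ (z.1, ())).map fun v => (v, (), z.1 z.2))
    (fun κ z => ((π κ).exec z.1 z.2).map fun e => (e.1, e.2.2.1, e.2.2.2))
  have key' := key h
  exact key'

theorem OTSecure.exists_sender_sim [∀ κ, NeZero (N κ)] [hM : ∀ κ, Nonempty (M κ)]
    (h : OTSecure p π) :
    ∃ Sim : ∀ κ, (Fin (N κ) → M κ) × Unit → PMF (π κ).View₀, PolyTime p Sim ∧
      CI (I := Σ κ, (Fin (N κ) → M κ) × Fin (N κ)) (fun x => x.1) (fun x => p x.1)
        (α := fun x => (π x.1).View₀ × Unit × M x.1)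
        (fun x => (Sim x.1 (x.2.1, ())).map fun v => (v, (), x.2.1 x.2.2))
        fun x => ((π x.1).exec x.2.1 x.2.2).map fun e => (e.1, e.2.2.1, e.2.2.2) :=
  let ⟨Sim, hS, hSim⟩ := h.exists_sender_sim_seq
  ⟨Sim, hS, CI.sender_of_indist Sim hSim⟩

theorem OTSecure.exists_receiver_sim_seq (h : OTSecure p π) :
    ∃ Sim : ∀ κ, Fin (N κ) × M κ → PMF (π κ).View₁, PolyTime p Sim ∧
      ∀ z : ∀ κ, (Fin (N κ) → M κ) × Fin (N κ),
        Indist p (α := fun κ => (π κ).View₁ × Unit × M κ)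
          (fun κ => (Sim κ ((z κ).2, (z κ).1 (z κ).2)).map fun v => (v, (), (z κ).1 (z κ).2))
          fun κ => ((π κ).exec (z κ).1 (z κ).2).map fun e => (e.2.1, e.2.2.1, e.2.2.2) := by
  obtain ⟨Sim, hS, hSim⟩ := h.2.2
  refine ⟨Sim, hS, fun z => ?_⟩
  have e : ∀ κ, ((otFunctionality (z κ).1 (z κ).2).bind fun o =>
      (Sim κ ((z κ).2, o.2)).bind fun v => PMF.pure (v, o.1, o.2)) =
      ((Sim κ ((z κ).2, (z κ).1 (z κ).2)).map fun v => (v, (), (z κ).1 (z κ).2) :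
        PMF ((π κ).View₁ × Unit × M κ)) := fun κ => by
    rw [otFunctionality, PMF.pure_bind]
    rfl
  rw [← funext e]
  exact hSim _ _ fun _ => trivial

theorem CI.receiver_of_indist [∀ κ, NeZero (N κ)] [∀ κ, Nonempty (M κ)]
    (Sim : ∀ κ, Fin (N κ) × M κ → PMF (π κ).View₁)
    (h : ∀ z : ∀ κ, (Fin (N κ) → M κ) × Fin (N κ),
      Indist p (α := fun κ => (π κ).View₁ × Unit × M κ)
        (fun κ => (Sim κ ((z κ).2, (z κ).1 (z κ).2)).map fun v => (v, (), (z κ).1 (z κ).2))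
        fun κ => ((π κ).exec (z κ).1 (z κ).2).map fun e => (e.2.1, e.2.2.1, e.2.2.2)) :
    CI (I := Σ κ, (Fin (N κ) → M κ) × Fin (N κ)) (fun x => x.1) (fun x => p x.1)
      (α := fun x => (π x.1).View₁ × Unit × M x.1)
      (fun x => (Sim x.1 (x.2.2, x.2.1 x.2.2)).map fun v => (v, (), x.2.1 x.2.2))
      fun x => ((π x.1).exec x.2.1 x.2.2).map fun e => (e.2.1, e.2.2.1, e.2.2.2) := by
  have hz : ∀ κ, Nonempty ((Fin (N κ) → M κ) × Fin (N κ)) := fun κ => inferInstance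
  have key := @CI.of_indist p _ (fun κ => (π κ).View₁ × Unit × M κ) _
    (fun κ => (Fin (N κ) → M κ) × Fin (N κ)) hz
    (fun κ z => (Sim κ (z.2, z.1 z.2)).map fun v => (v, (), z.1 z.2))
    (fun κ z => ((π κ).exec z.1 z.2).map fun e => (e.2.1, e.2.2.1, e.2.2.2))
  have key' := key h
  exact key'

theorem OTSecure.exists_receiver_sim [∀ κ, NeZero (N κ)] [hM : ∀ κ, Nonempty (M κ)]
    (h : OTSecure p π) :
    ∃ Sim : ∀ κ, Fin (N κ) × M κ → PMF (π κ).View₁, PolyTime p Sim ∧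
      CI (I := Σ κ, (Fin (N κ) → M κ) × Fin (N κ)) (fun x => x.1) (fun x => p x.1)
        (α := fun x => (π x.1).View₁ × Unit × M x.1)
        (fun x => (Sim x.1 (x.2.2, x.2.1 x.2.2)).map fun v => (v, (), x.2.1 x.2.2))
        fun x => ((π x.1).exec x.2.1 x.2.2).map fun e => (e.2.1, e.2.2.1, e.2.2.2) :=
  let ⟨Sim, hS, hSim⟩ := h.exists_receiver_sim_seq
  ⟨Sim, hS, CI.receiver_of_indist Sim hSim⟩

/-- Correctness is a consequence of security. -/
theorem OTSecure.exists_correct [∀ κ, NeZero (N κ)] [∀ κ, Nonempty (M κ)]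
    [∀ κ, DecidableEq (M κ)] (h : OTSecure p π)
    (hM : DT (I := Σ κ : ℕ, M κ) (fun x => x.1) (fun x => p x.1)
      fun x (y : M x.1) => decide (y ≠ x.2)) :
    ∃ ε : ℕ → NNReal, Negligible (fun κ => (ε κ : ℝ)) ∧ ∀ κ, OTCorrect (π κ) (ε κ) := by
  obtain ⟨Sim, -, hCI⟩ := h.exists_sender_sim
  have hM' := hM.reindex fun x : Σ κ, (Fin (N κ) → M κ) × Fin (N κ) =>
    (⟨x.1, x.2.1 x.2.2⟩ : Σ κ, M κ)
  have hs : DT (I := Σ κ, (Fin (N κ) → M κ) × Fin (N κ)) (fun x => x.1) (fun x => p x.1)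
      (α := fun x => (π x.1).View₀ × Unit × M x.1) (β := fun x => M x.1)
      fun x a => a.2.2 := DT.id.snd.snd
  -- On the simulated side the output equals the chosen input with certainty, so all failure
  -- probability of the real protocol is distinguishing error.
  obtain ⟨ε, hε, hb⟩ := hCI.expect_le (c := fun x a => a.2.2 = x.2.1 x.2.2) (hM'.comp hs)
  refine ⟨ε, hε, fun κ a c => ?_⟩
  have := hb ⟨κ, a, c⟩
  simpa only [expect_map, if_true, expect_const, zero_add] using this

end

/- ### Homomorphic evaluation in the protocol -/

section

variable {p l k m : ℕ} [Fact p.Prime] (B : Blocks p l k m)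

/-- The sum of the entries at given positions. -/
def sumFormula (pos : Fin k → Fin m) : Formula p (Fin m) := .sum k fun a => .inp (pos a)

/-- The product of `s` with the sum of the entries at given positions. -/
def mulSumFormula (pos : Fin k → Fin m) (s : ZMod p) : Formula p (Fin m) :=
  .mul 2 ![.own s, sumFormula pos]

theorem evalFormula_sum_two (H : HEScheme p) {ι : Type} (pk : H.PK) (c : ι → H.CT)
    (e₀ e₁ : Formula p ι) :
    H.evalFormula pk c (.sum 2 ![e₀, e₁]) =
      (H.evalFormula pk c e₀).bind fun z₀ => (H.evalFormula pk c e₁).bind fun z₁ =>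
        (unif (Bits (H.sumLen 2))).map fun ω => H.evalSum pk 2 ![z₀, z₁] ω := by
  change ((indep 2 fun i => H.evalFormula pk c (![e₀, e₁] i)).bind fun cs =>
    (unif (Bits (H.sumLen 2))).bind fun ω => PMF.pure (H.evalSum pk 2 cs ω)) = _
  change (((H.evalFormula pk c e₀).bind fun z₀ => ((H.evalFormula pk c e₁).bind fun z₁ =>
    (PMF.pure Fin.elim0).bind fun v => PMF.pure (Fin.cons z₁ v : Fin 1 → H.CT)).bind fun v =>
      PMF.pure (Fin.cons z₀ v : Fin 2 → H.CT)).bind _) = _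
  simp only [PMF.bind_bind, PMF.pure_bind]
  have : ∀ z₀ z₁ : H.CT, (Fin.cons z₀ (Fin.cons z₁ Fin.elim0 : Fin 1 → H.CT) : Fin 2 → H.CT) =
      ![z₀, z₁] := by
    intro z₀ z₁
    funext i
    fin_cases i <;> rfl
  simp only [this]
  rfl

theorem evalFormula_mul_two (H : HEScheme p) {ι : Type} (pk : H.PK) (c : ι → H.CT)
    (e₀ e₁ : Formula p ι) :
    H.evalFormula pk c (.mul 2 ![e₀, e₁]) =
      (H.evalFormula pk c e₀).bind fun z₀ => (H.evalFormula pk c e₁).bind fun z₁ =>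
        (unif (Bits (H.mulLen 2))).map fun ω => H.evalMul pk 2 ![z₀, z₁] ω := by
  change ((indep 2 fun i => H.evalFormula pk c (![e₀, e₁] i)).bind fun cs =>
    (unif (Bits (H.mulLen 2))).bind fun ω => PMF.pure (H.evalMul pk 2 cs ω)) = _
  change (((H.evalFormula pk c e₀).bind fun z₀ => ((H.evalFormula pk c e₁).bind fun z₁ =>
    (PMF.pure Fin.elim0).bind fun v => PMF.pure (Fin.cons z₁ v : Fin 1 → H.CT)).bind fun v =>
      PMF.pure (Fin.cons z₀ v : Fin 2 → H.CT)).bind _) = _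
  simp only [PMF.bind_bind, PMF.pure_bind]
  have : ∀ z₀ z₁ : H.CT, (Fin.cons z₀ (Fin.cons z₁ Fin.elim0 : Fin 1 → H.CT) : Fin 2 → H.CT) =
      ![z₀, z₁] := by
    intro z₀ z₁
    funext i
    fin_cases i <;> rfl
  simp only [this]
  rfl

theorem evalFormula_own (H : HEScheme p) {ι : Type} (pk : H.PK) (c : ι → H.CT) (a : ZMod p) :
    H.evalFormula pk c (.own a) = (unif (Bits H.encLen)).map fun ω => H.enc pk a ω :=
  rfl

theorem evalFormula_sumFormula (H : HEScheme p) (pk : H.PK) (c : Fin m → H.CT)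
    (pos : Fin k → Fin m) :
    H.evalFormula pk c (sumFormula pos) =
      (unif (Bits (H.sumLen k))).map fun ω => H.evalSum pk k (fun a => c (pos a)) ω := by
  change ((indep k fun a => PMF.pure (c (pos a))).bind fun cs =>
    (unif (Bits (H.sumLen k))).bind fun ω => PMF.pure (H.evalSum pk k cs ω)) = _
  rw [indep_pure, PMF.pure_bind]
  rfl

/-- The client's message has exactly the law of homomorphically evaluating a masked formula, the
mask being a fresh encryption of -μ. Correctness and function privacy of the scheme thereby apply to
it. -/
theorem evalFormula_ν (pk : B.he.PK) (c : Fin m → B.he.CT) (pos : Fin k → Fin m) (μ : ZMod p) :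
    B.he.evalFormula pk c (.sum 2 ![sumFormula pos, .own (-μ)]) =
      (unif (Bits (B.he.sumLen k))).bind fun ωsum => (unif (Bits B.he.encLen)).bind fun ωμ =>
      (unif (Bits (B.he.sumLen 2))).map fun ων =>
        ctν B pk (fun a => c (pos a)) μ ωsum ωμ ων := by
  rw [evalFormula_sum_two, evalFormula_sumFormula, evalFormula_own]
  simp only [PMF.bind_map, Function.comp_def]
  rfl

theorem evalFormula_ν' (pk : B.he.PK) (c : Fin m → B.he.CT) (pos : Fin k → Fin m)
    (s δ : ZMod p) :
    B.he.evalFormula pk c (.sum 2 ![mulSumFormula pos s, .own (-δ)]) =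
      (unif (Bits (B.he.sumLen k))).bind fun ωsum' => (unif (Bits B.he.encLen)).bind fun ωs =>
      (unif (Bits (B.he.mulLen 2))).bind fun ωmul => (unif (Bits B.he.encLen)).bind fun ωδ =>
      (unif (Bits (B.he.sumLen 2))).map fun ων' =>
        ctν' B pk (fun a => c (pos a)) s δ ωsum' ωs ωmul ωδ ων' := by
  rw [evalFormula_sum_two, mulSumFormula, evalFormula_mul_two, evalFormula_sumFormula,
    evalFormula_own, evalFormula_own]
  simp only [PMF.bind_map, PMF.bind_bind, Function.comp_def]
  -- The formula evaluates its factor `own s` first, whereas the protocol draws the tape of the sum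
  -- first.
  rw [PMF.bind_comm]
  rfl

theorem value_sumFormula (pos : Fin k → Fin m) (x : Fin m → ZMod p) :
    (sumFormula pos : Formula p (Fin m)).value x = ∑ a, x (pos a) := rfl

theorem value_mulSumFormula (pos : Fin k → Fin m) (s : ZMod p) (x : Fin m → ZMod p) :
    (mulSumFormula pos s).value x = s * ∑ a, x (pos a) := by
  change (∏ i : Fin 2, ((![.own s, sumFormula pos] : Fin 2 → Formula p (Fin m)) i).value x) = _
  rw [Fin.prod_univ_two]
  rfl

theorem value_sub (e : Formula p (Fin m)) (b : ZMod p) (x : Fin m → ZMod p) :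
    (Formula.sum 2 ![e, .own (-b)]).value x = e.value x - b := by
  change (∑ i : Fin 2, ((![e, .own (-b)] : Fin 2 → Formula p (Fin m)) i).value x) = _
  rw [Fin.sum_univ_two, sub_eq_add_neg]
  rfl

theorem size_sumFormula (pos : Fin k → Fin m) :
    (sumFormula pos : Formula p (Fin m)).size = 1 + k := by
  change 1 + ∑ _ : Fin k, 1 = _
  simp

theorem size_mulSumFormula (pos : Fin k → Fin m) (s : ZMod p) :
    (mulSumFormula pos s).size = 3 + k := by
  change 1 + (∑ i : Fin 2, ((![.own s, sumFormula pos] : Fin 2 → Formula p (Fin m)) i).size) = _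
  rw [Fin.sum_univ_two]
  change 1 + (1 + (sumFormula pos : Formula p (Fin m)).size) = _
  rw [size_sumFormula]
  ring

theorem size_sub (e : Formula p (Fin m)) (b : ZMod p) :
    (Formula.sum 2 ![e, .own b]).size = 2 + e.size := by
  change 1 + (∑ i : Fin 2, ((![e, .own b] : Fin 2 → Formula p (Fin m)) i).size) = _
  rw [Fin.sum_univ_two]
  change 1 + (e.size + 1) = _
  ring

theorem degree_sumFormula (pos : Fin k → Fin m) :
    (sumFormula pos : Formula p (Fin m)).degree ≤ 1 := by
  change (Finset.univ.sup fun _ : Fin k => 1) ≤ 1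
  exact Finset.sup_le fun _ _ => le_rfl

/-- The fresh encryption of `s` counts as degree one, so this product uses the full degree allowed
by the assumptions. -/
theorem degree_mulSumFormula (pos : Fin k → Fin m) (s : ZMod p) :
    (mulSumFormula pos s).degree ≤ 2 := by
  change (∑ i : Fin 2, ((![.own s, sumFormula pos] : Fin 2 → Formula p (Fin m)) i).degree) ≤ 2
  rw [Fin.sum_univ_two]
  exact add_le_add (le_refl 1) (degree_sumFormula pos)

theorem degree_sub (e : Formula p (Fin m)) (b : ZMod p) (h : e.degree ≤ 2) :
    (Formula.sum 2 ![e, .own b]).degree ≤ 2 := by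
  change (Finset.univ.sup fun i => ((![e, .own b] : Fin 2 → Formula p (Fin m)) i).degree) ≤ 2
  refine Finset.sup_le fun i _ => ?_
  fin_cases i
  · exact h
  · exact one_le_two

end

/-! ### Uniform failure bounds and statistical closeness to the ideal execution -/

section

variable {p l k m n : ℕ → ℕ} [∀ κ, Fact (p κ).Prime] {B : ∀ κ, Blocks (p κ) (l κ) (k κ) (m κ)}

/-- Failure probabilities lie between 0 and 1, so `exists_negligible_bound` makes the assumed
correctness uniform in `z`. The nested expectation is the failure probability of `evalGame` with its
draws written out. -/
theorem HECorrect.exists_bound (h : HECorrect p fun κ => (B κ).he) (hm : PolyBounded m)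
    {Z : ℕ → Type} [∀ κ, Nonempty (Z κ)] (x : ∀ κ, Z κ → Fin (m κ) → ZMod (p κ))
    (e : ∀ κ, Z κ → Formula (p κ) (Fin (m κ)))
    (hs : ∀ z : ∀ κ, Z κ, PolyBounded fun κ => (e κ (z κ)).size) (hd : ∀ κ z, (e κ z).degree ≤ 2) :
    ∃ ε : ℕ → NNReal, Negligible (fun κ => (ε κ : ℝ)) ∧ ∀ κ z,
      (expect (unif (Bits (B κ).he.genLen)) fun g =>
        expect (unif (Fin (m κ) → Bits (B κ).he.encLen)) fun ω =>
        expect ((B κ).he.evalFormula ((B κ).he.keyGen g).1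
          (encTable (B κ) ((B κ).he.keyGen g).1 (x κ z) ω) (e κ z)) fun c =>
          if (B κ).he.dec ((B κ).he.keyGen g).2 c = (e κ z).value (x κ z) then 0 else 1) ≤
        ε κ := by
  obtain ⟨ε, hε, hb⟩ := exists_negligible_bound (W := Z)
    (fun κ z => prob ((B κ).he.evalGame (x κ z) (e κ z)) {v | (B κ).he.dec
      ((B κ).he.keyGen v.1).2 v.2.2 ≠ (e κ z).value (x κ z)})
    (fun _ _ => prob_nonneg _ _) (fun _ _ => prob_le_one _ _)
    (fun z => h m (fun κ => x κ (z κ)) (fun κ => e κ (z κ)) hm (hs z) fun κ => hd κ (z κ))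
  refine ⟨ε, hε, fun κ z => ?_⟩
  refine le_trans (le_of_eq ?_) (toOuterMeasure_le_of_prob_le (hb κ z))
  refine Eq.trans ?_ (expect_eq_outer ((B κ).he.evalGame (x κ z) (e κ z))
    fun v => (B κ).he.dec ((B κ).he.keyGen v.1).2 v.2.2 = (e κ z).value (x κ z))
  change _ = expect ((unif (Bits (B κ).he.genLen)).bind fun g =>
    (unif (Fin (m κ) → Bits (B κ).he.encLen)).bind fun ω =>
    ((B κ).he.evalFormula ((B κ).he.keyGen g).1
          (encTable (B κ) ((B κ).he.keyGen g).1 (x κ z) ω) (e κ z)).bind fun c =>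
      PMF.pure (g, ω, c)) _
  simp only [expect_bind, expect_pure]

theorem HECorrect.exists_decCorrect (h : HECorrect p fun κ => (B κ).he) (hm : PolyBounded m)
    (hk : PolyBounded k) :
    ∃ ε : ℕ → NNReal, Negligible (fun κ => (ε κ : ℝ)) ∧ ∀ κ, DecCorrect (B κ) (ε κ) := by
  obtain ⟨P, hP⟩ := hk
  let W : ℕ → Type := fun κ => (Fin (m κ) → ZMod (p κ)) × (Fin (k κ) → Fin (m κ)) × ZMod (p κ) ×
    ZMod (p κ)
  let F : ∀ κ, W κ → Formula (p κ) (Fin (m κ)) := fun κ w =>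
    .sum 2 ![sumFormula w.2.1, .own (-w.2.2.2)]
  let F' : ∀ κ, W κ → Formula (p κ) (Fin (m κ)) := fun κ w =>
    .sum 2 ![mulSumFormula w.2.1 w.2.2.1, .own (-w.2.2.2)]
  -- `W κ` is empty if m = 0 < k, so `none` is added with a trivial formula to keep the parameters
  -- nonempty. The bound 5 + k is the size of the larger of the two masked formulas.
  have hs : ∀ κ (z : Option (W κ)), (z.elim (.own 0) (F κ)).size ≤ (5 + P).eval κ := fun κ z => by
    have := hP κ
    rw [Polynomial.eval_add]
    rcases z with _ | w
    · simp [Formula.size]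
      omega
    · simp only [Option.elim, F, size_sub, size_sumFormula]
      simp
      omega
  have hs' : ∀ κ (z : Option (W κ)), (z.elim (.own 0) (F' κ)).size ≤ (5 + P).eval κ := fun κ z => by
    have := hP κ
    rw [Polynomial.eval_add]
    rcases z with _ | w
    · simp [Formula.size]
      omega
    · simp only [Option.elim, F', size_sub, size_mulSumFormula]
      simp
      omega
  obtain ⟨ε, hε, h1⟩ := h.exists_bound hm (Z := fun κ => Option (W κ))
    (fun κ z => z.elim 0 fun w => w.1) (fun κ z => z.elim (.own 0) (F κ))
    (fun z => ⟨5 + P, fun κ => hs κ (z κ)⟩) (fun κ z => by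
      rcases z with _ | w
      · exact one_le_two
      · exact degree_sub _ _ ((degree_sumFormula _).trans one_le_two))
  obtain ⟨ε', hε', h2⟩ := h.exists_bound hm (Z := fun κ => Option (W κ))
    (fun κ z => z.elim 0 fun w => w.1) (fun κ z => z.elim (.own 0) (F' κ))
    (fun z => ⟨5 + P, fun κ => hs' κ (z κ)⟩) (fun κ z => by
      rcases z with _ | w
      · exact one_le_two
      · exact degree_sub _ _ (degree_mulSumFormula _ _))
  refine ⟨fun κ => ε κ + ε' κ, hε.add hε', fun κ f pos s => ⟨?_, ?_⟩⟩
  · refine le_trans ?_ (show (ε κ : ℝ≥0∞) ≤ _ by simp)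
    simp only [decErr₁]
    have : ∀ μ, _ := fun μ => h1 κ (some (f, pos, s, μ))
    simp only [Option.elim, F, evalFormula_ν, value_sub, value_sumFormula, expect_bind,
      expect_map] at this
    -- The bound holds for each fixed mask, hence on average; the draw of the mask is then moved
    -- behind those of the keys and tapes.
    refine le_trans (le_of_eq ?_) (expect_le (P := unif (ZMod (p κ))) fun μ _ => this μ)
    rw [expect_comm (unif (ZMod (p κ)))]
    refine congrArg _ (funext fun g => ?_)
    rw [expect_comm (unif (ZMod (p κ)))]
  · refine le_trans ?_ (show (ε' κ : ℝ≥0∞) ≤ _ by simp)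
    simp only [decErr₂]
    have : ∀ μ, _ := fun μ => h2 κ (some (f, pos, s, μ))
    simp only [Option.elim, F', evalFormula_ν', value_sub, value_mulSumFormula, expect_bind,
      expect_map] at this
    refine le_trans (le_of_eq ?_) (expect_le (P := unif (ZMod (p κ))) fun μ _ => this μ)
    rw [expect_comm (unif (ZMod (p κ)))]
    refine congrArg _ (funext fun g => ?_)
    rw [expect_comm (unif (ZMod (p κ)))]

theorem BFReliable.exists_bound (h : BFReliable l k m n fun κ => (B κ).hf) :
    ∃ ε : ℕ → NNReal, Negligible (fun κ => (ε κ : ℝ)) ∧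
      ∀ κ, BFReliableWith (B κ) (n κ) (ε κ) := by
  let W : ℕ → Type := fun κ =>
    {z : Finset (Bits (l κ)) × Bits (l κ) // z.1.card ≤ n κ ∧ z.2 ∉ z.1}
  have : ∀ κ, Nonempty (W κ) := fun κ => ⟨⟨(∅, fun _ => true), by simp⟩⟩
  obtain ⟨ε, hε, hb⟩ := exists_negligible_bound (W := W)
    (fun κ z => prob (unif (Bits (B κ).hf.seedLen)) {s | ∀ i, BFSet ((B κ).hf.hash s) z.1.1
      ((B κ).hf.hash s i z.1.2)})
    (fun _ _ => prob_nonneg _ _) (fun _ _ => prob_le_one _ _)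
    (fun z => h (fun κ => (z κ).1.1) (fun κ => (z κ).1.2) (fun κ => (z κ).2.1) fun κ => (z κ).2.2)
  exact ⟨ε, hε, fun κ Q x hQ hx => toOuterMeasure_le_of_prob_le (hb κ ⟨(Q, x), hQ, hx⟩)⟩

theorem Negligible.tendsto_zero {f : ℕ → ℝ} (h : Negligible f) : Tendsto f atTop (𝓝 0) := by
  simpa using h 0

theorem polyBounded_size (hlog : PolyBounded fun κ => Nat.log 2 (p κ)) :
    PolyBounded fun κ => (p κ).size := by
  obtain ⟨P, hP⟩ := hlog
  refine ⟨P + 1, fun κ => ?_⟩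
  have : Nat.log 2 (p κ) ≤ P.eval κ := hP κ
  have h2 : (p κ).size ≤ Nat.log 2 (p κ) + 1 := by
    rw [Nat.size_le]
    exact Nat.lt_pow_succ_log_self one_lt_two _
  simp
  omega

/-- The product of k + 3 with 1/p is negligible, hence eventually below 1. The summand 3 yields p ≠
2 along with k < p. -/
theorem eventually_lt_of_negligible (hp : Negligible fun κ => 1 / (p κ : ℝ))
    (hk : PolyBounded k) : ∀ᶠ κ in atTop, k κ < p κ ∧ p κ ≠ 2 := by
  obtain ⟨P, hP⟩ := hk
  have h1 : Negligible fun κ => (((1 / (p κ : NNReal) : NNReal)) : ℝ) := by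
    simpa using hp
  have h2 := (h1.poly_mul (s := fun κ => k κ + 3) ⟨P + 3, fun κ => by
    have := hP κ
    simp
    omega⟩).tendsto_zero
  filter_upwards [h2.eventually (gt_mem_nhds one_pos)] with κ hκ
  have hpos : (0 : ℝ) < p κ := by exact_mod_cast (Fact.out : (p κ).Prime).pos
  push_cast at hκ
  rw [mul_one_div, div_lt_one hpos] at hκ
  have : k κ + 3 < p κ := by exact_mod_cast hκ
  omega

/-- The protocol is statistically close to its execution with ideal subroutines. -/
theorem si_ssipIdeal {t : ℕ → ℕ} (adj : Bool) (hp : Negligible fun κ => 1 / (p κ : ℝ))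
    (hlog : PolyBounded fun κ => Nat.log 2 (p κ))
    (hk : PolyBounded k) (hm : PolyBounded m) (hn : PolyBounded n) (ht : PolyBounded t)
    (hBF : BFReliable l k m n fun κ => (B κ).hf) (hHE : HECorrect p fun κ => (B κ).he)
    (hOTB : OTSecure p fun κ => (B κ).otB) (hOTF : OTSecure p fun κ => (B κ).otF)
    (XS : ∀ κ, Fin (t κ) → Bits (l κ) × ZMod (p κ))
    (YG : ∀ κ, Fin (n κ) → Bits (l κ) × ZMod (p κ))
    (hY : ∀ κ, Function.Injective fun i => (YG κ i).1) :
    SI (fun κ => κ) (fun κ => ssip₁ (B κ) (XS κ) (YG κ)) fun κ => ssipIdeal (B κ) (XS κ) (YG κ) adj := by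
  obtain ⟨ε, hε, h⟩ := hBF.exists_bound
  obtain ⟨ε₀, hε₀, h₀⟩ := hHE.exists_decCorrect hm hk
  obtain ⟨ε₁, hε₁, h₁⟩ := hOTB.exists_correct (dt_bool_ne (p := p))
  obtain ⟨ε₂, hε₂, h₂⟩ := hOTF.exists_correct (dt_zmod_ne (polyBounded_size hlog))
  have hε₃ : Negligible fun κ => (((p κ : NNReal)⁻¹ : NNReal) : ℝ) := by
    simpa using hp
  refine SI.of_eventually ⟨_, (((hε.poly_mul ht).add (hε.poly_mul hn)).add
    ((hε₀.add ((hε₃.poly_mul hk).add (hε₁.add (hε₀.add (hε₂.add hε₂))))).poly_mul ht)), ?_⟩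
  filter_upwards [eventually_lt_of_negligible hp hk] with κ hκ i hi
  subst hi
  refine (sd_ssipIdeal (B i) (XS i) (YG i) adj hκ.2 hκ.1 (hY i) (h i) (h₀ i) (h₁ i) (h₂ i)).mono
    (le_of_eq ?_)
  have hpos : (p i : NNReal) ≠ 0 := by exact_mod_cast (Fact.out : (p i).Prime).ne_zero
  push_cast [ENNReal.coe_inv hpos]
  rfl

end

section

variable {I : Type} {N q n : I → ℕ} [∀ i, Fact (q i).Prime] {α β γ : I → Type}
  [∀ i, Data (q i) (α i)] [∀ i, Data (q i) (β i)] [∀ i, Data (q i) (γ i)]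

theorem DT.pi_fst {f : ∀ i, α i → Fin (n i) → β i × γ i} (h : DT N q f) :
    DT N q fun i a j => (f i a j).1 :=
  DT.comp (f := fun i (x : Fin (n i) → β i × γ i) j => (x j).1)
    (DT.of_wiring (fun _ o => (o.1, Sum.inl o.2)) fun _ _ _ => rfl) h

theorem DT.pi_snd {f : ∀ i, α i → Fin (n i) → β i × γ i} (h : DT N q f) :
    DT N q fun i a j => (f i a j).2 :=
  DT.comp (f := fun i (x : Fin (n i) → β i × γ i) j => (x j).2)
    (DT.of_wiring (fun _ o => (o.1, Sum.inr o.2)) fun _ _ _ => rfl) h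

end

/- ## Simulation of the oblivious transfers -/

section

variable {I : Type} {N q : I → ℕ} [∀ i, Fact (q i).Prime] {α β : I → Type}
  [∀ i, Data (q i) (α i)] [∀ i, Data (q i) (β i)] {X X' : ∀ i, PMF (α i)} {Y Y' : ∀ i, PMF (β i)}

theorem CI.average_sigma {Z : I → Type} (P : ∀ i, PMF (Z i)) {X Y : ∀ x : Σ i, Z i, PMF (α x.1)}
    (h : CI (fun x : Σ i, Z i => N x.1) (fun x => q x.1) X Y) :
    CI N q (fun i => (P i).bind fun z => X ⟨i, z⟩) fun i => (P i).bind fun z => Y ⟨i, z⟩ :=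
  CI.average P (X := fun i z => X ⟨i, z⟩) (Y := fun i z => Y ⟨i, z⟩) h

theorem CI.indep_congr_sigma {n : I → ℕ} (hn : PolyBdd N n) (hα : FewWires N q α)
    {X Y : ∀ x : Σ i, Fin (n i), PMF (α x.1)}
    (h : CI (fun x : Σ i, Fin (n i) => N x.1) (fun x => q x.1) X Y) :
    CI N q (fun i => indep (n i) fun j => X ⟨i, j⟩) fun i => indep (n i) fun j => Y ⟨i, j⟩ :=
  CI.indep_congr hn hα (X := fun i j => X ⟨i, j⟩) (Y := fun i j => Y ⟨i, j⟩) h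

/-- One factor is exchanged while the other is fixed and wired in, then the roles are reversed.
Neither factor needs an efficient sampler. -/
theorem CI.prod (hα : FewWires N q α) (hβ : FewWires N q β) (hX : CI N q X X')
    (hY : CI N q Y Y') :
    CI N q (fun i => (X i).bind fun a => (Y i).map fun b => (a, b))
      fun i => (X' i).bind fun a => (Y' i).map fun b => (a, b) := by
  have h1 : CI N q (fun i => (X i).bind fun a => (Y i).map fun b => (a, b))
      fun i => (X i).bind fun a => (Y' i).map fun b => (a, b) := by
    refine CI.average X ?_
    refine CI.map (hY.reindex fun x : Σ i, α i => x.1)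
      (g := fun (x : Σ i, α i) (b : β x.1) => (x.2, b)) ?_
    exact DT.prodMk (DT.const (hα.reindex fun x : Σ i, α i => x.1) fun x => x.2) DT.id
  have h2 : CI N q (fun i => (Y' i).bind fun b => (X i).map fun a => (a, b))
      fun i => (Y' i).bind fun b => (X' i).map fun a => (a, b) := by
    refine CI.average Y' ?_
    refine CI.map (hX.reindex fun x : Σ i, β i => x.1)
      (g := fun (x : Σ i, β i) (a : α x.1) => (a, x.2)) ?_
    exact DT.prodMk DT.id (DT.const (hβ.reindex fun x : Σ i, β i => x.1) fun x => x.2)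
  have e : ∀ (X : ∀ i, PMF (α i)) i, ((Y' i).bind fun b => (X i).map fun a => (a, b)) =
      (X i).bind fun a => (Y' i).map fun b => (a, b) := fun X i => PMF.bind_comm _ _ _
  simp only [e] at h2
  exact h1.trans h2

end

section

variable {p : ℕ → ℕ} [∀ κ, Fact (p κ).Prime]

variable {In₀ In₁ Out₀ Out₁ : ℕ → Type}
  [∀ κ, Data (p κ) (In₀ κ)] [∀ κ, Data (p κ) (In₁ κ)]
  [∀ κ, Data (p κ) (Out₀ κ)] [∀ κ, Data (p κ) (Out₁ κ)]
  {π : ∀ κ, TwoParty (In₀ κ) (In₁ κ) (Out₀ κ) (Out₁ κ)}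

theorem TwoParty.Efficient.fewWires₀ (h : TwoParty.Efficient p π) {I : Type} (N : I → ℕ) :
    FewWires N (fun i => p (N i)) fun i => (π (N i)).View₀ :=
  (fewWires_bits (PolyBounded.polyBdd h.2.2.1)).prod
    (FewWires.pi (PolyBounded.polyBdd h.1)
      (fewWires_bits (PolyBounded.polyBdd h.2.1)).option)

theorem TwoParty.Efficient.fewWires₁ (h : TwoParty.Efficient p π) {I : Type} (N : I → ℕ) :
    FewWires N (fun i => p (N i)) fun i => (π (N i)).View₁ :=
  (fewWires_bits (PolyBounded.polyBdd h.2.2.2.1)).prod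
    (FewWires.pi (PolyBounded.polyBdd h.1)
      (fewWires_bits (PolyBounded.polyBdd h.2.1)).option)

end

section

variable {p : ℕ → ℕ} [∀ κ, Fact (p κ).Prime] {N : ℕ → ℕ} {M : ℕ → Type} [∀ κ, Data (p κ) (M κ)]
  {π : ∀ κ, OTProtocol (N κ) (M κ)}

/-- The inputs are arbitrary functions of the index, so they may depend on values sampled earlier.
Outputs can be dropped, because the ideal execution continues with the prescribed results instead.
-/
theorem OTSecure.exists_sender_view [∀ κ, NeZero (N κ)] [∀ κ, Nonempty (M κ)]
    (h : OTSecure p π) :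
    ∃ Sim : ∀ κ, (Fin (N κ) → M κ) × Unit → PMF (π κ).View₀, PolyTime p Sim ∧
      ∀ {I : Type} (L : I → ℕ) (a : ∀ i, Fin (N (L i)) → M (L i)) (c : ∀ i, Fin (N (L i))),
        CI L (fun i => p (L i)) (fun i => Sim (L i) (a i, ()))
          fun i => ((π (L i)).exec (a i) (c i)).map fun e => e.1 := by
  obtain ⟨Sim, hS, hSim⟩ := h.exists_sender_sim
  refine ⟨Sim, hS, fun L a c => ?_⟩
  have hf : DT (I := Σ κ, (Fin (N κ) → M κ) × Fin (N κ)) (fun x => x.1) (fun x => p x.1)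
      (α := fun x => (π x.1).View₀ × Unit × M x.1) (β := fun x => (π x.1).View₀)
      fun x a => a.1 := DT.id.fst
  have h1 := (hSim.map hf).reindex fun i => ⟨L i, a i, c i⟩
  simp only [PMF.map_comp] at h1
  refine (CI.of_eq fun i => ?_).trans (h1.trans (CI.of_eq fun i => rfl))
  exact (PMF.map_id _).symm

/-- The simulator receives the entry selected by the actual inputs. For this to be the prescribed
result the inputs must agree with it, which is the purpose of `adj` in `onlineIdeal`. -/
theorem OTSecure.exists_receiver_view [∀ κ, NeZero (N κ)] [∀ κ, Nonempty (M κ)]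
    (h : OTSecure p π) :
    ∃ Sim : ∀ κ, Fin (N κ) × M κ → PMF (π κ).View₁, PolyTime p Sim ∧
      ∀ {I : Type} (L : I → ℕ) (a : ∀ i, Fin (N (L i)) → M (L i)) (c : ∀ i, Fin (N (L i))),
        CI L (fun i => p (L i)) (fun i => Sim (L i) (c i, a i (c i)))
          fun i => ((π (L i)).exec (a i) (c i)).map fun e => e.2.1 := by
  obtain ⟨Sim, hS, hSim⟩ := h.exists_receiver_sim
  refine ⟨Sim, hS, fun L a c => ?_⟩
  have hf : DT (I := Σ κ, (Fin (N κ) → M κ) × Fin (N κ)) (fun x => x.1) (fun x => p x.1)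
      (α := fun x => (π x.1).View₁ × Unit × M x.1) (β := fun x => (π x.1).View₁)
      fun x a => a.1 := DT.id.fst
  have h1 := (hSim.map hf).reindex fun i => ⟨L i, a i, c i⟩
  simp only [PMF.map_comp] at h1
  refine (CI.of_eq fun i => ?_).trans (h1.trans (CI.of_eq fun i => rfl))
  exact (PMF.map_id _).symm

end

/- ## Encrypted tables -/

section

variable {p : ℕ → ℕ} [∀ κ, Fact (p κ).Prime] {H : ∀ κ, HEScheme (p κ)} {I : Type} {L : I → ℕ}
  {α : I → Type} [∀ i, Data (p (L i)) (α i)]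

theorem HEEfficient.dt_pk (h : HEEfficient p H) {g : ∀ i, α i → Bits (H (L i)).genLen}
    (hg : DT L (fun i => p (L i)) g) :
    DT L (fun i => p (L i)) fun i x => ((H (L i)).keyGen (g i x)).1 := by
  have h1 : DT L (fun i => p (L i)) (α := fun i => Bits (H (L i)).genLen)
      (β := fun i => (H (L i)).PK × (H (L i)).SK) fun i g => (H (L i)).keyGen g :=
    h.2.2.2.2.2.1.pt L
  exact (h1.comp hg).fst

theorem HEEfficient.dt_enc (h : HEEfficient p H) {pk : ∀ i, α i → (H (L i)).PK}
    {a : ∀ i, α i → ZMod (p (L i))} {ω : ∀ i, α i → Bits (H (L i)).encLen}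
    (hpk : DT L (fun i => p (L i)) pk) (ha : DT L (fun i => p (L i)) a)
    (hω : DT L (fun i => p (L i)) ω) :
    DT L (fun i => p (L i)) fun i x => (H (L i)).enc (pk i x) (a i x) (ω i x) := by
  have h1 : DT L (fun i => p (L i))
      (α := fun i => (H (L i)).PK × ZMod (p (L i)) × Bits (H (L i)).encLen)
      (β := fun i => (H (L i)).CT) fun i v => (H (L i)).enc v.1 v.2.1 v.2.2 :=
    h.2.2.2.2.2.2.1.pt L
  exact h1.comp (hpk.prodMk (ha.prodMk hω))

theorem HEEfficient.dt_evalSum (h : HEEfficient p H) {r : ℕ → ℕ} (hr : PolyBounded r)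
    {pk : ∀ i, α i → (H (L i)).PK} {c : ∀ i, α i → Fin (r (L i)) → (H (L i)).CT}
    {ω : ∀ i, α i → Bits ((H (L i)).sumLen (r (L i)))}
    (hpk : DT L (fun i => p (L i)) pk) (hc : DT L (fun i => p (L i)) c)
    (hω : DT L (fun i => p (L i)) ω) :
    DT L (fun i => p (L i)) fun i x =>
      (H (L i)).evalSum (pk i x) (r (L i)) (c i x) (ω i x) := by
  have h1 : DT L (fun i => p (L i))
      (α := fun i => (H (L i)).PK × (Fin (r (L i)) → (H (L i)).CT) ×
        Bits ((H (L i)).sumLen (r (L i))))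
      (β := fun i => (H (L i)).CT) fun i v => (H (L i)).evalSum v.1 (r (L i)) v.2.1 v.2.2 :=
    (h.2.2.2.2.2.2.2.2 r hr).2.2.1.pt L
  exact h1.comp (hpk.prodMk (hc.prodMk hω))

theorem HEEfficient.dt_evalMul (h : HEEfficient p H) {r : ℕ → ℕ} (hr : PolyBounded r)
    {pk : ∀ i, α i → (H (L i)).PK} {c : ∀ i, α i → Fin (r (L i)) → (H (L i)).CT}
    {ω : ∀ i, α i → Bits ((H (L i)).mulLen (r (L i)))}
    (hpk : DT L (fun i => p (L i)) pk) (hc : DT L (fun i => p (L i)) c)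
    (hω : DT L (fun i => p (L i)) ω) :
    DT L (fun i => p (L i)) fun i x =>
      (H (L i)).evalMul (pk i x) (r (L i)) (c i x) (ω i x) := by
  have h1 : DT L (fun i => p (L i))
      (α := fun i => (H (L i)).PK × (Fin (r (L i)) → (H (L i)).CT) ×
        Bits ((H (L i)).mulLen (r (L i))))
      (β := fun i => (H (L i)).CT) fun i v => (H (L i)).evalMul v.1 (r (L i)) v.2.1 v.2.2 :=
    (h.2.2.2.2.2.2.2.2 r hr).2.2.2.pt L
  exact h1.comp (hpk.prodMk (hc.prodMk hω))

end

section

variable {p l k m : ℕ → ℕ} [∀ κ, Fact (p κ).Prime] {B : ∀ κ, Blocks (p κ) (l κ) (k κ) (m κ)}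

theorem HEEfficient.pt_enc (h : HEEfficient p fun κ => (B κ).he) {I : Type} {L : I → ℕ}
    {α : I → Type} [∀ i, Data (p (L i)) (α i)] {pk : ∀ i, α i → (B (L i)).he.PK}
    {a : ∀ i, α i → ZMod (p (L i))} (hpk : DT L (fun i => p (L i)) pk)
    (ha : DT L (fun i => p (L i)) a) :
    PT L (fun i => p (L i)) (β := fun i => (B (L i)).he.CT) fun i x =>
      (unif (Bits (B (L i)).he.encLen)).map fun ω => (B (L i)).he.enc (pk i x) (a i x) ω := by
  refine PT.bind (f := fun (i : I) _ => unif (Bits (B (L i)).he.encLen))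
    (PT.unif_bits (PolyBounded.polyBdd (N := L) h.2.2.2.2.1)) ?_
  have h1 : DT L (fun i => p (L i)) (α := fun i => α i × Bits (B (L i)).he.encLen)
      (β := fun i => α i) fun _ x => x.1 := DT.id.fst
  exact h.dt_enc (hpk.comp h1) (ha.comp h1) DT.id.snd

theorem HEEfficient.pt_encTable (h : HEEfficient p fun κ => (B κ).he) (hm : PolyBounded m)
    {I : Type} {L : I → ℕ} {α : I → Type} [∀ i, Data (p (L i)) (α i)]
    {pk : ∀ i, α i → (B (L i)).he.PK} (hpk : DT L (fun i => p (L i)) pk)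
    (f : ∀ i, Fin (m (L i)) → ZMod (p (L i))) :
    PT L (fun i => p (L i)) (β := fun i => Fin (m (L i)) → (B (L i)).he.CT)
      fun i x => indep (m (L i)) fun q =>
        (unif (Bits (B (L i)).he.encLen)).map fun ω => (B (L i)).he.enc (pk i x) (f i q) ω :=
  PT.indep (PolyBounded.polyBdd hm) (h.pt_enc (I := Σ i, Fin (m (L i))) (L := fun x => L x.1)
    (α := fun x => α x.1) (hpk.reindex fun x : Σ i, Fin (m (L i)) => x.1)
    (DT.constF fun x : Σ i, Fin (m (L i)) => f x.1 x.2))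

theorem unif_map_encTable {p l k m : ℕ} (B : Blocks p l k m) (pk : B.he.PK)
    (f : Fin m → ZMod p) : (unif (Fin m → Bits B.he.encLen)).map (encTable B pk f) =
      indep m fun q => (unif (Bits B.he.encLen)).map fun ω => B.he.enc pk (f q) ω := by
  rw [unif_fin, indep_map]
  rfl

/-- A public key with an encrypted table is indistinguishable from one with an encryption of
zeros. -/
theorem HESemanticSecurity.ci_encTable (h : HESemanticSecurity p fun κ => (B κ).he)
    (hE : HEEfficient p fun κ => (B κ).he) (hm : PolyBounded m)
    {I : Type} (L : I → ℕ) (f f' : ∀ i, Fin (m (L i)) → ZMod (p (L i))) :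
    CI L (fun i => p (L i)) (α := fun i => (B (L i)).he.PK × (Fin (m (L i)) → (B (L i)).he.CT))
      (fun i => (unif (Bits (B (L i)).he.genLen)).bind fun g =>
        (unif (Fin (m (L i)) → Bits (B (L i)).he.encLen)).map fun ω =>
          (((B (L i)).he.keyGen g).1, encTable (B (L i)) ((B (L i)).he.keyGen g).1 (f i) ω))
      fun i => (unif (Bits (B (L i)).he.genLen)).bind fun g =>
        (unif (Fin (m (L i)) → Bits (B (L i)).he.encLen)).map fun ω =>
          (((B (L i)).he.keyGen g).1, encTable (B (L i)) ((B (L i)).he.keyGen g).1 (f' i) ω) := by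
  have key := @CI.of_indist p _ (fun κ => (B κ).he.PK × (B κ).he.CT) _
    (fun κ => ZMod (p κ) × ZMod (p κ)) (fun κ => inferInstance)
    (fun κ z => (B κ).he.encGame z.1) (fun κ z => (B κ).he.encGame z.2)
  have key' := key fun z => h (fun κ => (z κ).1) fun κ => (z κ).2
  let P : ∀ i, PMF (B (L i)).he.PK := fun i =>
    (unif (Bits (B (L i)).he.genLen)).map fun g => ((B (L i)).he.keyGen g).1
  let A : (∀ i, Fin (m (L i)) → ZMod (p (L i))) →
      ∀ i, Fin (m (L i)) → (B (L i)).he.PK → PMF (B (L i)).he.CT := fun f i q pk =>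
    (unif (Bits (B (L i)).he.encLen)).map fun ω => (B (L i)).he.enc pk (f i q) ω
  have hA : ∀ f, PT (I := Σ i, Fin (m (L i))) (fun x => L x.1) (fun x => p (L x.1))
      (α := fun x => (B (L x.1)).he.PK) (β := fun x => (B (L x.1)).he.CT)
      fun x a => A f x.1 x.2 a := fun f =>
    hE.pt_enc (I := Σ i, Fin (m (L i))) (L := fun x => L x.1)
      (α := fun x => (B (L x.1)).he.PK) DT.id
        (DT.constF fun x : Σ i, Fin (m (L i)) => f x.1 x.2)
  have e1 : ∀ f i, ((unif (Bits (B (L i)).he.genLen)).bind fun g =>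
        (unif (Fin (m (L i)) → Bits (B (L i)).he.encLen)).map fun ω =>
          (((B (L i)).he.keyGen g).1, encTable (B (L i)) ((B (L i)).he.keyGen g).1 (f i) ω)) =
      (P i).bind fun c => (indep (m (L i)) fun j => A f i j c).map fun z => (c, z) := by
    intro f i
    simp only [P, A, PMF.bind_map, ← unif_map_encTable, PMF.map_comp]
    rfl
  simp only [e1]
  -- The context is the public key: given it and one challenge ciphertext, the reduction encrypts
  -- all other entries itself.
  refine CI.indep_context (PolyBounded.polyBdd hm) (hA f) (hA f') ?_
  refine (CI.of_eq fun x => ?_).trans ((key'.reindex fun x : Σ i, Fin (m (L i)) =>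
    ⟨L x.1, f x.1 x.2, f' x.1 x.2⟩).trans (CI.of_eq fun x => ?_))
  · simp only [P, A, PMF.bind_map, PMF.map_comp]
    rfl
  · simp only [P, A, PMF.bind_map, PMF.map_comp]
    rfl

end

/- ## Simulation of the client -/

section

variable {p l k m t n : ℕ} [Fact p.Prime] (B : Blocks p l k m)

/-- Simulation of the client's view of one query, given simulators for the oblivious transfers and
the client's share. -/
def clientQuerySim (R₁ : Fin (k + 1) × Bool → PMF B.otB.View₁)
    (S₂ : (Fin 2 → ZMod p) × Unit → PMF B.otF.View₀) (R₃ : Fin 2 × ZMod p → PMF B.otF.View₁)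
    (w : ZMod p) : PMF (ClientQueryView B) :=
  (unif (ZMod p)).bind fun μ => (unif Bool).bind fun b => (unif (ZMod p)).bind fun δ =>
  (unif (ZMod p)).bind fun Δ => (queryTapes B).bind fun τ =>
  (R₁ (modIdx k μ.valMinAbs, b)).bind fun v₁ => (S₂ (clientValues b δ Δ, ())).bind fun v₂ =>
  (R₃ (choice b, w + Δ)).map fun v₃ => clientQueryView B (μ, b, δ, Δ, w) τ v₁ v₂ v₃

theorem unif_bool_xor {β : Type} (c : Bool) (f : Bool → PMF β) :
    ((unif Bool).bind fun b => f (xor b c)) = (unif Bool).bind f :=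
  unif_bind_equiv ⟨fun b => xor b c, fun b => xor b c, fun b => by simp, fun b => by simp⟩ f

/-- The server's bit enters only through its xor with `pass`, which is uniform whatever `pass` is;
and α enters the client's view only through the share u - α. So a fresh bit and the share suffice to
produce the view. -/
theorem clientQuerySim_eq (R₁ : Fin (k + 1) × Bool → PMF B.otB.View₁)
    (S₂ : (Fin 2 → ZMod p) × Unit → PMF B.otF.View₀) (R₃ : Fin 2 × ZMod p → PMF B.otF.View₁)
    (u : ZMod p) (pass : Bool) :
    ((scalars p).bind fun σ => (queryTapes B).bind fun τ =>
      (R₁ (modIdx k σ.μ.valMinAbs, xor σ.b pass)).bind fun v₁ =>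
      (S₂ (clientValues (xor σ.b pass) σ.δ σ.Δ, ())).bind fun v₂ =>
      (R₃ (choice (xor σ.b pass), u - σ.α + σ.Δ)).map fun v₃ =>
      (clientQueryView B σ τ v₁ v₂ v₃, u - σ.α, σ.α)) =
    (unif (ZMod p)).bind fun α =>
      (clientQuerySim B R₁ S₂ R₃ (u - α)).map fun v => (v, u - α, α) := by
  simp only [clientQuerySim, scalars, PMF.bind_bind, PMF.pure_bind, PMF.map_bind, PMF.map_comp,
    Scalars.μ, Scalars.b, Scalars.δ, Scalars.Δ, Scalars.α]
  conv_rhs => rw [PMF.bind_comm (unif (ZMod p)) (unif (ZMod p)) fun α μ => _]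
  refine congrArg _ (funext fun μ => ?_)
  refine Eq.trans (unif_bool_xor pass fun b => (unif (ZMod p)).bind fun δ => (unif (ZMod p)).bind fun Δ =>
    (unif (ZMod p)).bind fun α => (queryTapes B).bind fun τ =>
      (R₁ (modIdx k μ.valMinAbs, b)).bind fun v₁ => (S₂ (clientValues b δ Δ, ())).bind fun v₂ =>
      (R₃ (choice b, u - α + Δ)).map fun v₃ =>
        (clientQueryView B (μ, b, δ, Δ, α) τ v₁ v₂ v₃, u - α, α)) ?_
  conv_rhs => rw [PMF.bind_comm (unif (ZMod p)) (unif Bool) fun α b => _]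
  refine congrArg _ (funext fun b => ?_)
  conv_rhs => rw [PMF.bind_comm (unif (ZMod p)) (unif (ZMod p)) fun α δ => _]
  refine congrArg _ (funext fun δ => ?_)
  conv_rhs => rw [PMF.bind_comm (unif (ZMod p)) (unif (ZMod p)) fun α Δ => _]
  -- The two sides put different values into the last component of the scalars, which the client's
  -- view does not contain.
  rfl

end

section

variable {p l k m : ℕ → ℕ} [∀ κ, Fact (p κ).Prime] {B : ∀ κ, Blocks (p κ) (l κ) (k κ) (m κ)}
  {I : Type} {L : I → ℕ}

theorem dt_clientQueryView {α : I → Type} [∀ i, Data (p (L i)) (α i)] {σ : ∀ i, α i → Scalars (p (L i))}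
    {τ : ∀ i, α i → QueryTapes (B (L i))} {v₁ : ∀ i, α i → (B (L i)).otB.View₁}
    {v₂ : ∀ i, α i → (B (L i)).otF.View₀} {v₃ : ∀ i, α i → (B (L i)).otF.View₁}
    (hσ : DT L (fun i => p (L i)) σ) (hτ : DT L (fun i => p (L i)) τ)
    (h₁ : DT L (fun i => p (L i)) v₁) (h₂ : DT L (fun i => p (L i)) v₂)
    (h₃ : DT L (fun i => p (L i)) v₃) :
    DT L (fun i => p (L i)) (β := fun i => ClientQueryView (B (L i))) fun i x =>
      clientQueryView (B (L i)) (σ i x) (τ i x) (v₁ i x) (v₂ i x) (v₃ i x) := by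
  refine DT.via ?_
  exact hσ.fst.prodMk (hσ.snd.snd.fst.prodMk (hσ.snd.snd.snd.fst.prodMk
    (hτ.fst.prodMk (hτ.snd.fst.prodMk (hτ.snd.snd.fst.prodMk (hτ.snd.snd.snd.fst.prodMk
    (hτ.snd.snd.snd.snd.fst.prodMk (hτ.snd.snd.snd.snd.snd.fst.prodMk
    (hτ.snd.snd.snd.snd.snd.snd.fst.prodMk (hτ.snd.snd.snd.snd.snd.snd.snd.prodMk
    (h₁.prodMk (h₂.prodMk h₃))))))))))))

theorem fewWires_queryTapes (hE : HEEfficient p fun κ => (B κ).he) (hk : PolyBounded k) :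
    FewWires L (fun i => p (L i)) fun i => QueryTapes (B (L i)) := by
  have hs : FewWires L (fun i => p (L i)) fun i => Bits ((B (L i)).he.sumLen (k (L i))) :=
    fewWires_bits (PolyBounded.polyBdd (hE.2.2.2.2.2.2.2.2 k hk).1)
  have hs2 : FewWires L (fun i => p (L i)) fun i => Bits ((B (L i)).he.sumLen 2) :=
    fewWires_bits (PolyBounded.polyBdd (hE.2.2.2.2.2.2.2.2 (fun _ => 2) ⟨2, by simp⟩).1)
  have hm2 : FewWires L (fun i => p (L i)) fun i => Bits ((B (L i)).he.mulLen 2) :=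
    fewWires_bits (PolyBounded.polyBdd (hE.2.2.2.2.2.2.2.2 (fun _ => 2) ⟨2, by simp⟩).2.1)
  have he : FewWires L (fun i => p (L i)) fun i => Bits (B (L i)).he.encLen :=
    fewWires_bits (PolyBounded.polyBdd hE.2.2.2.2.1)
  exact hs.prod (he.prod (hs2.prod (hs.prod (he.prod (hm2.prod (he.prod hs2))))))

theorem fewWires_scalars : FewWires L (fun i => p (L i)) fun i => Scalars (p (L i)) :=
  fewWires_zmod.prod (fewWires_bool.prod (fewWires_zmod.prod (fewWires_zmod.prod fewWires_zmod)))

theorem fewWires_clientQueryView (hE : HEEfficient p fun κ => (B κ).he) (hk : PolyBounded k)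
    (hB : TwoParty.Efficient p fun κ => (B κ).otB) (hF : TwoParty.Efficient p fun κ => (B κ).otF) :
    FewWires L (fun i => p (L i)) fun i => ClientQueryView (B (L i)) := by
  have hs : FewWires L (fun i => p (L i)) fun i => Bits ((B (L i)).he.sumLen (k (L i))) :=
    fewWires_bits (PolyBounded.polyBdd (hE.2.2.2.2.2.2.2.2 k hk).1)
  have hs2 : FewWires L (fun i => p (L i)) fun i => Bits ((B (L i)).he.sumLen 2) :=
    fewWires_bits (PolyBounded.polyBdd (hE.2.2.2.2.2.2.2.2 (fun _ => 2) ⟨2, by simp⟩).1)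
  have hm2 : FewWires L (fun i => p (L i)) fun i => Bits ((B (L i)).he.mulLen 2) :=
    fewWires_bits (PolyBounded.polyBdd (hE.2.2.2.2.2.2.2.2 (fun _ => 2) ⟨2, by simp⟩).2.1)
  have he : FewWires L (fun i => p (L i)) fun i => Bits (B (L i)).he.encLen :=
    fewWires_bits (PolyBounded.polyBdd hE.2.2.2.2.1)
  have hz : FewWires L (fun i => p (L i)) fun i => ZMod (p (L i)) := fewWires_zmod
  exact hz.prod (hz.prod (hz.prod (hs.prod (he.prod (hs2.prod (hs.prod (he.prod (hm2.prod
    (he.prod (hs2.prod ((hB.fewWires₁ L).prod ((hF.fewWires₀ L).prod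
      (hF.fewWires₁ L)))))))))))))

/-- The client's view of one query, and the shares. -/
theorem ci_clientQuery (hE : HEEfficient p fun κ => (B κ).he) (hk : PolyBounded k)
    (hB : TwoParty.Efficient p fun κ => (B κ).otB) (hF : TwoParty.Efficient p fun κ => (B κ).otF)
    {R₁ : ∀ κ, Fin (k κ + 1) × Bool → PMF (B κ).otB.View₁}
    {S₂ : ∀ κ, (Fin 2 → ZMod (p κ)) × Unit → PMF (B κ).otF.View₀}
    {R₃ : ∀ κ, Fin 2 × ZMod (p κ) → PMF (B κ).otF.View₁}
    (h₁ : ∀ {I : Type} (L : I → ℕ) (a : ∀ i, Fin (k (L i) + 1) → Bool)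
      (c : ∀ i, Fin (k (L i) + 1)), CI L (fun i => p (L i)) (fun i => R₁ (L i) (c i, a i (c i)))
        fun i => ((B (L i)).otB.exec (a i) (c i)).map fun e => e.2.1)
    (h₂ : ∀ {I : Type} (L : I → ℕ) (a : ∀ i, Fin 2 → ZMod (p (L i))) (c : I → Fin 2),
      CI L (fun i => p (L i)) (fun i => S₂ (L i) (a i, ()))
        fun i => ((B (L i)).otF.exec (a i) (c i)).map fun e => e.1)
    (h₃ : ∀ {I : Type} (L : I → ℕ) (a : ∀ i, Fin 2 → ZMod (p (L i))) (c : I → Fin 2),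
      CI L (fun i => p (L i)) (fun i => R₃ (L i) (c i, a i (c i)))
        fun i => ((B (L i)).otF.exec (a i) (c i)).map fun e => e.2.1)
    (pk : ∀ i, (B (L i)).he.PK) (cB cG : ∀ i, Fin (k (L i)) → (B (L i)).he.CT)
    (s C G u : ∀ i, ZMod (p (L i))) (pass : I → Bool) :
    CI L (fun i => p (L i))
      (α := fun i => ClientQueryView (B (L i)) × ZMod (p (L i)) × ZMod (p (L i)))
      (fun i => (unif (ZMod (p (L i)))).bind fun α =>
        (clientQuerySim (B (L i)) (R₁ (L i)) (S₂ (L i)) (R₃ (L i)) (u i - α)).map fun v =>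
          (v, u i - α, α))
      fun i => (onlineIdeal (B (L i)) true (pk i) (cB i) (cG i) (s i) (C i) (G i) (u i)
        (pass i)).map fun e => (e.1, e.2.2.1, e.2.2.2) := by
  -- With scalars and tapes moved into the index, the three transfers have fixed inputs and are
  -- independent.
  let J : Type := Σ x : (Σ i, Scalars (p (L i))), QueryTapes (B (L x.1))
  let L' : J → ℕ := fun x => L x.1.1
  have w₁ := hB.fewWires₁ L'
  have w₂ := hF.fewWires₀ L'
  have w₃ := hF.fewWires₁ L'
  -- The client is receiver here and in the third transfer. Overwriting the selected entries makes
  -- the simulators' arguments equal to the prescribed results, although `C`, `G` and `u` are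
  -- unrelated at this point.
  let a₁ : ∀ x : J, Fin (k (L' x) + 1) → Bool := fun x =>
    Function.update (senderBits (k (L' x)) x.1.2.b (C x.1.1 - x.1.2.μ))
      (modIdx (k (L' x)) x.1.2.μ.valMinAbs) (xor x.1.2.b (pass x.1.1))
  let a₂ : ∀ x : J, Fin 2 → ZMod (p (L' x)) := fun x =>
    clientValues (xor x.1.2.b (pass x.1.1)) x.1.2.δ x.1.2.Δ
  let a₃ : ∀ x : J, Fin 2 → ZMod (p (L' x)) := fun x =>
    Function.update (serverValues x.1.2.b (x.1.2.Δ + bitF (p (L' x)) (pass x.1.1) * x.1.2.δ)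
      (s x.1.1 * G x.1.1 - x.1.2.δ) x.1.2.α) (choice (xor x.1.2.b (pass x.1.1)))
      (u x.1.1 - x.1.2.α + x.1.2.Δ)
  have k₁ := h₁ L' a₁ fun x => modIdx (k (L' x)) x.1.2.μ.valMinAbs
  have k₂ := h₂ L' a₂ fun x => choice x.1.2.b
  have k₃ := h₃ L' a₃ fun x => choice (xor x.1.2.b (pass x.1.1))
  have key := CI.prod w₁ (w₂.prod w₃) k₁ (CI.prod w₂ w₃ k₂ k₃)
  have key' := key.map (β := fun x => ClientQueryView (B (L' x)) × ZMod (p (L' x)) × ZMod (p (L' x)))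
    (g := fun x v => (clientQueryView (B (L' x)) x.1.2 x.2 v.1 v.2.1 v.2.2,
      u x.1.1 - x.1.2.α, x.1.2.α))
    (DT.prodMk (dt_clientQueryView (L := L')
      (DT.const (fewWires_scalars (L := L')) fun x => x.1.2)
      (DT.const (fewWires_queryTapes (L := L') hE hk) fun x => x.2) DT.id.fst DT.id.snd.fst
      DT.id.snd.snd) (DT.prodMk (DT.constF fun x : J => u x.1.1 - x.1.2.α)
        (DT.constF fun x : J => x.1.2.α)))
  have avg := CI.average_sigma (N := L) (q := fun i => p (L i))
    (α := fun i => ClientQueryView (B (L i)) × ZMod (p (L i)) × ZMod (p (L i)))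
    (fun i => scalars (p (L i)))
    (CI.average_sigma (N := fun x : Σ i, Scalars (p (L i)) => L x.1)
      (q := fun x : Σ i, Scalars (p (L i)) => p (L x.1))
      (α := fun x => ClientQueryView (B (L x.1)) × ZMod (p (L x.1)) × ZMod (p (L x.1)))
      (fun x => queryTapes (B (L x.1))) key')
  refine (CI.of_eq fun i => ?_).trans (avg.trans (CI.of_eq fun i => ?_))
  · rw [← clientQuerySim_eq _ _ _ _ _ (pass i)]
    simp only [a₁, a₂, a₃, Function.update_self, PMF.map_bind, PMF.map_comp]
    rfl
  · rw [onlineIdeal_eq]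
    simp only [a₁, a₂, a₃, PMF.map_bind, PMF.map_comp, PMF.bind_map, if_true, PMF.pure_map,
      Function.comp_def]
    rfl

end

/-! ### The client's whole view: encrypted tables and all queries -/

section

variable {p l k m t n : ℕ} [Fact p.Prime] (B : Blocks p l k m)

/-- A public key with two encrypted tables. -/
def encPair (f g : Fin m → ZMod p) :
    PMF (B.he.PK × (Fin m → B.he.CT) × (Fin m → B.he.CT)) :=
  (unif (Bits B.he.genLen)).bind fun gen => (unif (Fin m → Bits B.he.encLen)).bind fun ωB =>
  (unif (Fin m → Bits B.he.encLen)).map fun ωG =>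
    ((B.he.keyGen gen).1, encTable B (B.he.keyGen gen).1 f ωB,
      encTable B (B.he.keyGen gen).1 g ωG)

/-- The hash functions and the tables of the server. -/
abbrev Tables : Type := Bits B.hf.seedLen × GBFTable p m × (Fin m → ZMod p)

/-- The choice of hash functions and tables. -/
def tables (YG : Fin n → Bits l × ZMod p) : PMF (Tables B) :=
  (unif (Bits B.hf.seedLen)).bind fun seed =>
  (gbfSample (keyPos B YG seed) (fun i => (YG i).2) fun _ => none).bind fun T =>
  (gbfFinish T).map fun gbf => (seed, T, gbf)

/-- The client's view and the outputs of both parties. -/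
def clientResult (seed : Bits B.hf.seedLen) (e : B.he.PK × (Fin m → B.he.CT) × (Fin m → B.he.CT))
    (res : Fin t → ClientQueryView B × ZMod p × ZMod p) :
    ClientView B t × Option (Fin t → ZMod p) × Option (Fin t → ZMod p) :=
  ({ seed := seed, pk := e.1, rest := some (e.2.1, e.2.2, fun j => (res j).1) },
    some fun j => (res j).2.1, some fun j => (res j).2.2)

/-- Simulation of the client's view. -/
def clientSim (R₁ : Fin (k + 1) × Bool → PMF B.otB.View₁)
    (S₂ : (Fin 2 → ZMod p) × Unit → PMF B.otF.View₀) (R₃ : Fin 2 × ZMod p → PMF B.otF.View₁)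
    (w : Option (Fin t → ZMod p)) : PMF (ClientView B t) :=
  (unif (Bits B.hf.seedLen)).bind fun seed => (encPair B 0 0).bind fun e =>
  (indep t fun j => clientQuerySim B R₁ S₂ R₃ (w.getD 0 j)).map fun v =>
    { seed := seed, pk := e.1, rest := some (e.2.1, e.2.2, v) }

variable (XS : Fin t → Bits l × ZMod p) (YG : Fin n → Bits l × ZMod p)

theorem ssipIdeal_map_client : (ssipIdeal B XS YG true).map (fun e => (e.1, e.2.2.1, e.2.2.2)) =
    (tables B YG).bind fun T => (unif (Bits B.he.genLen)).bind fun gen =>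
    (unif (Fin m → Bits B.he.encLen)).bind fun ωB => (unif (Fin m → Bits B.he.encLen)).bind fun ωG =>
    (indep t fun j => (onlineIdeal B true (B.he.keyGen gen).1
      (fun a => encTable B (B.he.keyGen gen).1 (bfEntry B YG T.1) ωB (queryPos B XS T.1 j a))
      (fun a => encTable B (B.he.keyGen gen).1 T.2.2 ωG (queryPos B XS T.1 j a))
      (XS j).2 (bfSum B XS YG T.1 j) (gbfSum B XS T.1 T.2.2 j) (ssipTarget XS YG j)
      (isMember XS YG j)).map fun e => (e.1, e.2.2.1, e.2.2.2)).map
    (clientResult B T.1 ((B.he.keyGen gen).1, encTable B (B.he.keyGen gen).1 (bfEntry B YG T.1) ωB,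
      encTable B (B.he.keyGen gen).1 T.2.2 ωG)) := by
  simp only [ssipIdeal, tables, PMF.map_bind, PMF.bind_bind, PMF.bind_map, indep_map, PMF.map_comp,
    PMF.pure_map, Function.comp_def]
  rfl

/-- The per-query shares α combine to the uniform vector of the functionality. Under encryptions of
zero only the seed of the tables matters, so the garbled filter is averaged out. -/
theorem clientSim_eq (R₁ : Fin (k + 1) × Bool → PMF B.otB.View₁)
    (S₂ : (Fin 2 → ZMod p) × Unit → PMF B.otF.View₀) (R₃ : Fin 2 × ZMod p → PMF B.otF.View₁)
    (u : Fin t → ZMod p) :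
    ((indep t fun j => (unif (ZMod p)).bind fun α =>
        (clientQuerySim B R₁ S₂ R₃ (u j - α)).map fun v => (v, u j - α, α)).bind fun res =>
      (tables B YG).bind fun T => (encPair B 0 0).map fun e => clientResult B T.1 e res) =
    (unif (Fin t → ZMod p)).bind fun r =>
      (clientSim B R₁ S₂ R₃ (some (u - r))).map fun v => (v, some (u - r), some r) := by
  rw [indep_bind, ← unif_fin]
  simp only [indep_map, PMF.bind_map, PMF.bind_bind, Function.comp_def]
  refine congrArg _ (funext fun r => ?_)
  simp only [clientSim, tables, PMF.bind_bind, PMF.map_bind, PMF.bind_map, Function.comp_def,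
    PMF.bind_const, PMF.map_comp]
  rw [PMF.bind_comm]
  refine congrArg _ (funext fun seed => ?_)
  exact PMF.bind_comm _ _ _

end

section

variable {p l k m n t : ℕ → ℕ} [∀ κ, Fact (p κ).Prime] {B : ∀ κ, Blocks (p κ) (l κ) (k κ) (m κ)}
  {I : Type} {L : I → ℕ}

theorem fewWires_ct (hE : HEEfficient p fun κ => (B κ).he) :
    FewWires L (fun i => p (L i)) fun i => (B (L i)).he.CT :=
  fewWires_bits (PolyBounded.polyBdd hE.2.2.1)

theorem fewWires_tables (hh : HashEfficient p l k m fun κ => (B κ).hf) (hm : PolyBounded m) :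
    FewWires L (fun i => p (L i)) fun i => Tables (B (L i)) :=
  (fewWires_bits (PolyBounded.polyBdd hh.1)).prod
    ((FewWires.pi (PolyBounded.polyBdd hm) fewWires_zmod.option).prod
      (FewWires.pi (PolyBounded.polyBdd hm) fewWires_zmod))

/-- The tables are exchanged one after the other. Meanwhile the other table is encrypted honestly,
which needs nothing but the public key. -/
theorem HESemanticSecurity.ci_encPair (h : HESemanticSecurity p fun κ => (B κ).he)
    (hE : HEEfficient p fun κ => (B κ).he) (hm : PolyBounded m)
    (f g f' g' : ∀ i, Fin (m (L i)) → ZMod (p (L i))) :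
    CI L (fun i => p (L i)) (fun i => encPair (B (L i)) (f i) (g i))
      fun i => encPair (B (L i)) (f' i) (g' i) := by
  let T : I → Type := fun i =>
    (B (L i)).he.PK × (Fin (m (L i)) → (B (L i)).he.CT) × (Fin (m (L i)) → (B (L i)).he.CT)
  have h1 := (h.ci_encTable hE hm L f f').bind_pt (β := T)
    (g := fun i x => (indep (m (L i)) fun q => (unif (Bits (B (L i)).he.encLen)).map fun ω =>
      (B (L i)).he.enc x.1 (g i q) ω).bind fun c => PMF.pure (x.1, x.2, c))
    (PT.bind (hE.pt_encTable hm DT.id.fst g)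
      (DT.prodMk DT.id.fst.fst (DT.prodMk DT.id.fst.snd DT.id.snd)))
  have h2 := (h.ci_encTable hE hm L g g').bind_pt (β := T)
    (g := fun i x => (indep (m (L i)) fun q => (unif (Bits (B (L i)).he.encLen)).map fun ω =>
      (B (L i)).he.enc x.1 (f' i q) ω).bind fun c => PMF.pure (x.1, c, x.2))
    (PT.bind (hE.pt_encTable hm DT.id.fst f')
      (DT.prodMk DT.id.fst.fst (DT.prodMk DT.id.snd DT.id.fst.snd)))
  refine (CI.of_eq fun i => ?_).trans (h1.trans ((CI.of_eq fun i => ?_).trans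
    (h2.trans (CI.of_eq fun i => ?_))))
  · simp only [encPair, PMF.bind_bind, PMF.bind_map, ← unif_map_encTable, Function.comp_def]
    rfl
  · simp only [PMF.bind_bind, PMF.bind_map, ← unif_map_encTable, Function.comp_def]
    exact congrArg _ (funext fun gen => PMF.bind_comm _ _ _)
  · simp only [encPair, PMF.bind_bind, PMF.bind_map, ← unif_map_encTable, Function.comp_def]
    exact congrArg _ (funext fun gen => PMF.bind_comm _ _ _)

/-- The client's simulator is correct. -/
theorem ci_clientSim (hh : HashEfficient p l k m fun κ => (B κ).hf)
    (hE : HEEfficient p fun κ => (B κ).he) (hS : HESemanticSecurity p fun κ => (B κ).he)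
    (hk : PolyBounded k) (hm : PolyBounded m) (ht : PolyBounded t)
    (hB : TwoParty.Efficient p fun κ => (B κ).otB) (hF : TwoParty.Efficient p fun κ => (B κ).otF)
    {R₁ : ∀ κ, Fin (k κ + 1) × Bool → PMF (B κ).otB.View₁}
    {S₂ : ∀ κ, (Fin 2 → ZMod (p κ)) × Unit → PMF (B κ).otF.View₀}
    {R₃ : ∀ κ, Fin 2 × ZMod (p κ) → PMF (B κ).otF.View₁}
    (h₁ : ∀ {I : Type} (L : I → ℕ) (a : ∀ i, Fin (k (L i) + 1) → Bool)
      (c : ∀ i, Fin (k (L i) + 1)), CI L (fun i => p (L i)) (fun i => R₁ (L i) (c i, a i (c i)))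
        fun i => ((B (L i)).otB.exec (a i) (c i)).map fun e => e.2.1)
    (h₂ : ∀ {I : Type} (L : I → ℕ) (a : ∀ i, Fin 2 → ZMod (p (L i))) (c : I → Fin 2),
      CI L (fun i => p (L i)) (fun i => S₂ (L i) (a i, ()))
        fun i => ((B (L i)).otF.exec (a i) (c i)).map fun e => e.1)
    (h₃ : ∀ {I : Type} (L : I → ℕ) (a : ∀ i, Fin 2 → ZMod (p (L i))) (c : I → Fin 2),
      CI L (fun i => p (L i)) (fun i => R₃ (L i) (c i, a i (c i)))
        fun i => ((B (L i)).otF.exec (a i) (c i)).map fun e => e.2.1)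
    (XS : ∀ i, Fin (t (L i)) → Bits (l (L i)) × ZMod (p (L i)))
    (YG : ∀ i, Fin (n (L i)) → Bits (l (L i)) × ZMod (p (L i))) :
    CI L (fun i => p (L i)) (α := fun i => ClientView (B (L i)) (t (L i)) ×
        Option (Fin (t (L i)) → ZMod (p (L i))) × Option (Fin (t (L i)) → ZMod (p (L i))))
      (fun i => (unif (Fin (t (L i)) → ZMod (p (L i)))).bind fun r =>
        (clientSim (B (L i)) (R₁ (L i)) (S₂ (L i)) (R₃ (L i))
          (some (ssipTarget (XS i) (YG i) - r))).map fun v =>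
            (v, some (ssipTarget (XS i) (YG i) - r), some r))
      fun i => (ssipIdeal (B (L i)) (XS i) (YG i) true).map fun e => (e.1, e.2.2.1, e.2.2.2) := by
  let V : I → Type := fun i => ClientQueryView (B (L i)) × ZMod (p (L i)) × ZMod (p (L i))
  let O : I → Type := fun i => ClientView (B (L i)) (t (L i)) ×
    Option (Fin (t (L i)) → ZMod (p (L i))) × Option (Fin (t (L i)) → ZMod (p (L i)))
  let Q : ∀ i, Fin (t (L i)) → PMF (V i) := fun i j => (unif (ZMod (p (L i)))).bind fun α =>
    (clientQuerySim (B (L i)) (R₁ (L i)) (S₂ (L i)) (R₃ (L i))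
      (ssipTarget (XS i) (YG i) j - α)).map fun v => (v, ssipTarget (XS i) (YG i) j - α, α)
  have hV : FewWires L (fun i => p (L i)) V :=
    (fewWires_clientQueryView hE hk hB hF).prod (fewWires_zmod.prod fewWires_zmod)
  let E : I → Type := fun i =>
    (B (L i)).he.PK × (Fin (m (L i)) → (B (L i)).he.CT) × (Fin (m (L i)) → (B (L i)).he.CT)
  have hEw : FewWires L (fun i => p (L i)) E :=
    (fewWires_bits (PolyBounded.polyBdd hE.1)).prod
      ((FewWires.pi (PolyBounded.polyBdd hm) (fewWires_ct hE)).prod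
        (FewWires.pi (PolyBounded.polyBdd hm) (fewWires_ct hE)))
  -- Semantic security: the simulated queries do not involve the ciphertexts, so they and the tables
  -- are fixed while the encrypted zeros are replaced.
  have s1 : CI L (fun i => p (L i)) (α := O)
      (fun i => (indep (t (L i)) (Q i)).bind fun res => (tables (B (L i)) (YG i)).bind fun T =>
        (encPair (B (L i)) 0 0).map fun e => clientResult (B (L i)) T.1 e res)
      (fun i => (indep (t (L i)) (Q i)).bind fun res => (tables (B (L i)) (YG i)).bind fun T =>
        (encPair (B (L i)) (bfEntry (B (L i)) (YG i) T.1) T.2.2).map fun e =>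
          clientResult (B (L i)) T.1 e res) := by
    let J : Type := Σ x : (Σ i, Fin (t (L i)) → V i), Tables (B (L x.1))
    have key := hS.ci_encPair (L := fun x : J => L x.1.1) hE hm (fun _ => 0) (fun _ => 0)
      (fun x => bfEntry (B (L x.1.1)) (YG x.1.1) x.2.1) fun x => x.2.2.2
    have c1 := (FewWires.pi (PolyBounded.polyBdd ht) hV).reindex fun x : J => x.1.1
    have c2 := fewWires_tables (B := B) (L := fun x : J => L x.1.1) hh hm
    refine CI.average_sigma (α := O) _ (CI.average_sigma
      (N := fun x : Σ i, Fin (t (L i)) → V i => L x.1) (α := fun x => O x.1)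
      (fun x => tables (B (L x.1)) (YG x.1)) (X := fun x => (encPair (B (L x.1.1)) 0 0).map
        fun e => clientResult (B (L x.1.1)) x.2.1 e x.1.2) (Y := fun x =>
        (encPair (B (L x.1.1)) (bfEntry (B (L x.1.1)) (YG x.1.1) x.2.1) x.2.2.2).map
        fun e => clientResult (B (L x.1.1)) x.2.1 e x.1.2) (key.map ?_))
    refine DT.prodMk (DT.via (DT.prodMk (DT.const c2 fun x => x.2).fst (DT.prodMk DT.id.fst
      (DT.some (DT.prodMk DT.id.snd.fst (DT.prodMk DT.id.snd.snd ?_)))))) (DT.prodMk ?_ ?_)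
    · exact (DT.const c1 fun x => x.1.2).pi_fst
    · exact (DT.const c1 fun x => x.1.2).pi_snd.pi_fst.some
    · exact (DT.const c1 fun x => x.1.2).pi_snd.pi_snd.some
  -- Now seed, tables, keys and encryption tapes are fixed, and the simulated OT views are replaced
  -- by real ones, query by query.
  have s2 : CI L (fun i => p (L i)) (α := O)
      (fun i => (tables (B (L i)) (YG i)).bind fun T =>
        (unif (Bits (B (L i)).he.genLen)).bind fun gen =>
        (unif (Fin (m (L i)) → Bits (B (L i)).he.encLen)).bind fun ωB =>
        (unif (Fin (m (L i)) → Bits (B (L i)).he.encLen)).bind fun ωG =>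
        (indep (t (L i)) (Q i)).map (clientResult (B (L i)) T.1 (((B (L i)).he.keyGen gen).1,
          encTable (B (L i)) ((B (L i)).he.keyGen gen).1 (bfEntry (B (L i)) (YG i) T.1) ωB,
          encTable (B (L i)) ((B (L i)).he.keyGen gen).1 T.2.2 ωG)))
      fun i => (ssipIdeal (B (L i)) (XS i) (YG i) true).map fun e => (e.1, e.2.2.1, e.2.2.2) := by
    let S : I → Type := fun i => Tables (B (L i)) × Bits (B (L i)).he.genLen ×
      (Fin (m (L i)) → Bits (B (L i)).he.encLen) × (Fin (m (L i)) → Bits (B (L i)).he.encLen)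
    let P : ∀ i, PMF (S i) := fun i => (tables (B (L i)) (YG i)).bind fun T =>
      (unif (Bits (B (L i)).he.genLen)).bind fun gen =>
      (unif (Fin (m (L i)) → Bits (B (L i)).he.encLen)).bind fun ωB =>
      (unif (Fin (m (L i)) → Bits (B (L i)).he.encLen)).bind fun ωG => PMF.pure (T, gen, ωB, ωG)
    let e : ∀ x : Σ i, S i, E x.1 := fun x => (((B (L x.1)).he.keyGen x.2.2.1).1,
      encTable (B (L x.1)) ((B (L x.1)).he.keyGen x.2.2.1).1
        (bfEntry (B (L x.1)) (YG x.1) x.2.1.1) x.2.2.2.1,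
      encTable (B (L x.1)) ((B (L x.1)).he.keyGen x.2.2.1).1 x.2.1.2.2 x.2.2.2.2)
    have key := CI.indep_congr_sigma (N := fun x : Σ i, S i => L x.1) (α := fun x => V x.1) (q := fun x => p (L x.1))
      (n := fun x : Σ i, S i => t (L x.1)) (PolyBounded.polyBdd ht)
      (hV.reindex fun x : Σ i, S i => x.1)
      (ci_clientQuery (I := Σ x : Σ i, S i, Fin (t (L x.1))) (L := fun y => L y.1.1)
        hE hk hB hF h₁ h₂ h₃
        (fun y => (e y.1).1)
        (fun y a => (e y.1).2.1 (queryPos (B (L y.1.1)) (XS y.1.1) y.1.2.1.1 y.2 a))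
        (fun y a => (e y.1).2.2 (queryPos (B (L y.1.1)) (XS y.1.1) y.1.2.1.1 y.2 a))
        (fun y => (XS y.1.1 y.2).2)
        (fun y => bfSum (B (L y.1.1)) (XS y.1.1) (YG y.1.1) y.1.2.1.1 y.2)
        (fun y => gbfSum (B (L y.1.1)) (XS y.1.1) y.1.2.1.1 y.1.2.1.2.2 y.2)
        (fun y => ssipTarget (XS y.1.1) (YG y.1.1) y.2)
        (fun y => isMember (XS y.1.1) (YG y.1.1) y.2))
    have c1 := hEw.reindex fun x : Σ i, S i => x.1
    have c2 : FewWires (fun x : Σ i, S i => L x.1) (fun x => p (L x.1))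
      fun x => Bits (B (L x.1)).hf.seedLen := fewWires_bits (PolyBounded.polyBdd hh.1)
    have avg := CI.average_sigma (N := L) (q := fun i => p (L i)) (α := O) P (key.map
      (g := fun x res => clientResult (B (L x.1)) x.2.1.1 (e x) res)
      (DT.prodMk (DT.via (DT.prodMk (DT.const c2 fun x => x.2.1.1) (DT.prodMk
        (DT.const c1 e).fst (DT.some (DT.prodMk (DT.const c1 e).snd.fst (DT.prodMk
          (DT.const c1 e).snd.snd DT.id.pi_fst))))))
        (DT.prodMk DT.id.pi_snd.pi_fst.some DT.id.pi_snd.pi_snd.some)))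
    refine (CI.of_eq fun i => ?_).trans (avg.trans (CI.of_eq fun i => ?_))
    · simp only [P, PMF.bind_bind, PMF.pure_bind]
      rfl
    · rw [ssipIdeal_map_client]
      simp only [P, PMF.bind_bind, PMF.pure_bind]
      rfl
  refine (CI.of_eq fun i => ?_).trans (s1.trans ((CI.of_eq fun i => ?_).trans s2))
  · exact (clientSim_eq _ _ _ _ _ _).symm
  · rw [PMF.bind_comm]
    refine congrArg _ (funext fun T => ?_)
    simp only [encPair, PMF.map_bind, PMF.map_comp]
    rw [PMF.bind_comm]
    refine congrArg _ (funext fun gen => ?_)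
    rw [PMF.bind_comm]
    refine congrArg _ (funext fun ωB => ?_)
    exact PMF.bind_comm _ _ _

end

/- ## Function privacy -/

section

variable {p l k m : ℕ} [Fact p.Prime] (B : Blocks p l k m)

/-- The first ciphertext that the client sends for a query. -/
def lawν (pk : B.he.PK) (c : Fin k → B.he.CT) (μ : ZMod p) : PMF B.he.CT :=
  (unif (Bits (B.he.sumLen k))).bind fun ωsum => (unif (Bits B.he.encLen)).bind fun ωμ =>
  (unif (Bits (B.he.sumLen 2))).map fun ων => ctν B pk c μ ωsum ωμ ων

/-- The second ciphertext that the client sends for a query. -/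
def lawν' (pk : B.he.PK) (c : Fin k → B.he.CT) (s δ : ZMod p) : PMF B.he.CT :=
  (unif (Bits (B.he.sumLen k))).bind fun ωsum' => (unif (Bits B.he.encLen)).bind fun ωs =>
  (unif (Bits (B.he.mulLen 2))).bind fun ωmul => (unif (Bits B.he.encLen)).bind fun ωδ =>
  (unif (Bits (B.he.sumLen 2))).map fun ων' => ctν' B pk c s δ ωsum' ωs ωmul ωδ ων'

/-- The server sees the client's tapes only through the two ciphertexts. These use disjoint parts of
the tapes and are therefore independent. -/
theorem queryTapes_bind {β : Type} (pk : B.he.PK) (cB cG : Fin k → B.he.CT) (μ s δ : ZMod p)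
    (f : B.he.CT → B.he.CT → PMF β) :
    ((queryTapes B).bind fun τ => f (ctν B pk cB μ τ.1 τ.2.1 τ.2.2.1)
      (ctν' B pk cG s δ τ.2.2.2.1 τ.2.2.2.2.1 τ.2.2.2.2.2.1 τ.2.2.2.2.2.2.1 τ.2.2.2.2.2.2.2)) =
    (lawν B pk cB μ).bind fun ν => (lawν' B pk cG s δ).bind fun ν' => f ν ν' := by
  simp only [queryTapes, lawν, lawν', PMF.bind_bind, PMF.bind_map, PMF.pure_bind,
    Function.comp_def]

end

section

variable {p : ℕ → ℕ} [∀ κ, Fact (p κ).Prime] {H : ∀ κ, HEScheme (p κ)}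

theorem HEFunctionPrivacy.exists_sim (h : HEFunctionPrivacy p H) {m : ℕ → ℕ}
    (hm : PolyBounded m) :
    ∃ F : ∀ κ, (H κ).PK × ZMod (p κ) → PMF (H κ).CT, PolyTime p F ∧
      ∀ {I : Type} (L : I → ℕ) (x : ∀ i, Fin (m (L i)) → ZMod (p (L i)))
        (e : ∀ i, Formula (p (L i)) (Fin (m (L i)))) (b : ∀ i, ZMod (p (L i))),
        PolyBdd L (fun i => (e i).size) → (∀ i, (e i).degree ≤ 2) →
        CI L (fun i => p (L i)) (α := fun i => Bits (H (L i)).genLen ×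
            (Fin (m (L i)) → Bits (H (L i)).encLen) × (H (L i)).CT)
          (fun i => (H (L i)).evalGame (x i) (.sum 2 ![e i, .own (b i)]))
          fun i => (unif (Bits (H (L i)).genLen)).bind fun g =>
            (unif (Fin (m (L i)) → Bits (H (L i)).encLen)).bind fun ω =>
            (F (L i) (((H (L i)).keyGen g).1, (e i).value (x i) + b i)).map fun z => (g, ω, z) := by
  obtain ⟨F, hF, hsim⟩ := h
  refine ⟨F, hF, fun {I} L x e b ⟨P, hP⟩ hd => ?_⟩
  -- Formulas of bounded size become parameters. The summand 1 in the bound admits the one-node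
  -- formula, so that parameters exist even if `P` vanishes.
  let Z : ℕ → Type := fun κ => {w : (Fin (m κ) → ZMod (p κ)) × Formula (p κ) (Fin (m κ)) ×
    ZMod (p κ) // w.2.1.size ≤ (P + 1).eval κ ∧ w.2.1.degree ≤ 2}
  have hZ : ∀ κ, Nonempty (Z κ) := fun κ =>
    ⟨⟨(0, .own 0, 0), by simp [Formula.size], one_le_two⟩⟩
  have key := @CI.of_indist p _ (fun κ => Bits (H κ).genLen ×
      (Fin (m κ) → Bits (H κ).encLen) × (H κ).CT) _ Z hZ
    (fun κ z => (H κ).evalGame z.1.1 (.sum 2 ![z.1.2.1, .own z.1.2.2]))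
    (fun κ z => (unif (Bits (H κ).genLen)).bind fun g =>
      (unif (Fin (m κ) → Bits (H κ).encLen)).bind fun ω =>
      (F κ (((H κ).keyGen g).1, z.1.2.1.value z.1.1 + z.1.2.2)).map fun z => (g, ω, z))
  have key' := key fun z => hsim m (fun κ => (z κ).1.1) (fun κ => (z κ).1.2.1)
    (fun κ => (z κ).1.2.2) hm ⟨P + 1, fun κ => (z κ).2.1⟩ fun κ => (z κ).2.2
  exact key'.reindex fun i => ⟨L i, (x i, e i, b i), (hP i).trans (by simp), hd i⟩

end

section

variable {p l k m : ℕ → ℕ} [∀ κ, Fact (p κ).Prime] {B : ∀ κ, Blocks (p κ) (l κ) (k κ) (m κ)}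

/-- One simulator serves both ciphertexts of a query, since it uses only the public key and the
masked plaintext, not the formula. -/
theorem HEFunctionPrivacy.exists_sim_query (h : HEFunctionPrivacy p fun κ => (B κ).he)
    (hm : PolyBounded m) (hk : PolyBounded k) :
    ∃ F : ∀ κ, (B κ).he.PK × ZMod (p κ) → PMF (B κ).he.CT, PolyTime p F ∧
      ∀ {I : Type} (L : I → ℕ) (f : ∀ i, Fin (m (L i)) → ZMod (p (L i)))
        (pos : ∀ i, Fin (k (L i)) → Fin (m (L i))) (s μ : ∀ i, ZMod (p (L i))),
        CI L (fun i => p (L i)) (α := fun i => Bits (B (L i)).he.genLen ×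
            (Fin (m (L i)) → Bits (B (L i)).he.encLen) × (B (L i)).he.CT)
          (fun i => (unif (Bits (B (L i)).he.genLen)).bind fun g =>
            (unif (Fin (m (L i)) → Bits (B (L i)).he.encLen)).bind fun ω =>
            (lawν (B (L i)) ((B (L i)).he.keyGen g).1 (fun a =>
              encTable (B (L i)) ((B (L i)).he.keyGen g).1 (f i) ω (pos i a)) (μ i)).map
              fun z => (g, ω, z))
          (fun i => (unif (Bits (B (L i)).he.genLen)).bind fun g =>
            (unif (Fin (m (L i)) → Bits (B (L i)).he.encLen)).bind fun ω =>
            (F (L i) (((B (L i)).he.keyGen g).1, (∑ a, f i (pos i a)) - μ i)).map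
              fun z => (g, ω, z)) ∧
        CI L (fun i => p (L i)) (α := fun i => Bits (B (L i)).he.genLen ×
            (Fin (m (L i)) → Bits (B (L i)).he.encLen) × (B (L i)).he.CT)
          (fun i => (unif (Bits (B (L i)).he.genLen)).bind fun g =>
            (unif (Fin (m (L i)) → Bits (B (L i)).he.encLen)).bind fun ω =>
            (lawν' (B (L i)) ((B (L i)).he.keyGen g).1 (fun a =>
              encTable (B (L i)) ((B (L i)).he.keyGen g).1 (f i) ω (pos i a)) (s i) (μ i)).map
              fun z => (g, ω, z))
          (fun i => (unif (Bits (B (L i)).he.genLen)).bind fun g =>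
            (unif (Fin (m (L i)) → Bits (B (L i)).he.encLen)).bind fun ω =>
            (F (L i) (((B (L i)).he.keyGen g).1, s i * (∑ a, f i (pos i a)) - μ i)).map
              fun z => (g, ω, z)) := by
  obtain ⟨F, hF, hsim⟩ := h.exists_sim hm
  refine ⟨F, hF, fun {I} L f pos s μ => ⟨?_, ?_⟩⟩
  · have key := hsim L f (fun i => sumFormula (pos i)) (fun i => -μ i)
      (by
        simp only [size_sumFormula]
        exact (polyBdd_const 1).add (PolyBounded.polyBdd hk))
      fun i => (degree_sumFormula _).trans one_le_two
    refine (CI.of_eq fun i => ?_).trans (key.trans (CI.of_eq fun i => ?_))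
    · change _ = (unif _).bind fun g => (unif _).bind fun ω => (HEScheme.evalFormula _ _ _ _).bind
        fun z => PMF.pure (g, ω, z)
      simp only [lawν, evalFormula_ν]
      rfl
    · simp only [value_sumFormula, sub_eq_add_neg]
  · have key := hsim L f (fun i => mulSumFormula (pos i) (s i)) (fun i => -μ i)
      (by
        simp only [size_mulSumFormula]
        exact (polyBdd_const 3).add (PolyBounded.polyBdd hk))
      fun i => degree_mulSumFormula _ _
    refine (CI.of_eq fun i => ?_).trans (key.trans (CI.of_eq fun i => ?_))
    · change _ = (unif _).bind fun g => (unif _).bind fun ω => (HEScheme.evalFormula _ _ _ _).bind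
        fun z => PMF.pure (g, ω, z)
      simp only [lawν', evalFormula_ν']
      rfl
    · simp only [value_mulSumFormula, sub_eq_add_neg]

variable {I : Type} {L : I → ℕ} {α : I → Type} [∀ i, Data (p (L i)) (α i)]

theorem DT.vec_two {N q : I → ℕ} [∀ i, Fact (q i).Prime] {α β : I → Type}
    [∀ i, Data (q i) (α i)] [∀ i, Data (q i) (β i)] {f g : ∀ i, α i → β i} (hf : DT N q f)
    (hg : DT N q g) : DT N q (β := fun i => Fin 2 → β i) fun i a => ![f i a, g i a] := by
  refine DT.comp (f := fun i (x : β i × β i) => ![x.1, x.2]) (DT.of_wiring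
    (fun i (o : Fin 2 × Data.Idx (q i) (β i)) => if o.1 = 0 then Sum.inl o.2 else Sum.inr o.2) ?_)
    (hf.prodMk hg)
  rintro i ⟨a, b⟩ ⟨j, o⟩
  fin_cases j <;> rfl

theorem polyBounded_const (c : ℕ) : PolyBounded fun _ => c := ⟨Polynomial.C c, by simp⟩

theorem HEEfficient.pt_lawν (h : HEEfficient p fun κ => (B κ).he) (hk : PolyBounded k)
    {pk : ∀ i, α i → (B (L i)).he.PK} {c : ∀ i, α i → Fin (k (L i)) → (B (L i)).he.CT}
    (hpk : DT L (fun i => p (L i)) pk) (hc : DT L (fun i => p (L i)) c)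
    (μ : ∀ i, ZMod (p (L i))) :
    PT L (fun i => p (L i)) fun i x => lawν (B (L i)) (pk i x) (c i x) (μ i) := by
  have hs := (h.2.2.2.2.2.2.2.2 k hk).1
  have hs2 := (h.2.2.2.2.2.2.2.2 (fun _ => 2) (polyBounded_const 2)).1
  let β : I → Type := fun i => ((α i × Bits ((B (L i)).he.sumLen (k (L i)))) ×
    Bits (B (L i)).he.encLen) × Bits ((B (L i)).he.sumLen 2)
  have hx : DT L (fun i => p (L i)) (α := β) (β := α) fun i x => x.1.1.1 := DT.id.fst.fst.fst
  refine PT.bind (f := fun (i : I) _ => unif (Bits ((B (L i)).he.sumLen (k (L i)))))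
    (PT.unif_bits (PolyBounded.polyBdd (N := L) hs)) (PT.bind
    (f := fun (i : I) _ => unif (Bits (B (L i)).he.encLen))
    (PT.unif_bits (PolyBounded.polyBdd (N := L) h.2.2.2.2.1)) (PT.bind
    (f := fun (i : I) _ => unif (Bits ((B (L i)).he.sumLen 2)))
    (PT.unif_bits (PolyBounded.polyBdd (N := L) hs2)) ?_))
  exact h.dt_evalSum (r := fun _ => 2) (polyBounded_const 2) (hpk.comp hx) (DT.vec_two
    (h.dt_evalSum hk (hpk.comp hx) (hc.comp hx) DT.id.fst.fst.snd)
    (h.dt_enc (hpk.comp hx) (DT.constF fun i => -μ i) DT.id.fst.snd)) DT.id.snd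

theorem HEEfficient.pt_lawν' (h : HEEfficient p fun κ => (B κ).he) (hk : PolyBounded k)
    {pk : ∀ i, α i → (B (L i)).he.PK} {c : ∀ i, α i → Fin (k (L i)) → (B (L i)).he.CT}
    (hpk : DT L (fun i => p (L i)) pk) (hc : DT L (fun i => p (L i)) c)
    (s δ : ∀ i, ZMod (p (L i))) :
    PT L (fun i => p (L i)) fun i x => lawν' (B (L i)) (pk i x) (c i x) (s i) (δ i) := by
  have hs := (h.2.2.2.2.2.2.2.2 k hk).1
  have hs2 := (h.2.2.2.2.2.2.2.2 (fun _ => 2) (polyBounded_const 2)).1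
  have hm2 := (h.2.2.2.2.2.2.2.2 (fun _ => 2) (polyBounded_const 2)).2.1
  let β : I → Type := fun i => ((((α i × Bits ((B (L i)).he.sumLen (k (L i)))) ×
    Bits (B (L i)).he.encLen) × Bits ((B (L i)).he.mulLen 2)) × Bits (B (L i)).he.encLen) ×
    Bits ((B (L i)).he.sumLen 2)
  have hx : DT L (fun i => p (L i)) (α := β) (β := α) fun i x => x.1.1.1.1.1 :=
    DT.id.fst.fst.fst.fst.fst
  refine PT.bind (f := fun (i : I) _ => unif (Bits ((B (L i)).he.sumLen (k (L i)))))
    (PT.unif_bits (PolyBounded.polyBdd (N := L) hs)) (PT.bind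
    (f := fun (i : I) _ => unif (Bits (B (L i)).he.encLen))
    (PT.unif_bits (PolyBounded.polyBdd (N := L) h.2.2.2.2.1)) (PT.bind
    (f := fun (i : I) _ => unif (Bits ((B (L i)).he.mulLen 2)))
    (PT.unif_bits (PolyBounded.polyBdd (N := L) hm2)) (PT.bind
    (f := fun (i : I) _ => unif (Bits (B (L i)).he.encLen))
    (PT.unif_bits (PolyBounded.polyBdd (N := L) h.2.2.2.2.1)) (PT.bind
    (f := fun (i : I) _ => unif (Bits ((B (L i)).he.sumLen 2)))
    (PT.unif_bits (PolyBounded.polyBdd (N := L) hs2)) ?_))))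
  exact h.dt_evalSum (r := fun _ => 2) (polyBounded_const 2) (hpk.comp hx) (DT.vec_two
    (h.dt_evalMul (r := fun _ => 2) (polyBounded_const 2) (hpk.comp hx) (DT.vec_two
      (h.dt_enc (hpk.comp hx) (DT.constF s) DT.id.fst.fst.fst.snd)
      (h.dt_evalSum hk (hpk.comp hx) (hc.comp hx) DT.id.fst.fst.fst.fst.snd)) DT.id.fst.fst.snd)
    (h.dt_enc (hpk.comp hx) (DT.constF fun i => -δ i) DT.id.fst.snd)) DT.id.snd

end

/- ## Simulation of the server -/

section

variable {p l k m t n : ℕ} [Fact p.Prime] (B : Blocks p l k m)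

/-- The random choices and the views of the oblivious transfers of one query. -/
abbrev QueryAux : Type := Scalars p × B.otB.View₀ × B.otF.View₁ × B.otF.View₀

/-- The views of the oblivious transfers of one query are simulated for the server. -/
def queryAux (S₁ : (Fin (k + 1) → Bool) × Unit → PMF B.otB.View₀)
    (R₂ : Fin 2 × ZMod p → PMF B.otF.View₁) (S₃ : (Fin 2 → ZMod p) × Unit → PMF B.otF.View₀)
    (s C G : ZMod p) (pass : Bool) : PMF (QueryAux B) :=
  (scalars p).bind fun σ => (S₁ (senderBits k σ.b (C - σ.μ), ())).bind fun v₁ =>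
  (R₂ (choice σ.b, σ.Δ + bitF p pass * σ.δ)).bind fun v₂ =>
  (S₃ (serverValues σ.b (σ.Δ + bitF p pass * σ.δ) (s * G - σ.δ) σ.α, ())).map fun v₃ =>
    (σ, v₁, v₂, v₃)

theorem bind_rotate_three {α β γ δ ε : Type} (P : PMF α) (Q : PMF β) (R : PMF γ) (S : PMF δ)
    (f : α → β → γ → δ → PMF ε) :
    (P.bind fun a => Q.bind fun b => R.bind fun c => S.bind fun d => f a b c d) =
      S.bind fun d => P.bind fun a => Q.bind fun b => R.bind fun c => f a b c d := by
  rw [PMF.bind_comm S P]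
  refine congrArg _ (funext fun a => ?_)
  rw [PMF.bind_comm S Q]
  exact congrArg _ (funext fun b => PMF.bind_comm _ _ _)

/-- The server's view of one query, and the shares. -/
def serverQueryResult (u : ZMod p) (a : QueryAux B) (z : B.he.CT × B.he.CT) :
    ServerQueryView B × ZMod p × ZMod p :=
  ({ b := a.1.b, α := a.1.α, ν := z.1, ν' := z.2, ot₁ := a.2.1, ot₂ := a.2.2.1, ot₃ := a.2.2.2 },
    u - a.1.α, a.1.α)

/-- Simulation of the server's view of one query from its share. -/
def serverQuerySim (S₁ : (Fin (k + 1) → Bool) × Unit → PMF B.otB.View₀)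
    (R₂ : Fin 2 × ZMod p → PMF B.otF.View₁) (S₃ : (Fin 2 → ZMod p) × Unit → PMF B.otF.View₀)
    (F : B.he.PK × ZMod p → PMF B.he.CT) (pk : B.he.PK) (α : ZMod p) : PMF (ServerQueryView B) :=
  (unif (ZMod p)).bind fun x => (unif Bool).bind fun b => (unif (ZMod p)).bind fun ρ =>
  (unif (ZMod p)).bind fun r => (S₁ (senderBits k b x, ())).bind fun v₁ =>
  (R₂ (choice b, r)).bind fun v₂ => (S₃ (serverValues b r ρ α, ())).bind fun v₃ =>
  (F (pk, x)).bind fun ν => (F (pk, ρ)).map fun ν' =>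
    { b := b, α := α, ν := ν, ν' := ν', ot₁ := v₁, ot₂ := v₂, ot₃ := v₃ }

/-- Three bijective substitutions turn the masks into what the server sees: μ into C - μ, then δ
into s·G - δ, and, with δ fixed, Δ into Δ + pass·δ. Thus the view depends on the client's data only
through its own share. -/
theorem serverQuerySim_eq (S₁ : (Fin (k + 1) → Bool) × Unit → PMF B.otB.View₀)
    (R₂ : Fin 2 × ZMod p → PMF B.otF.View₁) (S₃ : (Fin 2 → ZMod p) × Unit → PMF B.otF.View₀)
    (F : B.he.PK × ZMod p → PMF B.he.CT) (pk : B.he.PK) (s C G u : ZMod p) (pass : Bool) :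
    ((queryAux B S₁ R₂ S₃ s C G pass).bind fun a => (F (pk, C - a.1.μ)).bind fun ν =>
      (F (pk, s * G - a.1.δ)).map fun ν' => serverQueryResult B u a (ν, ν')) =
    (unif (ZMod p)).bind fun α =>
      (serverQuerySim B S₁ R₂ S₃ F pk α).map fun v => (v, u - α, α) := by
  simp only [queryAux, serverQuerySim, scalars, PMF.bind_bind, PMF.pure_bind, PMF.map_bind,
    PMF.map_comp, PMF.bind_map, Function.comp_def,
    Scalars.μ, Scalars.b, Scalars.δ, Scalars.Δ, Scalars.α, serverQueryResult]
  conv_rhs => rw [PMF.bind_comm (unif (ZMod p)) (unif (ZMod p)) fun α μ => _]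
  refine Eq.trans ?_ (unif_bind_equiv (Equiv.subLeft C) _)
  refine congrArg _ (funext fun μ => ?_)
  conv_rhs => rw [PMF.bind_comm (unif (ZMod p)) (unif Bool) fun α b => _]
  refine congrArg _ (funext fun b => ?_)
  conv_rhs => rw [PMF.bind_comm (unif (ZMod p)) (unif (ZMod p)) fun α δ => _]
  refine Eq.trans ?_ (unif_bind_equiv (Equiv.subLeft (s * G)) _)
  refine congrArg _ (funext fun δ => ?_)
  conv_rhs => rw [PMF.bind_comm (unif (ZMod p)) (unif (ZMod p)) fun α Δ => _]
  refine Eq.trans ?_ (unif_bind_equiv (Equiv.addRight (bitF p pass * δ)) _)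
  rfl

end

section

variable {p l k m : ℕ → ℕ} [∀ κ, Fact (p κ).Prime] {B : ∀ κ, Blocks (p κ) (l κ) (k κ) (m κ)}
  {I : Type} {L : I → ℕ}

theorem dt_serverQueryResult {α : I → Type} [∀ i, Data (p (L i)) (α i)]
    {a : ∀ i, α i → QueryAux (B (L i))} {z : ∀ i, α i → (B (L i)).he.CT × (B (L i)).he.CT}
    (u : ∀ i, ZMod (p (L i))) (ha : DT L (fun i => p (L i)) a) (hz : DT L (fun i => p (L i)) z) :
    DT L (fun i => p (L i))
      (β := fun i => ServerQueryView (B (L i)) × ZMod (p (L i)) × ZMod (p (L i)))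
      fun i x => serverQueryResult (B (L i)) (u i) (a i x) (z i x) := by
  have hα := ha.fst.snd.snd.snd.snd
  refine DT.prodMk (DT.via ?_) (DT.prodMk ((DT.constF u).sub hα) hα)
  exact ha.fst.snd.fst.prodMk (hα.prodMk (hz.fst.prodMk (hz.snd.prodMk (ha.snd.fst.prodMk
    (ha.snd.snd.fst.prodMk ha.snd.snd.snd)))))

theorem fewWires_serverQueryView (hE : HEEfficient p fun κ => (B κ).he)
    (hB : TwoParty.Efficient p fun κ => (B κ).otB) (hF : TwoParty.Efficient p fun κ => (B κ).otF) :
    FewWires L (fun i => p (L i)) fun i => ServerQueryView (B (L i)) := by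
  have hz : FewWires L (fun i => p (L i)) fun i => ZMod (p (L i)) := fewWires_zmod
  have hb : FewWires L (fun i => p (L i)) fun i => Bool := fewWires_bool
  exact hb.prod (hz.prod ((fewWires_ct hE).prod ((fewWires_ct hE).prod ((hB.fewWires₀ L).prod
    ((hF.fewWires₁ L).prod (hF.fewWires₀ L))))))

theorem fewWires_queryAux (hB : TwoParty.Efficient p fun κ => (B κ).otB)
    (hF : TwoParty.Efficient p fun κ => (B κ).otF) :
    FewWires L (fun i => p (L i)) fun i => QueryAux (B (L i)) :=
  (fewWires_scalars (L := L)).prod ((hB.fewWires₀ L).prod ((hF.fewWires₁ L).prod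
    (hF.fewWires₀ L)))

/-- The server's view of one query, and the shares. -/
theorem ci_serverQuery (hE : HEEfficient p fun κ => (B κ).he)
    (hB : TwoParty.Efficient p fun κ => (B κ).otB) (hF : TwoParty.Efficient p fun κ => (B κ).otF)
    {S₁ : ∀ κ, (Fin (k κ + 1) → Bool) × Unit → PMF (B κ).otB.View₀}
    {R₂ : ∀ κ, Fin 2 × ZMod (p κ) → PMF (B κ).otF.View₁}
    {S₃ : ∀ κ, (Fin 2 → ZMod (p κ)) × Unit → PMF (B κ).otF.View₀}
    (h₁ : ∀ {I : Type} (L : I → ℕ) (a : ∀ i, Fin (k (L i) + 1) → Bool)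
      (c : ∀ i, Fin (k (L i) + 1)), CI L (fun i => p (L i)) (fun i => S₁ (L i) (a i, ()))
        fun i => ((B (L i)).otB.exec (a i) (c i)).map fun e => e.1)
    (h₂ : ∀ {I : Type} (L : I → ℕ) (a : ∀ i, Fin 2 → ZMod (p (L i))) (c : I → Fin 2),
      CI L (fun i => p (L i)) (fun i => R₂ (L i) (c i, a i (c i)))
        fun i => ((B (L i)).otF.exec (a i) (c i)).map fun e => e.2.1)
    (h₃ : ∀ {I : Type} (L : I → ℕ) (a : ∀ i, Fin 2 → ZMod (p (L i))) (c : I → Fin 2),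
      CI L (fun i => p (L i)) (fun i => S₃ (L i) (a i, ()))
        fun i => ((B (L i)).otF.exec (a i) (c i)).map fun e => e.1)
    (pk : ∀ i, (B (L i)).he.PK) (cB cG : ∀ i, Fin (k (L i)) → (B (L i)).he.CT)
    (s C G u : ∀ i, ZMod (p (L i))) (pass : I → Bool) :
    CI L (fun i => p (L i))
      (α := fun i => ServerQueryView (B (L i)) × ZMod (p (L i)) × ZMod (p (L i)))
      (fun i => (queryAux (B (L i)) (S₁ (L i)) (R₂ (L i)) (S₃ (L i)) (s i) (C i) (G i)
        (pass i)).bind fun a => (lawν (B (L i)) (pk i) (cB i) a.1.μ).bind fun ν =>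
        (lawν' (B (L i)) (pk i) (cG i) (s i) a.1.δ).map fun ν' =>
          serverQueryResult (B (L i)) (u i) a (ν, ν'))
      fun i => (onlineIdeal (B (L i)) false (pk i) (cB i) (cG i) (s i) (C i) (G i) (u i)
        (pass i)).map fun e => (e.2.1, e.2.2.1, e.2.2.2) := by
  -- In the ideal phase the OT inputs depend on the intended plaintexts instead of the ciphertexts,
  -- so the ciphertexts can be drawn first and fixed.
  let P : ∀ i, PMF (Scalars (p (L i)) × (B (L i)).he.CT × (B (L i)).he.CT) := fun i =>
    (scalars (p (L i))).bind fun σ => (lawν (B (L i)) (pk i) (cB i) σ.μ).bind fun ν =>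
      (lawν' (B (L i)) (pk i) (cG i) (s i) σ.δ).map fun ν' => (σ, ν, ν')
  let J : Type := Σ i, Scalars (p (L i)) × (B (L i)).he.CT × (B (L i)).he.CT
  let L' : J → ℕ := fun x => L x.1
  have w₁ := hB.fewWires₀ L'
  have w₂ := hF.fewWires₁ L'
  have w₃ := hF.fewWires₀ L'
  let a₁ : ∀ x : J, Fin (k (L' x) + 1) → Bool := fun x =>
    senderBits (k (L' x)) x.2.1.b (C x.1 - x.2.1.μ)
  let a₂ : ∀ x : J, Fin 2 → ZMod (p (L' x)) := fun x =>
    clientValues (xor x.2.1.b (pass x.1)) x.2.1.δ x.2.1.Δ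
  let a₃ : ∀ x : J, Fin 2 → ZMod (p (L' x)) := fun x =>
    serverValues x.2.1.b (x.2.1.Δ + bitF (p (L' x)) (pass x.1) * x.2.1.δ)
      (s x.1 * G x.1 - x.2.1.δ) x.2.1.α
  have k₁ := h₁ L' a₁ fun x => modIdx (k (L' x)) x.2.1.μ.valMinAbs
  have k₂ := h₂ L' a₂ fun x => choice x.2.1.b
  have k₃ := h₃ L' a₃ fun x => choice (xor x.2.1.b (pass x.1))
  have key := CI.prod w₁ (w₂.prod w₃) k₁ (CI.prod w₂ w₃ k₂ k₃)
  have c1 := DT.const (α := fun x : J => (B (L' x)).otB.View₀ × (B (L' x)).otF.View₁ ×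
    (B (L' x)).otF.View₀) ((fewWires_scalars (L := L')).prod ((fewWires_ct (B := B) hE).prod
      (fewWires_ct hE))) fun x => x.2
  have key' := key.map (β := fun x => ServerQueryView (B (L' x)) × ZMod (p (L' x)) × ZMod (p (L' x)))
    (g := fun x v => serverQueryResult (B (L' x)) (u x.1) (x.2.1, v) x.2.2)
    (dt_serverQueryResult (L := L') (fun x => u x.1) (c1.fst.prodMk DT.id) c1.snd)
  have avg := CI.average_sigma (N := L) (q := fun i => p (L i))
    (α := fun i => ServerQueryView (B (L i)) × ZMod (p (L i)) × ZMod (p (L i))) P key'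
  refine (CI.of_eq fun i => ?_).trans (avg.trans (CI.of_eq fun i => ?_))
  · simp only [P, queryAux, a₁, a₂, a₃, clientValues_choice, PMF.map_bind, PMF.map_comp,
      PMF.bind_bind, PMF.bind_map, Function.comp_def]
    refine congrArg _ (funext fun σ => ?_)
    rw [bind_rotate_three]
    refine congrArg _ (funext fun ν => ?_)
    exact bind_rotate_three _ _ _ _ fun v₁ v₂ v₃ ν' =>
      PMF.pure (serverQueryResult (B (L i)) (u i) (σ, v₁, v₂, v₃) (ν, ν'))
  · rw [onlineIdeal_eq]
    simp only [P, a₁, a₂, a₃, PMF.map_bind, PMF.map_comp, PMF.bind_map, PMF.pure_map,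
      PMF.bind_bind, Function.comp_def, if_false, Bool.false_eq_true]
    refine congrArg _ (funext fun σ => ?_)
    refine Eq.trans (queryTapes_bind _ _ _ _ _ _ _ _).symm ?_
    rfl

end

/-! ### The server's whole view -/

section

variable {p l k m t n : ℕ} [Fact p.Prime] (B : Blocks p l k m)

/-- The random tapes for the generation of keys and for the encryption of the two tables. -/
abbrev EncTapes : Type :=
  Bits B.he.genLen × (Fin m → Bits B.he.encLen) × (Fin m → Bits B.he.encLen)

def encTapes : PMF (EncTapes B) :=
  (unif (Bits B.he.genLen)).bind fun gen => (unif (Fin m → Bits B.he.encLen)).bind fun ωB =>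
  (unif (Fin m → Bits B.he.encLen)).map fun ωG => (gen, ωB, ωG)

/-- The public key. -/
def EncTapes.pk {B : Blocks p l k m} (c : EncTapes B) : B.he.PK := (B.he.keyGen c.1).1

/-- The server's view and the outputs of both parties. -/
def serverResult (T : Tables B) (c : EncTapes B)
    (res : Fin t → ServerQueryView B × ZMod p × ZMod p) :
    ServerView B t × Option (Fin t → ZMod p) × Option (Fin t → ZMod p) :=
  ({ seed := T.1, gen := c.1, table := T.2.1,
     rest := some (T.2.2, c.2.1, c.2.2, fun j => (res j).1) },
    some fun j => (res j).2.1, some fun j => (res j).2.2)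

/-- Simulation of the server's view. -/
def serverSim (S₁ : (Fin (k + 1) → Bool) × Unit → PMF B.otB.View₀)
    (R₂ : Fin 2 × ZMod p → PMF B.otF.View₁) (S₃ : (Fin 2 → ZMod p) × Unit → PMF B.otF.View₀)
    (F : B.he.PK × ZMod p → PMF B.he.CT) (YG : Fin n → Bits l × ZMod p)
    (w : Option (Fin t → ZMod p)) : PMF (ServerView B t) :=
  (tables B YG).bind fun T => (encTapes B).bind fun c =>
  (indep t fun j => serverQuerySim B S₁ R₂ S₃ F c.pk (w.getD 0 j)).map fun v =>
    { seed := T.1, gen := c.1, table := T.2.1, rest := some (T.2.2, c.2.1, c.2.2, v) }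

variable (XS : Fin t → Bits l × ZMod p) (YG : Fin n → Bits l × ZMod p)

theorem bind_swap_pairs {α β γ δ ε : Type} (P : PMF α) (Q : PMF β) (R : PMF γ) (S : γ → PMF δ)
    (f : α → β → γ → δ → PMF ε) :
    (P.bind fun a => Q.bind fun b => R.bind fun c => (S c).bind fun d => f a b c d) =
      R.bind fun c => (S c).bind fun d => P.bind fun a => Q.bind fun b => f a b c d := by
  rw [show (R.bind fun c => (S c).bind fun d => P.bind fun a => Q.bind fun b => f a b c d) =
      R.bind fun c => P.bind fun a => Q.bind fun b => (S c).bind fun d => f a b c d from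
    congrArg _ (funext fun c => (PMF.bind_comm _ _ _).trans
      (congrArg _ (funext fun a => PMF.bind_comm _ _ _))), PMF.bind_comm R P]
  exact congrArg _ (funext fun a => PMF.bind_comm _ _ _)

theorem ssipIdeal_map_server : (ssipIdeal B XS YG false).map (fun e => (e.2.1, e.2.2.1, e.2.2.2)) =
    (tables B YG).bind fun T => (encTapes B).bind fun c =>
    (indep t fun j => (onlineIdeal B false c.pk
      (fun a => encTable B c.pk (bfEntry B YG T.1) c.2.1 (queryPos B XS T.1 j a))
      (fun a => encTable B c.pk T.2.2 c.2.2 (queryPos B XS T.1 j a))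
      (XS j).2 (bfSum B XS YG T.1 j) (gbfSum B XS T.1 T.2.2 j) (ssipTarget XS YG j)
      (isMember XS YG j)).map fun e => (e.2.1, e.2.2.1, e.2.2.2)).map (serverResult B T c) := by
  simp only [ssipIdeal, tables, encTapes, PMF.map_bind, PMF.bind_bind, PMF.bind_map, indep_map,
    PMF.map_comp, PMF.pure_map, Function.comp_def]
  rfl

/-- The shares α, drawn query by query, are collected in the uniform vector `r`; tables and tapes
are independent of it and change places with it. -/
theorem serverSim_eq (S₁ : (Fin (k + 1) → Bool) × Unit → PMF B.otB.View₀)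
    (R₂ : Fin 2 × ZMod p → PMF B.otF.View₁) (S₃ : (Fin 2 → ZMod p) × Unit → PMF B.otF.View₀)
    (F : B.he.PK × ZMod p → PMF B.he.CT) (u : Fin t → ZMod p) :
    ((tables B YG).bind fun T => (encTapes B).bind fun c =>
      (indep t fun j => (unif (ZMod p)).bind fun α =>
        (serverQuerySim B S₁ R₂ S₃ F c.pk α).map fun v => (v, u j - α, α)).map
          (serverResult B T c)) =
    (unif (Fin t → ZMod p)).bind fun r =>
      (serverSim B S₁ R₂ S₃ F YG (some r)).map fun v => (v, some (u - r), some r) := by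
  simp only [serverSim, PMF.map_bind, PMF.map_comp]
  rw [PMF.bind_comm (unif (Fin t → ZMod p))]
  refine congrArg _ (funext fun T => ?_)
  rw [PMF.bind_comm (unif (Fin t → ZMod p))]
  refine congrArg _ (funext fun c => ?_)
  rw [indep_bind, ← unif_fin]
  simp only [indep_map, PMF.map_bind, PMF.map_comp]
  rfl

/-- The two ciphertexts that the client sends for a query. -/
def lawPair (f g : Fin m → ZMod p) (pos : Fin k → Fin m) (s μ δ : ZMod p) (c : EncTapes B) :
    PMF (B.he.CT × B.he.CT) :=
  (lawν B c.pk (fun a => encTable B c.pk f c.2.1 (pos a)) μ).bind fun ν =>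
  (lawν' B c.pk (fun a => encTable B c.pk g c.2.2 (pos a)) s δ).map fun ν' => (ν, ν')

def simPair (F : B.he.PK × ZMod p → PMF B.he.CT) (x ρ : ZMod p) (c : EncTapes B) :
    PMF (B.he.CT × B.he.CT) :=
  (F (c.pk, x)).bind fun ν => (F (c.pk, ρ)).map fun ν' => (ν, ν')

end

/-! ### Function privacy for both ciphertexts of a query -/

section

variable {p l k m n t : ℕ → ℕ} [∀ κ, Fact (p κ).Prime] {B : ∀ κ, Blocks (p κ) (l κ) (k κ) (m κ)}
  {I : Type} {L : I → ℕ}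

theorem HEEfficient.dt_encTable_comp (h : HEEfficient p fun κ => (B κ).he) (hk : PolyBounded k)
    {α : I → Type} [∀ i, Data (p (L i)) (α i)]
    {pk : ∀ i, α i → (B (L i)).he.PK} {ω : ∀ i, α i → Fin (m (L i)) → Bits (B (L i)).he.encLen}
    (hpk : DT L (fun i => p (L i)) pk) (hω : DT L (fun i => p (L i)) ω)
    (f : ∀ i, Fin (m (L i)) → ZMod (p (L i))) (pos : ∀ i, Fin (k (L i)) → Fin (m (L i))) :
    DT L (fun i => p (L i)) fun i x a =>
      encTable (B (L i)) (pk i x) (f i) (ω i x) (pos i a) :=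
  DT.pi (PolyBounded.polyBdd hk) (h.dt_enc (I := Σ i, Fin (k (L i))) (L := fun x => L x.1)
    (hpk.reindex fun x : Σ i, Fin (k (L i)) => x.1)
    (DT.constF fun x : Σ i, Fin (k (L i)) => f x.1 (pos x.1 x.2))
    ((hω.reindex fun x : Σ i, Fin (k (L i)) => x.1).eval fun x => pos x.1 x.2))

theorem HEEfficient.dt_encTapes_pk (h : HEEfficient p fun κ => (B κ).he) {α : I → Type}
    [∀ i, Data (p (L i)) (α i)] {c : ∀ i, α i → EncTapes (B (L i))}
    (hc : DT L (fun i => p (L i)) c) : DT L (fun i => p (L i)) fun i x => (c i x).pk :=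
  h.dt_pk hc.fst

theorem HEEfficient.pt_simPair (h : HEEfficient p fun κ => (B κ).he)
    {F : ∀ κ, (B κ).he.PK × ZMod (p κ) → PMF (B κ).he.CT} (hF : PolyTime p F)
    (x ρ : ∀ i, ZMod (p (L i))) :
    PT L (fun i => p (L i)) fun i c => simPair (B (L i)) (F (L i)) (x i) (ρ i) c :=
  PT.bind ((hF.pt L).comp (DT.prodMk (h.dt_encTapes_pk DT.id) (DT.constF x)))
    (PT.bind (f := fun i (y : EncTapes (B (L i)) × (B (L i)).he.CT) => F (L i) (y.1.pk, ρ i))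
      ((hF.pt L).comp (DT.prodMk (h.dt_encTapes_pk DT.id.fst) (DT.constF ρ)))
      (DT.prodMk DT.id.fst.snd DT.id.snd))

theorem HEEfficient.pt_lawPair (h : HEEfficient p fun κ => (B κ).he) (hk : PolyBounded k)
    (f g : ∀ i, Fin (m (L i)) → ZMod (p (L i))) (pos : ∀ i, Fin (k (L i)) → Fin (m (L i)))
    (s μ δ : ∀ i, ZMod (p (L i))) :
    PT L (fun i => p (L i)) fun i c =>
      lawPair (B (L i)) (f i) (g i) (pos i) (s i) (μ i) (δ i) c := by
  have w : DT L (fun i => p (L i))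
      (α := fun i => EncTapes (B (L i)) × (B (L i)).he.CT) fun i y => y.1 := DT.id.fst
  exact PT.bind (h.pt_lawν hk (h.dt_encTapes_pk DT.id)
      (h.dt_encTable_comp hk (h.dt_encTapes_pk DT.id) DT.id.snd.fst f pos) μ)
    (PT.bind (f := fun i (y : EncTapes (B (L i)) × (B (L i)).he.CT) =>
        lawν' (B (L i)) y.1.pk
          (fun a => encTable (B (L i)) y.1.pk (g i) y.1.2.2 (pos i a)) (s i) (δ i))
      (h.pt_lawν' hk (h.dt_encTapes_pk w)
        (h.dt_encTable_comp hk (h.dt_encTapes_pk w) w.snd.snd g pos) s δ)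
      (DT.prodMk DT.id.fst.snd DT.id.snd))

/-- Both ciphertexts of a query can be simulated from their plaintexts. -/
theorem ci_lawPair (hE : HEEfficient p fun κ => (B κ).he) (hk : PolyBounded k)
    (hm : PolyBounded m) {F : ∀ κ, (B κ).he.PK × ZMod (p κ) → PMF (B κ).he.CT}
    (hF : PolyTime p F)
    (hν : ∀ {I : Type} (L : I → ℕ) (f : ∀ i, Fin (m (L i)) → ZMod (p (L i)))
        (pos : ∀ i, Fin (k (L i)) → Fin (m (L i))) (s μ : ∀ i, ZMod (p (L i))),
        CI L (fun i => p (L i)) (α := fun i => Bits (B (L i)).he.genLen ×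
            (Fin (m (L i)) → Bits (B (L i)).he.encLen) × (B (L i)).he.CT)
          (fun i => (unif (Bits (B (L i)).he.genLen)).bind fun g =>
            (unif (Fin (m (L i)) → Bits (B (L i)).he.encLen)).bind fun ω =>
            (lawν (B (L i)) ((B (L i)).he.keyGen g).1 (fun a =>
              encTable (B (L i)) ((B (L i)).he.keyGen g).1 (f i) ω (pos i a)) (μ i)).map
              fun z => (g, ω, z))
          (fun i => (unif (Bits (B (L i)).he.genLen)).bind fun g =>
            (unif (Fin (m (L i)) → Bits (B (L i)).he.encLen)).bind fun ω =>
            (F (L i) (((B (L i)).he.keyGen g).1, (∑ a, f i (pos i a)) - μ i)).map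
              fun z => (g, ω, z)) ∧
        CI L (fun i => p (L i)) (α := fun i => Bits (B (L i)).he.genLen ×
            (Fin (m (L i)) → Bits (B (L i)).he.encLen) × (B (L i)).he.CT)
          (fun i => (unif (Bits (B (L i)).he.genLen)).bind fun g =>
            (unif (Fin (m (L i)) → Bits (B (L i)).he.encLen)).bind fun ω =>
            (lawν' (B (L i)) ((B (L i)).he.keyGen g).1 (fun a =>
              encTable (B (L i)) ((B (L i)).he.keyGen g).1 (f i) ω (pos i a)) (s i) (μ i)).map
              fun z => (g, ω, z))
          (fun i => (unif (Bits (B (L i)).he.genLen)).bind fun g =>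
            (unif (Fin (m (L i)) → Bits (B (L i)).he.encLen)).bind fun ω =>
            (F (L i) (((B (L i)).he.keyGen g).1, s i * (∑ a, f i (pos i a)) - μ i)).map
              fun z => (g, ω, z)))
    (f g : ∀ i, Fin (m (L i)) → ZMod (p (L i))) (pos : ∀ i, Fin (k (L i)) → Fin (m (L i)))
    (s μ δ : ∀ i, ZMod (p (L i))) :
    CI L (fun i => p (L i))
      (α := fun i => EncTapes (B (L i)) × (B (L i)).he.CT × (B (L i)).he.CT)
      (fun i => (encTapes (B (L i))).bind fun c =>
        (lawPair (B (L i)) (f i) (g i) (pos i) (s i) (μ i) (δ i) c).map fun z => (c, z))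
      fun i => (encTapes (B (L i))).bind fun c =>
        (simPair (B (L i)) (F (L i)) ((∑ a, f i (pos i a)) - μ i)
          (s i * (∑ a, g i (pos i a)) - δ i) c).map fun z => (c, z) := by
  let R : I → Type := fun i => Bits (B (L i)).he.genLen ×
    (Fin (m (L i)) → Bits (B (L i)).he.encLen) × (B (L i)).he.CT
  let O : I → Type := fun i => EncTapes (B (L i)) × (B (L i)).he.CT × (B (L i)).he.CT
  let Ω : I → Type := fun i => Fin (m (L i)) → Bits (B (L i)).he.encLen
  have hΩ : PT L (fun i => p (L i)) (α := R) fun i _ => unif (Ω i) :=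
    PT.unif_pi (PolyBounded.polyBdd hm) (PT.unif_bits (PolyBounded.polyBdd (N := L) hE.2.2.2.2.1))
  -- First the ciphertext ν is replaced. The game reveals the key holder's tapes for the first
  -- table; the reduction adds tapes for the second and evaluates ν' honestly.
  have e1 := (hν L f pos s μ).1.bind_pt (β := O)
    (g := fun i x => (unif (Ω i)).bind fun ω' =>
      (lawν' (B (L i)) ((B (L i)).he.keyGen x.1).1 (fun a =>
        encTable (B (L i)) ((B (L i)).he.keyGen x.1).1 (g i) ω' (pos i a)) (s i) (δ i)).bind
      fun ν' => PMF.pure ((x.1, x.2.1, ω'), x.2.2, ν'))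
    (PT.bind hΩ (PT.bind (f := fun (i : I) (y : R i × Ω i) =>
        lawν' (B (L i)) ((B (L i)).he.keyGen y.1.1).1 (fun a =>
        encTable (B (L i)) ((B (L i)).he.keyGen y.1.1).1 (g i) y.2 (pos i a)) (s i) (δ i))
      (hE.pt_lawν' hk (hE.dt_pk DT.id.fst.fst)
        (hE.dt_encTable_comp hk (hE.dt_pk DT.id.fst.fst) DT.id.snd g pos) s δ)
      (DT.prodMk (DT.prodMk DT.id.fst.fst.fst (DT.prodMk DT.id.fst.fst.snd.fst DT.id.fst.snd))
        (DT.prodMk DT.id.fst.fst.snd.snd DT.id.snd))))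
  -- Then the second table is the one in the game: the reduction draws tapes for the first, and ν is
  -- already simulated from its plaintext.
  have e2 := (hν L g pos s δ).2.bind_pt (β := O)
    (g := fun i x => (unif (Ω i)).bind fun ω' =>
      (F (L i) (((B (L i)).he.keyGen x.1).1, (∑ a, f i (pos i a)) - μ i)).bind
      fun ν => PMF.pure ((x.1, ω', x.2.1), ν, x.2.2))
    (PT.bind hΩ (PT.bind (f := fun (i : I) (y : R i × Ω i) =>
        F (L i) (((B (L i)).he.keyGen y.1.1).1, (∑ a, f i (pos i a)) - μ i))
      ((hF.pt L).comp (DT.prodMk (hE.dt_pk DT.id.fst.fst) (DT.constF _)))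
      (DT.prodMk (DT.prodMk DT.id.fst.fst.fst (DT.prodMk DT.id.fst.snd DT.id.fst.fst.snd.fst))
        (DT.prodMk DT.id.snd DT.id.fst.fst.snd.snd))))
  refine (CI.of_eq fun i => ?_).trans (e1.trans ((CI.of_eq fun i => ?_).trans
    (e2.trans (CI.of_eq fun i => ?_))))
  · simp only [encTapes, lawPair, PMF.map_bind, PMF.bind_bind, PMF.bind_map, PMF.map_comp,
      EncTapes.pk, Function.comp_def]
    refine congrArg _ (funext fun gen => congrArg _ (funext fun ωB => ?_))
    exact PMF.bind_comm _ _ _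
  · simp only [PMF.bind_bind, PMF.bind_map, Function.comp_def]
    refine congrArg _ (funext fun gen => ?_)
    exact bind_swap_pairs _ _ _ _ _
  · simp only [encTapes, simPair, PMF.map_bind, PMF.bind_bind, PMF.bind_map, PMF.map_comp,
      EncTapes.pk, Function.comp_def]
    refine congrArg _ (funext fun gen => (bind_swap_pairs _ _ _ _ _).trans ?_)
    exact congrArg _ (funext fun ωB => PMF.bind_comm _ _ _)

end

section

variable {p l k m n t : ℕ} [Fact p.Prime] (B : Blocks p l k m)

/-- Scalars and OT views do not depend on keys or tapes and can be drawn first. What remains is a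
context, the tapes, with t ciphertext pairs that are independent given it, as `CI.indep_context`
demands. -/
theorem encTapes_bind_indep (T : Tables B) (A : Fin t → PMF (QueryAux B))
    (K : Fin t → QueryAux B → EncTapes B → PMF (B.he.CT × B.he.CT)) (u : Fin t → ZMod p) :
    ((encTapes B).bind fun c => (indep t fun j => (A j).bind fun a =>
      (K j a c).map (serverQueryResult B (u j) a)).map (serverResult B T c)) =
    (indep t A).bind fun a => ((encTapes B).bind fun c =>
      (indep t fun j => K j (a j) c).map fun z => (c, z)).map fun y =>
        serverResult B T y.1 fun j => serverQueryResult B (u j) (a j) (y.2 j) := by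
  simp only [indep_bind, indep_map, PMF.map_bind, PMF.map_comp]
  rw [PMF.bind_comm]
  rfl

end

section

variable {p l k m n t : ℕ → ℕ} [∀ κ, Fact (p κ).Prime] {B : ∀ κ, Blocks (p κ) (l κ) (k κ) (m κ)}
  {I : Type} {L : I → ℕ}

theorem dt_serverResult (hsv : FewWires L (fun i => p (L i)) fun i => Tables (B (L i)))
    {α : I → Type} [∀ i, Data (p (L i)) (α i)] (T : ∀ i, Tables (B (L i)))
    {c : ∀ i, α i → EncTapes (B (L i))}
    {res : ∀ i, α i → Fin (t (L i)) → ServerQueryView (B (L i)) × ZMod (p (L i)) × ZMod (p (L i))}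
    (hc : DT L (fun i => p (L i)) c) (hres : DT L (fun i => p (L i)) res) :
    DT L (fun i => p (L i)) (β := fun i => ServerView (B (L i)) (t (L i)) ×
        Option (Fin (t (L i)) → ZMod (p (L i))) × Option (Fin (t (L i)) → ZMod (p (L i))))
      fun i x => serverResult (B (L i)) (T i) (c i x) (res i x) := by
  have hT := DT.const (α := α) hsv T
  exact DT.prodMk (DT.via (DT.prodMk hT.fst (DT.prodMk hc.fst (DT.prodMk hT.snd.fst
    (DT.some (DT.prodMk hT.snd.snd (DT.prodMk hc.snd.fst (DT.prodMk hc.snd.snd hres.pi_fst))))))))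
    (DT.prodMk hres.pi_snd.pi_fst.some hres.pi_snd.pi_snd.some)

/-- The server's simulator is correct. -/
theorem ci_serverSim (hh : HashEfficient p l k m fun κ => (B κ).hf)
    (hE : HEEfficient p fun κ => (B κ).he)
    (hk : PolyBounded k) (hm : PolyBounded m) (ht : PolyBounded t)
    (hB : TwoParty.Efficient p fun κ => (B κ).otB) (hF : TwoParty.Efficient p fun κ => (B κ).otF)
    {S₁ : ∀ κ, (Fin (k κ + 1) → Bool) × Unit → PMF (B κ).otB.View₀}
    {R₂ : ∀ κ, Fin 2 × ZMod (p κ) → PMF (B κ).otF.View₁}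
    {S₃ : ∀ κ, (Fin 2 → ZMod (p κ)) × Unit → PMF (B κ).otF.View₀}
    {F : ∀ κ, (B κ).he.PK × ZMod (p κ) → PMF (B κ).he.CT} (hFt : PolyTime p F)
    (h₁ : ∀ {I : Type} (L : I → ℕ) (a : ∀ i, Fin (k (L i) + 1) → Bool)
      (c : ∀ i, Fin (k (L i) + 1)), CI L (fun i => p (L i)) (fun i => S₁ (L i) (a i, ()))
        fun i => ((B (L i)).otB.exec (a i) (c i)).map fun e => e.1)
    (h₂ : ∀ {I : Type} (L : I → ℕ) (a : ∀ i, Fin 2 → ZMod (p (L i))) (c : I → Fin 2),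
      CI L (fun i => p (L i)) (fun i => R₂ (L i) (c i, a i (c i)))
        fun i => ((B (L i)).otF.exec (a i) (c i)).map fun e => e.2.1)
    (h₃ : ∀ {I : Type} (L : I → ℕ) (a : ∀ i, Fin 2 → ZMod (p (L i))) (c : I → Fin 2),
      CI L (fun i => p (L i)) (fun i => S₃ (L i) (a i, ()))
        fun i => ((B (L i)).otF.exec (a i) (c i)).map fun e => e.1)
    (hν : ∀ {I : Type} (L : I → ℕ) (f : ∀ i, Fin (m (L i)) → ZMod (p (L i)))
        (pos : ∀ i, Fin (k (L i)) → Fin (m (L i))) (s μ : ∀ i, ZMod (p (L i))),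
        CI L (fun i => p (L i)) (α := fun i => Bits (B (L i)).he.genLen ×
            (Fin (m (L i)) → Bits (B (L i)).he.encLen) × (B (L i)).he.CT)
          (fun i => (unif (Bits (B (L i)).he.genLen)).bind fun g =>
            (unif (Fin (m (L i)) → Bits (B (L i)).he.encLen)).bind fun ω =>
            (lawν (B (L i)) ((B (L i)).he.keyGen g).1 (fun a =>
              encTable (B (L i)) ((B (L i)).he.keyGen g).1 (f i) ω (pos i a)) (μ i)).map
              fun z => (g, ω, z))
          (fun i => (unif (Bits (B (L i)).he.genLen)).bind fun g =>
            (unif (Fin (m (L i)) → Bits (B (L i)).he.encLen)).bind fun ω =>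
            (F (L i) (((B (L i)).he.keyGen g).1, (∑ a, f i (pos i a)) - μ i)).map
              fun z => (g, ω, z)) ∧
        CI L (fun i => p (L i)) (α := fun i => Bits (B (L i)).he.genLen ×
            (Fin (m (L i)) → Bits (B (L i)).he.encLen) × (B (L i)).he.CT)
          (fun i => (unif (Bits (B (L i)).he.genLen)).bind fun g =>
            (unif (Fin (m (L i)) → Bits (B (L i)).he.encLen)).bind fun ω =>
            (lawν' (B (L i)) ((B (L i)).he.keyGen g).1 (fun a =>
              encTable (B (L i)) ((B (L i)).he.keyGen g).1 (f i) ω (pos i a)) (s i) (μ i)).map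
              fun z => (g, ω, z))
          (fun i => (unif (Bits (B (L i)).he.genLen)).bind fun g =>
            (unif (Fin (m (L i)) → Bits (B (L i)).he.encLen)).bind fun ω =>
            (F (L i) (((B (L i)).he.keyGen g).1, s i * (∑ a, f i (pos i a)) - μ i)).map
              fun z => (g, ω, z)))
    (XS : ∀ i, Fin (t (L i)) → Bits (l (L i)) × ZMod (p (L i)))
    (YG : ∀ i, Fin (n (L i)) → Bits (l (L i)) × ZMod (p (L i))) :
    CI L (fun i => p (L i)) (α := fun i => ServerView (B (L i)) (t (L i)) ×
        Option (Fin (t (L i)) → ZMod (p (L i))) × Option (Fin (t (L i)) → ZMod (p (L i))))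
      (fun i => (unif (Fin (t (L i)) → ZMod (p (L i)))).bind fun r =>
        (serverSim (B (L i)) (S₁ (L i)) (R₂ (L i)) (S₃ (L i)) (F (L i)) (YG i) (some r)).map
          fun v => (v, some (ssipTarget (XS i) (YG i) - r), some r))
      fun i => (ssipIdeal (B (L i)) (XS i) (YG i) false).map
        fun e => (e.2.1, e.2.2.1, e.2.2.2) := by
  let V : I → Type := fun i => ServerQueryView (B (L i)) × ZMod (p (L i)) × ZMod (p (L i))
  let O : I → Type := fun i => ServerView (B (L i)) (t (L i)) ×
    Option (Fin (t (L i)) → ZMod (p (L i))) × Option (Fin (t (L i)) → ZMod (p (L i)))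
  have hV : FewWires L (fun i => p (L i)) V :=
    (fewWires_serverQueryView hE hB hF).prod (fewWires_zmod.prod fewWires_zmod)
  let A : ∀ i, Tables (B (L i)) → Fin (t (L i)) → PMF (QueryAux (B (L i))) := fun i T j =>
    queryAux (B (L i)) (S₁ (L i)) (R₂ (L i)) (S₃ (L i)) (XS i j).2
      (bfSum (B (L i)) (XS i) (YG i) T.1 j) (gbfSum (B (L i)) (XS i) T.1 T.2.2 j)
      (isMember (XS i) (YG i) j)
  let K : ∀ i, Tables (B (L i)) → Fin (t (L i)) → QueryAux (B (L i)) → EncTapes (B (L i)) →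
      PMF ((B (L i)).he.CT × (B (L i)).he.CT) := fun i T j a c =>
    lawPair (B (L i)) (bfEntry (B (L i)) (YG i) T.1) T.2.2 (queryPos (B (L i)) (XS i) T.1 j)
      (XS i j).2 a.1.μ a.1.δ c
  let K' : ∀ i, Tables (B (L i)) → Fin (t (L i)) → QueryAux (B (L i)) → EncTapes (B (L i)) →
      PMF ((B (L i)).he.CT × (B (L i)).he.CT) := fun i T j a c =>
    simPair (B (L i)) (F (L i)) (bfSum (B (L i)) (XS i) (YG i) T.1 j - a.1.μ)
      ((XS i j).2 * gbfSum (B (L i)) (XS i) T.1 T.2.2 j - a.1.δ) c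
  -- Function privacy: with tables, scalars and simulated OT views fixed, simulated ciphertexts are
  -- exchanged for evaluated ones.
  have s1 : CI L (fun i => p (L i)) (α := O)
      (fun i => (tables (B (L i)) (YG i)).bind fun T => (encTapes (B (L i))).bind fun c =>
        (indep (t (L i)) fun j => (A i T j).bind fun a => (K' i T j a c).map
          (serverQueryResult (B (L i)) (ssipTarget (XS i) (YG i) j) a)).map
            (serverResult (B (L i)) T c))
      (fun i => (tables (B (L i)) (YG i)).bind fun T => (encTapes (B (L i))).bind fun c =>
        (indep (t (L i)) fun j => (A i T j).bind fun a => (K i T j a c).map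
          (serverQueryResult (B (L i)) (ssipTarget (XS i) (YG i) j) a)).map
            (serverResult (B (L i)) T c)) := by
    refine (CI.of_eq fun i => congrArg _ (funext fun T => encTapes_bind_indep (B (L i)) T (A i T)
      (K' i T) (ssipTarget (XS i) (YG i)))).trans (CI.trans ?_ (CI.of_eq fun i => congrArg _
      (funext fun T => (encTapes_bind_indep (B (L i)) T (A i T) (K i T)
        (ssipTarget (XS i) (YG i))).symm)))
    let J₀ : Type := Σ i, Tables (B (L i))
    let J : Type := Σ x : J₀, Fin (t (L x.1)) → QueryAux (B (L x.1))
    let J' : Type := Σ x : J, Fin (t (L x.1.1))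
    have key := ci_lawPair (I := J') (L := fun y => L y.1.1.1) hE hk hm hFt hν
      (fun y => bfEntry (B (L y.1.1.1)) (YG y.1.1.1) y.1.1.2.1) (fun y => y.1.1.2.2.2)
      (fun y => queryPos (B (L y.1.1.1)) (XS y.1.1.1) y.1.1.2.1 y.2)
      (fun y => (XS y.1.1.1 y.2).2) (fun y => (y.1.2 y.2).1.μ) (fun y => (y.1.2 y.2).1.δ)
    -- A hybrid over the queries: given the server's tapes, the pairs of the other queries,
    -- evaluated or simulated, can be produced efficiently.
    have ctx := CI.indep_context (I := J) (N := fun x => L x.1.1) (p := fun x => p (L x.1.1))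
      (n := fun x => t (L x.1.1)) (γ := fun x => EncTapes (B (L x.1.1)))
      (α := fun x => (B (L x.1.1)).he.CT × (B (L x.1.1)).he.CT)
      (PolyBounded.polyBdd ht) (P := fun x => encTapes (B (L x.1.1)))
      (A := fun x j => K' x.1.1 x.1.2 j (x.2 j)) (B := fun x j => K x.1.1 x.1.2 j (x.2 j))
      (hE.pt_simPair (I := J') (L := fun y => L y.1.1.1) hFt _ _)
      (hE.pt_lawPair (I := J') (L := fun y => L y.1.1.1) hk _ _ _ _ _ _) key.symm
    have c1 := (FewWires.pi (N := L) (p := fun i => p (L i)) (n := fun i => t (L i))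
      (PolyBounded.polyBdd ht)
      (fewWires_queryAux (B := B) hB hF)).reindex fun x : J => x.1.1
    have hz : DT (fun x : J => L x.1.1) (fun x => p (L x.1.1)) (α := fun x : J =>
        EncTapes (B (L x.1.1)) × (Fin (t (L x.1.1)) → (B (L x.1.1)).he.CT × (B (L x.1.1)).he.CT))
        fun x y => y.2 := DT.id.snd
    have avg := CI.average_sigma (I := J₀) (N := fun x => L x.1) (q := fun x => p (L x.1))
      (α := fun x => O x.1) (fun x => indep (t (L x.1)) (A x.1 x.2)) (ctx.map
      (g := fun x y => serverResult (B (L x.1.1)) x.1.2 y.1 fun j =>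
        serverQueryResult (B (L x.1.1)) (ssipTarget (XS x.1.1) (YG x.1.1) j) (x.2 j) (y.2 j))
      (dt_serverResult (L := fun x : J => L x.1.1) (fewWires_tables (B := B) hh hm)
        (fun x => x.1.2) DT.id.fst (DT.pi (PolyBounded.polyBdd ht)
          (dt_serverQueryResult (I := J') (L := fun y => L y.1.1.1) _
            (DT.const (α := fun x : J => EncTapes (B (L x.1.1)) ×
              (Fin (t (L x.1.1)) → (B (L x.1.1)).he.CT × (B (L x.1.1)).he.CT)) c1
              fun x => x.2).component hz.component))))
    exact CI.average_sigma (N := L) (q := fun i => p (L i)) (α := O)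
      (fun i => tables (B (L i)) (YG i)) avg
  -- With tables and tapes fixed, the simulated OT views are exchanged for real ones.
  have s2 : CI L (fun i => p (L i)) (α := O)
      (fun i => (tables (B (L i)) (YG i)).bind fun T => (encTapes (B (L i))).bind fun c =>
        (indep (t (L i)) fun j => (A i T j).bind fun a => (K i T j a c).map
          (serverQueryResult (B (L i)) (ssipTarget (XS i) (YG i) j) a)).map
            (serverResult (B (L i)) T c))
      fun i => (ssipIdeal (B (L i)) (XS i) (YG i) false).map
        fun e => (e.2.1, e.2.2.1, e.2.2.2) := by
    let J₀ : Type := Σ i, Tables (B (L i))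
    let J : Type := Σ x : J₀, EncTapes (B (L x.1))
    have key := CI.indep_congr_sigma (N := fun x : J => L x.1.1) (α := fun x => V x.1.1)
      (q := fun x => p (L x.1.1))
      (n := fun x : J => t (L x.1.1)) (PolyBounded.polyBdd ht)
      (hV.reindex fun x : J => x.1.1)
      (ci_serverQuery (I := Σ x : J, Fin (t (L x.1.1))) (L := fun y => L y.1.1.1)
        hE hB hF h₁ h₂ h₃
        (fun y => y.1.2.pk)
        (fun y a => encTable (B (L y.1.1.1)) y.1.2.pk (bfEntry (B (L y.1.1.1)) (YG y.1.1.1)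
          y.1.1.2.1) y.1.2.2.1 (queryPos (B (L y.1.1.1)) (XS y.1.1.1) y.1.1.2.1 y.2 a))
        (fun y a => encTable (B (L y.1.1.1)) y.1.2.pk y.1.1.2.2.2 y.1.2.2.2
          (queryPos (B (L y.1.1.1)) (XS y.1.1.1) y.1.1.2.1 y.2 a))
        (fun y => (XS y.1.1.1 y.2).2)
        (fun y => bfSum (B (L y.1.1.1)) (XS y.1.1.1) (YG y.1.1.1) y.1.1.2.1 y.2)
        (fun y => gbfSum (B (L y.1.1.1)) (XS y.1.1.1) y.1.1.2.1 y.1.1.2.2.2 y.2)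
        (fun y => ssipTarget (XS y.1.1.1) (YG y.1.1.1) y.2)
        (fun y => isMember (XS y.1.1.1) (YG y.1.1.1) y.2))
    have c1 : FewWires (fun x : J => L x.1.1) (fun x => p (L x.1.1))
        fun x : J => EncTapes (B (L x.1.1)) :=
      (fewWires_bits (PolyBounded.polyBdd hE.2.2.2.1)).prod
        ((FewWires.pi (PolyBounded.polyBdd hm) (fewWires_bits (PolyBounded.polyBdd hE.2.2.2.2.1))).prod
          (FewWires.pi (PolyBounded.polyBdd hm) (fewWires_bits (PolyBounded.polyBdd hE.2.2.2.2.1))))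
    have avg := CI.average_sigma (I := J₀) (N := fun x => L x.1) (q := fun x => p (L x.1))
      (α := fun x => O x.1) (fun x => encTapes (B (L x.1))) (key.map
      (g := fun x res => serverResult (B (L x.1.1)) x.1.2 x.2 res)
      (dt_serverResult (L := fun x : J => L x.1.1) (fewWires_tables (B := B) hh hm)
        (fun x => x.1.2) (DT.const c1 fun x => x.2) DT.id))
    have avg' := CI.average_sigma (N := L) (q := fun i => p (L i)) (α := O)
      (fun i => tables (B (L i)) (YG i)) avg
    refine (CI.of_eq fun i => ?_).trans (avg'.trans (CI.of_eq fun i => ?_))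
    · simp only [A, K, lawPair, PMF.map_bind, PMF.map_comp]
      rfl
    · rw [ssipIdeal_map_server]
  refine (CI.of_eq fun i => ?_).trans (s1.trans s2)
  rw [← serverSim_eq]
  refine congrArg _ (funext fun T => congrArg _ (funext fun c => congrArg _ (congrArg _
    (funext fun j => ?_))))
  -- The simulator's law is the same for all values of `s`, `C`, `G` and `pass`, so the actual ones
  -- may be inserted.
  rw [← serverQuerySim_eq (B (L i)) _ _ _ _ _ (XS i j).2 (bfSum (B (L i)) (XS i) (YG i) T.1 j)
    (gbfSum (B (L i)) (XS i) T.1 T.2.2 j) _ (isMember (XS i) (YG i) j)]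
  simp only [A, K', simPair, PMF.map_bind, PMF.map_comp]
  rfl

end

/- ## Computation of residues -/

theorem sum_testBit (a r : ℕ) :
    ∑ j : Fin r, (if a.testBit j then 2 ^ (j : ℕ) else 0) = a % 2 ^ r := by
  induction r with
  | zero => simp [Nat.mod_one]
  | succ r ih =>
    rw [Fin.sum_univ_castSucc, Nat.mod_pow_succ, ← ih]
    congr 1
    rw [Fin.val_last, Nat.testBit_eq_decide_div_mod_eq]
    rcases Nat.mod_two_eq_zero_or_one (a / 2 ^ r) with h | h <;> simp [h]

theorem iterP_ite_add {σ : Type} [AddCommMonoid σ] (r : ℕ) (b : Fin r → Bool) (c : Fin r → σ)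
    (s : σ) : iterP r (fun j s => PMF.pure (if b j then s + c j else s)) s =
      PMF.pure (s + ∑ j, if b j then c j else 0) := by
  induction r generalizing s with
  | zero => simp [iterP]
  | succ r ih =>
    rw [iterP, PMF.pure_bind, ih, Fin.sum_univ_succ]
    cases b 0 <;> simp [add_assoc]

theorem modIdx_add (k : ℕ) (a b : ℤ) : modIdx k (a + b) = modIdx k a + modIdx k b := by
  have h1 := Int.emod_nonneg a (show (k : ℤ) + 1 ≠ 0 by omega)
  have h2 := Int.emod_nonneg b (show (k : ℤ) + 1 ≠ 0 by omega)
  have h3 := Int.emod_nonneg (a + b) (show (k : ℤ) + 1 ≠ 0 by omega)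
  ext
  rw [Fin.val_add]
  simp only [modIdx]
  zify
  rw [Int.toNat_of_nonneg h1, Int.toNat_of_nonneg h2, Int.toNat_of_nonneg h3, ← Int.add_emod]

theorem modIdx_zero (k : ℕ) : modIdx k 0 = 0 := by
  ext
  simp [modIdx]

theorem modIdx_sub (k : ℕ) (a b : ℤ) : modIdx k (a - b) = modIdx k a - modIdx k b := by
  rw [eq_sub_iff_add_eq, ← modIdx_add, sub_add_cancel]

theorem modIdx_sum (k r : ℕ) (c : Fin r → ℤ) :
    modIdx k (∑ j, c j) = ∑ j, modIdx k (c j) :=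
  map_sum (⟨⟨modIdx k, modIdx_zero k⟩, modIdx_add k⟩ : ℤ →+ Fin (k + 1)) _ _

/-- For odd p, `x` lies in the upper half iff doubling it wraps around, iff the representative of x
+ x is odd. A binary digit thus replaces a comparison. For p = 2 no correction occurs, and x + x =
0. -/
theorem valMinAbs_eq_sub {p : ℕ} [Fact p.Prime] (x : ZMod p) :
    x.valMinAbs = (x.val : ℤ) - if (x + x).val.testBit 0 then (p : ℤ) else 0 := by
  have hpp := (Fact.out : p.Prime)
  have : NeZero p := ⟨hpp.ne_zero⟩
  have hx := x.val_lt
  rw [ZMod.valMinAbs_def_pos, ZMod.val_add, Nat.testBit_zero]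
  rcases hpp.eq_two_or_odd with rfl | hodd
  · rw [if_pos (by omega), if_neg (by simp only [decide_eq_true_eq]; omega)]
    simp
  · by_cases h : x.val ≤ p / 2
    · rw [if_pos h, Nat.mod_eq_of_lt (show x.val + x.val < p by omega), if_neg (by simp only [decide_eq_true_eq]; omega)]
      simp
    · rw [if_neg h, Nat.mod_eq_sub_mod (show x.val + x.val ≥ p by omega),
        Nat.mod_eq_of_lt (show x.val + x.val - p < p by omega),
        if_pos (by simp only [decide_eq_true_eq]; omega)]

section

variable {I : Type} {N p : I → ℕ} [∀ i, Fact (p i).Prime] {α : I → Type} [∀ i, Data (p i) (α i)]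
  {k : I → ℕ}

theorem DT.of_boole {c : ∀ i, α i → Prop} [∀ i a, Decidable (c i a)]
    (h : DT N p fun i a => if c i a then (1 : ZMod (p i)) else 0) :
    DT N p fun i a => decide (c i a) := by
  refine DT.of_bool ?_
  convert h using 3 with i a
  simp [_root_.bitF]

/-- Adding a constant cyclically permutes the wires of an indicator vector and needs no gate. -/
theorem DT.fin_add {f : ∀ i, α i → Fin (k i + 1)} (h : DT N p f) (c : ∀ i, Fin (k i + 1)) :
    DT N p fun i a => f i a + c i := by
  let φ : ∀ i, Fin (k i + 1) → Fin (k i + 1) := fun i o => o - c i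
  refine DT.comp (f := fun i (s : Fin (k i + 1)) => s + c i) (DT.of_wiring φ fun i s => ?_) h
  intro (o : Fin (k i + 1))
  change _root_.bitF _ (decide (o = s + c i)) = _root_.bitF _ (decide (o - c i = s))
  simp only [sub_eq_iff_eq_add]

variable {x : ∀ i, α i → ZMod (p i)}

/-- Each binary digit of the representative in [0, p) decides whether the constant 2^j modulo k+1 is
added; finally p is subtracted for the upper half. No division is performed. -/
theorem DT.modIdx_valMinAbs (hk : PolyBdd N k) (hp : PolyBdd N fun i => (p i).size)
    (hx : DT N p x) : DT N p fun i a => modIdx (k i) (x i a).valMinAbs := by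
  have hfin : FewWires N p fun i => Fin (k i + 1) := fewWires_fin (hk.add (polyBdd_const 1))
  let f : ∀ i, Fin (p i).size → α i → Fin (k i + 1) → PMF (Fin (k i + 1)) := fun i j a s =>
    PMF.pure (if (x i a).val.testBit j then s + modIdx (k i) (2 ^ (j : ℕ)) else s)
  have hf : PT (I := Σ i, Fin (p i).size) (fun y => N y.1) (fun y => p y.1)
      (α := fun y => α y.1 × Fin (k y.1 + 1)) fun y a => f y.1 y.2 a.1 a.2 := by
    have hx' : DT (I := Σ i, Fin (p i).size) (fun y => N y.1) (fun y => p y.1)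
        (α := fun y => α y.1 × Fin (k y.1 + 1)) fun y a => x y.1 a.1 :=
      (hx.reindex fun y : Σ i, Fin (p i).size => y.1).comp DT.id.fst
    exact DT.ite (hfin.reindex fun y : Σ i, Fin (p i).size => y.1) (hx'.bit fun y => y.2)
      (DT.fin_add DT.id.snd fun y : Σ i, Fin (p i).size => modIdx (k y.1) (2 ^ (y.2 : ℕ)))
      DT.id.snd
  have h1 : DT N p fun i a => modIdx (k i) (x i a).val := by
    have := (PT.iterP hp hf).comp (DT.prodMk (DT.id (α := α)) (DT.const hfin fun _ => 0))
    unfold DT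
    convert this using 3 with i a
    have e : ((x i a).val : ℤ) =
        ∑ j : Fin (p i).size, if (x i a).val.testBit j then (2 : ℤ) ^ (j : ℕ) else 0 := by
      have := sum_testBit (x i a).val (p i).size
      rw [Nat.mod_eq_of_lt ((ZMod.val_lt (x i a)).trans (Nat.lt_size_self (p i)))] at this
      rw [← this]
      push_cast
      rw [this]
    refine Eq.trans ?_ (iterP_ite_add _ _ _ _).symm
    change PMF.pure (modIdx (k i) ((x i a).val : ℤ)) = _
    rw [e, modIdx_sum, zero_add]
    refine congrArg _ (Finset.sum_congr rfl fun j _ => ?_)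
    split_ifs
    · rfl
    · exact modIdx_zero _
  have h2 := DT.ite hfin ((hx.add hx).bit fun _ => 0)
    (h1.fin_add fun i => -modIdx (k i) (p i)) h1
  convert h2 using 3 with i a
  rw [valMinAbs_eq_sub]
  split_ifs
  · rw [modIdx_sub, sub_eq_add_neg]
  · rw [sub_zero]

theorem DT.senderBits (hk : PolyBdd N k) (hp : PolyBdd N fun i => (p i).size)
    {b : ∀ i, α i → Bool} (hb : DT N p b) (hx : DT N p x) :
    DT N p fun i a => senderBits (k i) (b i a) (x i a) := by
  have hs := DT.modIdx_valMinAbs hk hp hx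
  have hn : DT N p fun i a => !(b i a) := by
    refine DT.of_bool ?_
    convert (DT.constF (fun _ => 1)).sub hb.bitF using 3 with i a
    cases b i a <;> simp [_root_.bitF]
  refine DT.pi (hk.add (polyBdd_const 1)) ?_
  -- On output wire i the condition that i is k minus the residue is rewritten as: the residue is k
  -- - i, a comparison with a constant.
  have h3 := DT.of_boole (DT.boole_fin_eq (hs.reindex fun y : Σ i, Fin (k i + 1) => y.1)
    fun y => modIdx (k y.1) (k y.1) - y.2)
  have h4 := DT.ite fewWires_bool h3 (hn.reindex fun y : Σ i, Fin (k i + 1) => y.1)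
    (hb.reindex fun y : Σ i, Fin (k i + 1) => y.1)
  convert h4 using 3 with y a
  unfold _root_.senderBits
  simp only [modIdx_sub, decide_eq_true_eq]
  refine if_congr ?_ rfl rfl
  rw [eq_sub_iff_add_eq, eq_sub_iff_add_eq]
  exact Eq.congr_left (add_comm _ _)

theorem DT.clientValues {b : ∀ i, α i → Bool} {δ Δ : ∀ i, α i → ZMod (p i)} (hb : DT N p b)
    (hδ : DT N p δ) (hΔ : DT N p Δ) :
    DT N p fun i a => clientValues (b i a) (δ i a) (Δ i a) :=
  DT.vec_two (hΔ.add (hb.bitF.mul hδ)) (hΔ.add (((DT.constF fun _ => 1).sub hb.bitF).mul hδ))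

theorem DT.serverValues {b : ∀ i, α i → Bool} {r ρ γ : ∀ i, α i → ZMod (p i)} (hb : DT N p b)
    (hr : DT N p r) (hρ : DT N p ρ) (hγ : DT N p γ) :
    DT N p fun i a => serverValues (b i a) (r i a) (ρ i a) (γ i a) :=
  have hb' := (DT.constF fun _ => 1).sub hb.bitF
  DT.vec_two ((hr.add (hb.bitF.mul (hρ.sub hγ))).sub (hb'.mul hγ))
    ((hr.add (hb'.mul (hρ.sub hγ))).sub (hb.bitF.mul hγ))

theorem DT.choice {b : ∀ i, α i → Bool} (hb : DT N p b) : DT N p fun i a => choice (b i a) :=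
  DT.ite (fewWires_fin (polyBdd_const 2)) hb (DT.const (fewWires_fin (polyBdd_const 2)) fun _ => 1)
    (DT.const (fewWires_fin (polyBdd_const 2)) fun _ => 0)

end

/- ## The simulators run in polynomial time -/

section

variable {p l k m n t : ℕ → ℕ} [∀ κ, Fact (p κ).Prime] {B : ∀ κ, Blocks (p κ) (l κ) (k κ) (m κ)}
  {I : Type} {L : I → ℕ} {α : I → Type} [∀ i, Data (p (L i)) (α i)]

theorem DT.getD_apply {N q n : I → ℕ} [∀ i, Fact (q i).Prime] {α : I → Type} [∀ i, Data (q i) (α i)]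
    {w : ∀ i, α i → Option (Fin (n i) → ZMod (q i))} (hw : DT N q w) (j : ∀ i, Fin (n i)) :
    DT N q fun i a => (w i a).getD 0 (j i) := by
  have := hw.wire fun i => Option.some (j i, ())
  convert this using 3 with i a
  change _ = Option.elim (w i a) 0 _
  cases w i a <;> rfl

theorem pt_queryTapes (hE : HEEfficient p fun κ => (B κ).he) (hk : PolyBounded k) :
    PT L (fun i => p (L i)) fun i (_ : α i) => queryTapes (B (L i)) := by
  have hs : PolyBdd L fun i => (B (L i)).he.sumLen (k (L i)) :=
    PolyBounded.polyBdd (hE.2.2.2.2.2.2.2.2 k hk).1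
  have hs2 : PolyBdd L fun i => (B (L i)).he.sumLen 2 :=
    PolyBounded.polyBdd (hE.2.2.2.2.2.2.2.2 (fun _ => 2) (polyBounded_const 2)).1
  have hm2 : PolyBdd L fun i => (B (L i)).he.mulLen 2 :=
    PolyBounded.polyBdd (hE.2.2.2.2.2.2.2.2 (fun _ => 2) (polyBounded_const 2)).2.1
  have he : PolyBdd L fun i => (B (L i)).he.encLen := PolyBounded.polyBdd hE.2.2.2.2.1
  refine PT.bind (PT.unif_bits hs) (PT.bind (PT.unif_bits he) (PT.bind (PT.unif_bits hs2)
    (PT.bind (PT.unif_bits hs) (PT.bind (PT.unif_bits he) (PT.bind (PT.unif_bits hm2)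
    (PT.bind (PT.unif_bits he) (PT.bind (PT.unif_bits hs2) ?_)))))))
  exact DT.prodMk DT.id.fst.fst.fst.fst.fst.fst.fst.snd (DT.prodMk DT.id.fst.fst.fst.fst.fst.fst.snd
    (DT.prodMk DT.id.fst.fst.fst.fst.fst.snd (DT.prodMk DT.id.fst.fst.fst.fst.snd
    (DT.prodMk DT.id.fst.fst.fst.snd (DT.prodMk DT.id.fst.fst.snd
    (DT.prodMk DT.id.fst.snd DT.id.snd))))))

variable
    {R₁ : ∀ κ, Fin (k κ + 1) × Bool → PMF (B κ).otB.View₁}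
    {S₁ : ∀ κ, (Fin (k κ + 1) → Bool) × Unit → PMF (B κ).otB.View₀}
    {S₂ : ∀ κ, (Fin 2 → ZMod (p κ)) × Unit → PMF (B κ).otF.View₀}
    {R₂ : ∀ κ, Fin 2 × ZMod (p κ) → PMF (B κ).otF.View₁}
    {F : ∀ κ, (B κ).he.PK × ZMod (p κ) → PMF (B κ).he.CT}

theorem pt_clientQuerySim (hE : HEEfficient p fun κ => (B κ).he) (hk : PolyBounded k)
    (hp : PolyBounded fun κ => (p κ).size) (h₁ : PolyTime p R₁) (h₂ : PolyTime p S₂)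
    (h₃ : PolyTime p R₂) :
    PT L (fun i => p (L i)) fun i w =>
      clientQuerySim (B (L i)) (R₁ (L i)) (S₂ (L i)) (R₂ (L i)) w := by
  refine PT.bind PT.rand (PT.bind PT.flip (PT.bind PT.rand (PT.bind PT.rand
    (PT.bind (pt_queryTapes hE hk) (PT.bind ((h₁.pt L).comp (DT.prodMk (DT.modIdx_valMinAbs
      (PolyBounded.polyBdd hk) (PolyBounded.polyBdd hp) DT.id.fst.fst.fst.fst.snd)
      DT.id.fst.fst.fst.snd)) (PT.bind ((h₂.pt L).comp (DT.prodMk (DT.clientValues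
        DT.id.fst.fst.fst.fst.snd DT.id.fst.fst.fst.snd DT.id.fst.fst.snd)
        (DT.const fewWires_unit fun _ => ()))) (PT.bind ((h₃.pt L).comp (DT.prodMk (DT.choice
          DT.id.fst.fst.fst.fst.fst.snd) (DT.id.fst.fst.fst.fst.fst.fst.fst.add
          DT.id.fst.fst.fst.snd))) ?_)))))))
  exact dt_clientQueryView (DT.prodMk DT.id.fst.fst.fst.fst.fst.fst.fst.snd
    (DT.prodMk DT.id.fst.fst.fst.fst.fst.fst.snd (DT.prodMk DT.id.fst.fst.fst.fst.fst.snd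
      (DT.prodMk DT.id.fst.fst.fst.fst.snd DT.id.fst.fst.fst.fst.fst.fst.fst.fst))))
    DT.id.fst.fst.fst.snd DT.id.fst.fst.snd DT.id.fst.snd DT.id.snd

theorem pt_serverQuerySim (hk : PolyBounded k)
    (hp : PolyBounded fun κ => (p κ).size) (h₁ : PolyTime p S₁) (h₂ : PolyTime p R₂)
    (h₃ : PolyTime p S₂) (hF : PolyTime p F) :
    PT L (fun i => p (L i)) fun i (y : (B (L i)).he.PK × ZMod (p (L i))) =>
      serverQuerySim (B (L i)) (S₁ (L i)) (R₂ (L i)) (S₂ (L i)) (F (L i)) y.1 y.2 := by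
  have hk' : PolyBdd L fun i => k (L i) := PolyBounded.polyBdd hk
  have hp' : PolyBdd L fun i => (p (L i)).size := PolyBounded.polyBdd hp
  refine PT.bind PT.rand (PT.bind PT.flip (PT.bind PT.rand (PT.bind PT.rand
    (PT.bind ((h₁.pt L).comp (DT.prodMk (DT.senderBits hk' hp' DT.id.fst.fst.snd DT.id.fst.fst.fst.snd)
      (DT.const fewWires_unit fun _ => ()))) (PT.bind ((h₂.pt L).comp (DT.prodMk
        (DT.choice DT.id.fst.fst.fst.snd) DT.id.fst.snd)) (PT.bind ((h₃.pt L).comp (DT.prodMk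
        (DT.serverValues DT.id.fst.fst.fst.fst.snd DT.id.fst.fst.snd DT.id.fst.fst.fst.snd
          DT.id.fst.fst.fst.fst.fst.fst.snd) (DT.const fewWires_unit fun _ => ())))
        (PT.bind ((hF.pt L).comp (DT.prodMk DT.id.fst.fst.fst.fst.fst.fst.fst.fst
          DT.id.fst.fst.fst.fst.fst.fst.snd)) (PT.bind ((hF.pt L).comp (DT.prodMk
          DT.id.fst.fst.fst.fst.fst.fst.fst.fst.fst DT.id.fst.fst.fst.fst.fst.snd)) ?_))))))))
  exact DT.via (DT.prodMk DT.id.fst.fst.fst.fst.fst.fst.fst.snd (DT.prodMk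
    DT.id.fst.fst.fst.fst.fst.fst.fst.fst.fst.snd (DT.prodMk DT.id.fst.snd (DT.prodMk DT.id.snd
    (DT.prodMk DT.id.fst.fst.fst.fst.snd (DT.prodMk DT.id.fst.fst.fst.snd DT.id.fst.fst.snd))))))

theorem HEEfficient.dt_encTable (h : HEEfficient p fun κ => (B κ).he) (hm : PolyBounded m)
    {pk : ∀ i, α i → (B (L i)).he.PK} {ω : ∀ i, α i → Fin (m (L i)) → Bits (B (L i)).he.encLen}
    (hpk : DT L (fun i => p (L i)) pk) (hω : DT L (fun i => p (L i)) ω)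
    (f : ∀ i, Fin (m (L i)) → ZMod (p (L i))) :
    DT L (fun i => p (L i)) fun i x => encTable (B (L i)) (pk i x) (f i) (ω i x) :=
  DT.pi (PolyBounded.polyBdd hm) (h.dt_enc (I := Σ i, Fin (m (L i))) (L := fun x => L x.1)
    (hpk.reindex fun x : Σ i, Fin (m (L i)) => x.1)
    (DT.constF fun x : Σ i, Fin (m (L i)) => f x.1 x.2) hω.component)

theorem pt_encTapes (hE : HEEfficient p fun κ => (B κ).he) (hm : PolyBounded m) :
    PT L (fun i => p (L i)) fun i (_ : α i) => encTapes (B (L i)) := by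
  have he : PolyBdd L fun i => (B (L i)).he.encLen := PolyBounded.polyBdd hE.2.2.2.2.1
  have hg : PolyBdd L fun i => (B (L i)).he.genLen := PolyBounded.polyBdd hE.2.2.2.1
  refine PT.bind (PT.unif_bits hg) (PT.bind (PT.unif_pi (PolyBounded.polyBdd hm) (PT.unif_bits he))
    (PT.bind (f := fun (i : I) _ => unif (Fin (m (L i)) → Bits (B (L i)).he.encLen))
      (PT.unif_pi (PolyBounded.polyBdd hm) (PT.unif_bits he)) ?_))
  exact DT.prodMk DT.id.fst.fst.snd (DT.prodMk DT.id.fst.snd DT.id.snd)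

theorem encPair_eq_map {p l k m : ℕ} [Fact p.Prime] (B : Blocks p l k m) (f g : Fin m → ZMod p) :
    encPair B f g = (encTapes B).map fun c =>
      (c.pk, encTable B c.pk f c.2.1, encTable B c.pk g c.2.2) := by
  simp only [encPair, encTapes, PMF.map_bind, PMF.map_comp]
  rfl

theorem pt_clientSim (hh : HashEfficient p l k m fun κ => (B κ).hf)
    (hE : HEEfficient p fun κ => (B κ).he) (hk : PolyBounded k) (hm : PolyBounded m)
    (ht : PolyBounded t)
    (hp : PolyBounded fun κ => (p κ).size) (h₁ : PolyTime p R₁) (h₂ : PolyTime p S₂)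
    (h₃ : PolyTime p R₂) :
    PT L (fun i => p (L i)) fun i (w : Option (Fin (t (L i)) → ZMod (p (L i)))) =>
      clientSim (B (L i)) (R₁ (L i)) (S₂ (L i)) (R₂ (L i)) w := by
  have hs : PolyBdd L fun i => (B (L i)).hf.seedLen := PolyBounded.polyBdd hh.1
  simp only [clientSim, encPair_eq_map, PMF.bind_map]
  let J : Type := Σ i, Fin (t (L i))
  let A : I → Type := fun i => (Option (Fin (t (L i)) → ZMod (p (L i))) ×
    Bits (B (L i)).hf.seedLen) × EncTapes (B (L i))
  have hw : DT L (fun i => p (L i)) (α := A) fun i a => a.1.1 := DT.id.fst.fst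
  refine PT.bind (PT.unif_bits hs) (PT.bind (pt_encTapes hE hm) (PT.bind
    (PT.indep (PolyBounded.polyBdd ht)
      ((pt_clientQuerySim (L := fun x : J => L x.1) hE hk hp h₁ h₂ h₃).comp
        ((hw.reindex fun x : J => x.1).getD_apply fun x => x.2))) ?_))
  have hc := hE.dt_encTapes_pk (DT.id (α := fun i => ((Option (Fin (t (L i)) → ZMod (p (L i))) ×
    Bits (B (L i)).hf.seedLen) × EncTapes (B (L i))) ×
      (Fin (t (L i)) → ClientQueryView (B (L i))))).fst.snd
  exact DT.via (DT.prodMk DT.id.fst.fst.snd (DT.prodMk hc (DT.some (DT.prodMk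
    (hE.dt_encTable hm hc DT.id.fst.snd.snd.fst _) (DT.prodMk
      (hE.dt_encTable hm hc DT.id.fst.snd.snd.snd _) DT.id.snd)))))

/-- The explicit sampler `gbfSample` is used and no abort is simulated; this is harmless because the
real protocol aborts with negligible probability only. -/
theorem pt_tables (hh : HashEfficient p l k m fun κ => (B κ).hf) (hk : PolyBounded k)
    (hm : PolyBounded m) (hn : PolyBounded n) (hp : PolyBounded fun κ => (p κ).size) :
    PT L (fun i => p (L i)) fun i (YG : Fin (n (L i)) → Bits (l (L i)) × ZMod (p (L i))) =>
      tables (B (L i)) YG := by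
  have hs : PolyBdd L fun i => (B (L i)).hf.seedLen := PolyBounded.polyBdd hh.1
  have hT : FewWires L (fun i => p (L i)) fun i => GBFTable (p (L i)) (m (L i)) :=
    FewWires.pi (PolyBounded.polyBdd hm) fewWires_zmod.option
  let J : Type := Σ i, Fin (n (L i))
  let A : I → Type := fun i =>
    (Fin (n (L i)) → Bits (l (L i)) × ZMod (p (L i))) × Bits (B (L i)).hf.seedLen
  have hp' : PolyBdd L fun i => (p (L i)).size := PolyBounded.polyBdd hp
  have hY : DT L (fun i => p (L i)) (α := A) fun i a => a.1 := DT.id.fst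
  have hseed : DT L (fun i => p (L i)) (α := A) fun i a => a.2 := DT.id.snd
  have hpos : DT L (fun i => p (L i)) (α := A) fun i a => keyPos (B (L i)) a.1 a.2 :=
    DT.pi (PolyBounded.polyBdd hn) ((hh.2.pt fun x : J => L x.1).comp (DT.prodMk
      (hseed.reindex fun x : J => x.1) hY.component.fst))
  refine PT.bind (PT.unif_bits hs) (PT.bind (PT.gbfSample (PolyBounded.polyBdd hk)
    (PolyBounded.polyBdd hm) (PolyBounded.polyBdd hn) hp' hpos
    DT.id.fst.pi_snd (DT.const hT _)) (PT.bind
      (PT.gbfFinish (PolyBounded.polyBdd hm) DT.id.snd) ?_))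
  exact DT.prodMk DT.id.fst.fst.snd (DT.prodMk DT.id.fst.snd DT.id.snd)

theorem pt_serverSim (hh : HashEfficient p l k m fun κ => (B κ).hf)
    (hE : HEEfficient p fun κ => (B κ).he) (hk : PolyBounded k) (hm : PolyBounded m)
    (hn : PolyBounded n) (ht : PolyBounded t)
    (hp : PolyBounded fun κ => (p κ).size) (h₁ : PolyTime p S₁) (h₂ : PolyTime p R₂)
    (h₃ : PolyTime p S₂) (hF : PolyTime p F) :
    PT L (fun i => p (L i)) fun i (y : (Fin (n (L i)) → Bits (l (L i)) × ZMod (p (L i))) ×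
        Option (Fin (t (L i)) → ZMod (p (L i)))) =>
      serverSim (B (L i)) (S₁ (L i)) (R₂ (L i)) (S₂ (L i)) (F (L i)) y.1 y.2 := by
  let J : Type := Σ i, Fin (t (L i))
  let A : I → Type := fun i => (((Fin (n (L i)) → Bits (l (L i)) × ZMod (p (L i))) ×
        Option (Fin (t (L i)) → ZMod (p (L i)))) × Tables (B (L i))) × EncTapes (B (L i))
  have hc : DT L (fun i => p (L i)) (α := A) fun i a => a.2.pk := hE.dt_encTapes_pk DT.id.snd
  have hw : DT L (fun i => p (L i)) (α := A) fun i a => a.1.1.2 := DT.id.fst.fst.snd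
  have hcw := DT.prodMk (hc.reindex fun x : J => x.1)
    ((hw.reindex fun x : J => x.1).getD_apply fun x => x.2)
  have h0 := (pt_serverQuerySim (B := B) (L := fun x : J => L x.1) hk hp h₁ h₂ h₃ hF).comp hcw
  have hq : PT L (fun i => p (L i)) (α := A) fun i a => indep (t (L i)) fun j =>
      serverQuerySim (B (L i)) (S₁ (L i)) (R₂ (L i)) (S₂ (L i)) (F (L i)) a.2.pk
        (a.1.1.2.getD 0 j) := by
    refine PT.indep (PolyBounded.polyBdd ht) ?_
    exact h0
  have hT : PT L (fun i => p (L i)) (α := fun i => (Fin (n (L i)) → Bits (l (L i)) × ZMod (p (L i))) ×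
      Option (Fin (t (L i)) → ZMod (p (L i)))) fun i y => tables (B (L i)) y.1 :=
    (pt_tables hh hk hm hn hp).comp DT.id.fst
  have hr : DT L (fun i => p (L i)) (α := fun i => A i × (Fin (t (L i)) → ServerQueryView (B (L i))))
      (β := fun i => ServerView (B (L i)) (t (L i))) fun i a =>
      { seed := a.1.1.2.1, gen := a.1.2.1, table := a.1.1.2.2.1,
        rest := some (a.1.1.2.2.2, a.1.2.2.1, a.1.2.2.2, a.2) } :=
    DT.via (DT.prodMk DT.id.fst.fst.snd.fst (DT.prodMk DT.id.fst.snd.fst (DT.prodMk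
      DT.id.fst.fst.snd.snd.fst (DT.some (DT.prodMk DT.id.fst.fst.snd.snd.snd (DT.prodMk
        DT.id.fst.snd.snd.fst (DT.prodMk DT.id.fst.snd.snd.snd DT.id.snd)))))))
  exact PT.bind hT (PT.bind (pt_encTapes hE hm) (PT.bind hq hr))

end

theorem SI.map {I : Type} {N : I → ℕ} {α β : I → Type} {X Y : ∀ i, PMF (α i)} (h : SI N X Y)
    (g : ∀ i, α i → β i) : SI N (fun i => (X i).map (g i)) fun i => (Y i).map (g i) :=
  let ⟨ε, hε, h⟩ := h
  ⟨ε, hε, fun i => (h i).bind_left _⟩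

end

theorem theorem1 (p l k m n t : ℕ → ℕ) [∀ κ, Fact (p κ).Prime]
    (hp : Negligible fun κ => 1 / (p κ : ℝ)) (hlog : PolyBounded fun κ => Nat.log 2 (p κ))
    (hl : PolyBounded l) (hk : PolyBounded k) (hm : PolyBounded m)
    (hn : PolyBounded n) (ht : PolyBounded t)
    (B : ∀ κ, Blocks (p κ) (l κ) (k κ) (m κ))
    (hhash : HashEfficient p l k m fun κ => (B κ).hf)
    (hBF : BFReliable l k m n fun κ => (B κ).hf)
    (hHE : HESecure p fun κ => (B κ).he)
    (hOTB : OTSecure p fun κ => (B κ).otB)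
    (hOTF : OTSecure p fun κ => (B κ).otF) :
    SecurelyRealizes p
      (In₀ := fun κ => Fin (t κ) → Bits (l κ) × ZMod (p κ))
      (In₁ := fun κ => Fin (n κ) → Bits (l κ) × ZMod (p κ))
      (View₀ := fun κ => ClientView (B κ) (t κ))
      (View₁ := fun κ => ServerView (B κ) (t κ))
      (Out₀ := fun κ => Option (Fin (t κ) → ZMod (p κ)))
      (Out₁ := fun κ => Option (Fin (t κ) → ZMod (p κ)))
      (fun _ _ YG => Function.Injective fun i => (YG i).1)
      (fun κ => ssip₁ (B κ))
      (fun _ => ssipFunctionality) := by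
  have hsize := polyBounded_size hlog
  obtain ⟨hE, hC, hS, hP⟩ := hHE
  obtain ⟨R₁, hR₁, hR₁'⟩ := hOTB.exists_receiver_view
  obtain ⟨S₁, hS₁, hS₁'⟩ := hOTB.exists_sender_view
  obtain ⟨R₂, hR₂, hR₂'⟩ := hOTF.exists_receiver_view
  obtain ⟨S₂, hS₂, hS₂'⟩ := hOTF.exists_sender_view
  obtain ⟨F, hF, hF'⟩ := hP.exists_sim_query hm hk
  -- The client's simulator uses its output alone; the server's also uses its input, to sample the
  -- tables.
  refine ⟨⟨fun κ x => clientSim (B κ) (R₁ κ) (S₂ κ) (R₂ κ) x.2, ?_, fun XS YG hY => ?_⟩,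
    fun κ x => serverSim (B κ) (S₁ κ) (R₂ κ) (S₂ κ) (F κ) x.1 x.2, ?_, fun XS YG hY => ?_⟩
  · exact PT.polyTime ((pt_clientSim (L := fun κ => κ) hhash hE hk hm ht hsize hR₁ hS₂ hR₂).comp
      DT.id.snd)
  -- The intermediate execution has `adj` set, because the client receives in the first and third
  -- transfers.
  · have key := (ci_clientSim (L := fun κ => κ) hhash hE hS hk hm ht hOTB.1 hOTF.1 hR₁' hS₂' hR₂'
      XS YG).trans ((si_ssipIdeal true hp hlog hk hm hn ht hBF hC hOTB hOTF XS YG hY).map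
        fun κ e => (e.1, e.2.2.1, e.2.2.2)).ci.symm
    refine CI.indist ((CI.of_eq fun κ => ?_).trans key)
    exact PMF.bind_bind _ _ _ |>.trans (congrArg _ (funext fun r => PMF.pure_bind _ _))
  · exact PT.polyTime (pt_serverSim (L := fun κ => κ) hhash hE hk hm hn ht hsize hS₁ hR₂ hS₂ hF)
  · have key := (ci_serverSim (L := fun κ => κ) hhash hE hk hm ht hOTB.1 hOTF.1 hF hS₁' hR₂' hS₂'
      hF' XS YG).trans ((si_ssipIdeal false hp hlog hk hm hn ht hBF hC hOTB hOTF XS YG hY).map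
        fun κ e => (e.2.1, e.2.2.1, e.2.2.2)).ci.symm
    refine CI.indist ((CI.of_eq fun κ => ?_).trans key)
    exact PMF.bind_bind _ _ _ |>.trans (congrArg _ (funext fun r => PMF.pure_bind _ _))
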